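/- Let $n\ge 2$, let $M$ be a smooth $n$-manifold and let $\Omega=d\alpha$ be an exact volume form on $M$, with $\alpha\in\Lambda^{n-1}(M)$ of class $C^1$. Let $V(x,t)$ be a time-dependent vector field on $M$, of class $C^1$ in $(x,t)$, except that $V$ may jump at finitely many times (on each time interval between consecutive jumps it is the restriction of a $C^1$ field). Assume that $V$ is globally Liouville, that is, $\imath_{V(\cdot,t)}\Omega=d\beta_t$ for every $t$ with $C^1$ forms $\beta_t\in\Lambda^{n-2}(M)$, and that $V$ has a complete flow $\varphi_{t,s}:M\to M$ that is $C^1$ in space, with $\varphi_{t,s}$ and $D\varphi_{t,s}$ continuous in $t$. Let $\lambda=\imath_V\alpha+\beta$ be the (time-dependent) Lagrangian form. Let $\tau\in\mathbb R$. For a compact oriented embedded $C^1$ submanifold $\Gamma_\tau\subset M$ of codimension one, with boundary (and possibly corners), put $\Gamma_t=\varphi_{t,\tau}(\Gamma_\tau)$, oriented by transport, with the induced orientation on $\partial\Gamma_t$. The *$\alpha$-surface area* of $\Gamma_t$ is $\int_{\Gamma_t}|\alpha|$, the integral of the unsigned density $|\alpha|$. Then: 1. The function $s\mapsto\int_{\partial\Gamma_s}\lambda$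 is integrable on bounded intervals. If the $\alpha$-surface area of $\Gamma_t$ tends to $0$ as $t\to-\infty$, then $$\int_{\Gamma_\tau}\alpha=\int_{-\infty}^{\tau}\Bigl(\int_{\partial\Gamma_s}\lambda\Bigr)ds ,$$ and if it tends to $0$ as $t\to+\infty$, then $$\int_{\Gamma_\tau}\alpha=-\int_{\tau}^{\infty}\Bigl(\int_{\partial\Gamma_s}\lambda\Bigr)ds ,$$ where the integrals over infinite intervals are convergent improper integrals, $\lim_{r\to-\infty}\int_r^\tau$ and $\lim_{r\to+\infty}\int_\tau^r$. 2. Let $\mathcal R_\tau\subset M$ be a compact embedded $n$-dimensional $C^1$ submanifold with boundary (and possibly corners), oriented by $\Omega$, whose outward-oriented boundary is a finite sum of oriented chains $\partial\mathcal R_\tau=\sum_j\Gamma^{j-}_\tau+\sum_i\Gamma^{i+}_\tau$, with $\Gamma^{j-}_\tau,\Gamma^{i+}_\tau$ as above (equality of chains means that both sides have the same integral for every $C^1$ form of degree $n-1$). If the $\alpha$-surface area of each $\Gamma^{j-}_t$ tends to $0$ as $t\to-\infty$ and that of each $\Gamma^{i+}_t$ tends to $0$ as $t\to+\infty$, then $$\mathrm{Vol}(\mathcal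 R_\tau)=\int_{\mathcal R_\tau}\Omega=\sum_j\int_{-\infty}^{\tau}\Bigl(\int_{\partial\Gamma^{j-}_s}\lambda\Bigr)ds-\sum_i\int_{\tau}^{\infty}\Bigl(\int_{\partial\Gamma^{i+}_s}\lambda\Bigr)ds .$$ -/

import Mathlib

open Set Filter Topology MeasureTheory
open scoped Manifold ContDiff

noncomputable section

namespace ActionFlux

/-! ### Differential forms on a manifold -/

section Forms

variable {E : Type*} [NormedAddCommGroup E] [NormedSpace ℝ E]
  {H : Type*} [TopologicalSpace H]

/-- Differential `k`-forms (no regularity imposed) on a manifold `M` with model `I`. -/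
abbrev DForm (I : ModelWithCorners ℝ E H) (M : Type*) [TopologicalSpace M] [ChartedSpace H M]
    (k : ℕ) : Type _ :=
  ∀ p : M, (TangentSpace I p) [⋀^Fin k]→L[ℝ] ℝ

variable {I : ModelWithCorners ℝ E H} {M : Type*} [TopologicalSpace M] [ChartedSpace H M] {k : ℕ}

/-- The coordinate expression of `θ` in the preferred chart at `x`, that is, the pullback of `θ`
under the inverse chart. It is meaningful on the target of the chart. -/
def localForm (θ : DForm I M k) (x : M) (y : E) : E [⋀^Fin k]→L[ℝ] ℝ :=
  (θ ((extChartAt I x).symm y)).compContinuousLinearMap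
    (mfderivWithin 𝓘(ℝ, E) I (extChartAt I x).symm (range I) y)

/-- The form is continuous (its coefficients are, in all charts). -/
def IsC0 (θ : DForm I M k) : Prop :=
  ∀ x : M, ContinuousOn (localForm θ x) (extChartAt I x).target

/-- The form is of class `C¹` (its coefficients are, in all charts). -/
def IsC1 (θ : DForm I M k) : Prop :=
  ∀ x : M, ContDiffOn ℝ 1 (localForm θ x) (extChartAt I x).target

/-- The exterior derivative: at `p`, differentiate the coordinate expression in the chart at `p`
and transport the result back to the tangent space at `p`. -/
def extD (θ : DForm I M k) : DForm I M (k + 1) := fun p =>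
  (extDerivWithin (localForm θ p) (range I) (extChartAt I p p)).compContinuousLinearMap
    (mfderiv I 𝓘(ℝ, E) (extChartAt I p) p)

/-- The interior product `ι_X θ = θ(X, ·, …, ·)`. -/
def contract (X : ∀ p : M, TangentSpace I p) (θ : DForm I M (k + 1)) : DForm I M k := fun p =>
  ContinuousAlternatingMap.curryLeft (E := E) (θ p) (X p)

/-- The pullback `f^* θ`. -/
def pullback {E' : Type*} [NormedAddCommGroup E'] [NormedSpace ℝ E'] {H' : Type*}
    [TopologicalSpace H'] {J : ModelWithCorners ℝ E' H'} {N : Type*} [TopologicalSpace N]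
    [ChartedSpace H' N] (f : N → M) (θ : DForm I M k) : DForm J N k := fun q =>
  (θ (f q)).compContinuousLinearMap (mfderiv J I f q)

end Forms

/-! ### Integration over compact manifolds with corners -/

/-- The model `[0, ∞)^d` of `d`-dimensional manifolds with corners. -/
abbrev Corners (d : ℕ) : ModelWithCorners ℝ (EuclideanSpace ℝ (Fin d)) (EuclideanQuadrant d) :=
  modelWithCornersEuclideanQuadrant d

section Integration

variable (d : ℕ) (N : Type*) [TopologicalSpace N] [T2Space N] [CompactSpace N]
  [ChartedSpace (EuclideanQuadrant d) N] [IsManifold (Corners d) ∞ N]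

/-- A smooth partition of unity subordinate to the domains of the preferred charts. -/
def chartPartition : SmoothPartitionOfUnity N (Corners d) N univ :=
  Classical.choose (SmoothPartitionOfUnity.exists_isSubordinate_chartAt_source (Corners d) N)

variable {d N}

/-- The coordinate vector `∂ᵢ`. -/
def coordVec {d : ℕ} (i : Fin d) : EuclideanSpace ℝ (Fin d) := EuclideanSpace.single i 1

/-- The sign (`1` or `-1`) of the coordinate frame `(∂₀, …, ∂_{d-1})` of the chart at `x`, at the
point with coordinates `y`, for the orientation given by the nowhere vanishing form `μ`. -/
def frameSign (μ : DForm (Corners d) N d) (x : N) (y : EuclideanSpace ℝ (Fin d)) : ℝ :=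
  (SignType.sign (localForm μ x y coordVec) : ℝ)

/-- `∫_N θ` for a form `θ` of top degree, where `N` is oriented by the nowhere vanishing top
form `μ`. -/
def formIntegral (μ θ : DForm (Corners d) N d) : ℝ :=
  ∑ᶠ x : N, ∫ y in {y : Fin d → ℝ | WithLp.toLp 2 y ∈ (extChartAt (Corners d) x).target},
    chartPartition d N x ((extChartAt (Corners d) x).symm (WithLp.toLp 2 y)) *
      (frameSign μ x (WithLp.toLp 2 y) * localForm θ x (WithLp.toLp 2 y) coordVec)

/-- `∫_N |θ|`, the total mass of the (unsigned) density `|θ|` of a form `θ` of top degree. -/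
def densityIntegral (θ : DForm (Corners d) N d) : ℝ :=
  ∑ᶠ x : N, ∫ y in {y : Fin d → ℝ | WithLp.toLp 2 y ∈ (extChartAt (Corners d) x).target},
    chartPartition d N x ((extChartAt (Corners d) x).symm (WithLp.toLp 2 y)) *
      |localForm θ x (WithLp.toLp 2 y) coordVec|

end Integration

section BoundaryIntegration

variable {k : ℕ} {N : Type*} [TopologicalSpace N] [T2Space N] [CompactSpace N]
  [ChartedSpace (EuclideanQuadrant (k + 1)) N] [IsManifold (Corners (k + 1)) ∞ N]

/-- The point with coordinates `z` of the face `{yᵢ = 0}` of `[0, ∞)^(k+1)`. -/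
def facePoint (i : Fin (k + 1)) (z : Fin k → ℝ) : EuclideanSpace ℝ (Fin (k + 1)) :=
  WithLp.toLp 2 (i.insertNth (0 : ℝ) z)

/-- `∫_{∂N} η` for a form `η` of degree `dim N - 1`, where `N` is oriented by `μ` and `∂N` carries
the induced orientation (outward vector first). In a chart, `∂N` consists of the faces `{yᵢ = 0}`,
on which `-∂ᵢ` points outwards, so that `(∂₀, …, ∂ᵢ omitted, …, ∂ₖ)` has the sign `-(-1)^i` times
that of `(∂₀, …, ∂ₖ)`. -/
def boundaryIntegral (μ : DForm (Corners (k + 1)) N (k + 1)) (η : DForm (Corners (k + 1)) N k) :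
    ℝ :=
  ∑ᶠ x : N, ∑ i : Fin (k + 1),
    ∫ z in {z : Fin k → ℝ | facePoint i z ∈ (extChartAt (Corners (k + 1)) x).target},
      chartPartition (k + 1) N x ((extChartAt (Corners (k + 1)) x).symm (facePoint i z)) *
        (-((-1 : ℝ) ^ (i : ℕ)) * frameSign μ x (facePoint i z) *
          localForm η x (facePoint i z) (fun j => coordVec (i.succAbove j)))

end BoundaryIntegration

/-! ### Compact submanifolds -/

section Submanifolds

variable {n : ℕ}

/-- A compact `d`-dimensional `C¹` submanifold with corners of the `n`-manifold `M`, given by a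
`C¹` embedding of a compact smooth manifold with corners. (The boundary may be smooth, or
empty.) -/
structure CompactSubmanifold (d n : ℕ) (M : Type*) [TopologicalSpace M]
    [ChartedSpace (EuclideanSpace ℝ (Fin n)) M] where
  /-- the parametrizing manifold -/
  carrier : Type
  [topology : TopologicalSpace carrier]
  [hausdorff : T2Space carrier]
  [compact : CompactSpace carrier]
  [charted : ChartedSpace (EuclideanQuadrant d) carrier]
  [smooth : IsManifold (Corners d) ∞ carrier]
  /-- the embedding -/
  emb : carrier → M
  contMDiff_emb : ContMDiff (Corners d) (𝓡 n) 1 emb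
  injective_emb : Function.Injective emb
  injective_mfderiv_emb : ∀ p, Function.Injective (mfderiv (Corners d) (𝓡 n) emb p)

attribute [instance] CompactSubmanifold.topology CompactSubmanifold.hausdorff
  CompactSubmanifold.compact CompactSubmanifold.charted CompactSubmanifold.smooth

/-- An oriented compact submanifold; the orientation is that of a continuous nowhere vanishing form
of top degree. -/
structure OrientedSubmanifold (d n : ℕ) (M : Type*) [TopologicalSpace M]
    [ChartedSpace (EuclideanSpace ℝ (Fin n)) M] extends CompactSubmanifold d n M where
  /-- a form that is positive on positively oriented frames -/
  orient : DForm (Corners d) carrier d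
  continuous_orient : IsC0 orient
  orient_ne_zero : ∀ p, orient p ≠ 0

end Submanifolds

/-! ### Time-dependent vector fields, flows, Lagrangian forms -/

section Dynamics

variable {n : ℕ} {M : Type*} [TopologicalSpace M] [ChartedSpace (EuclideanSpace ℝ (Fin n)) M]
  [IsManifold (𝓡 n) ∞ M]

/-- `V(x, t)` is jointly of class `C¹` in `(t, x)`. -/
def IsC1Field (V : ℝ → ∀ p : M, TangentSpace (𝓡 n) p) : Prop :=
  ContMDiff (𝓘(ℝ, ℝ).prod (𝓡 n)) (𝓡 n).tangent 1
    (fun q : ℝ × M => (⟨q.2, V q.1 q.2⟩ : TangentBundle (𝓡 n) M))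

/-- `V` is of class `C¹`, piecewise in time with possible jumps only at the times in `D`: on every
bounded open time interval that avoids `D` it agrees with a `C¹` vector field. -/
def IsPiecewiseC1Field (D : Set ℝ) (V : ℝ → ∀ p : M, TangentSpace (𝓡 n) p) : Prop :=
  ∀ a b : ℝ, Disjoint (Ioo a b) D →
    ∃ W : ℝ → ∀ p : M, TangentSpace (𝓡 n) p, IsC1Field W ∧ ∀ t ∈ Ioo a b, V t = W t

/-- `φ t s : M → M` is the complete flow of `V` from time `s` to time `t`; it is of class `C¹` in
space, the map and its derivative being continuous in time, and solves `∂ₜ φ = V` except possibly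
at the times in `D`. -/
structure IsFlow (D : Set ℝ) (V : ℝ → ∀ p : M, TangentSpace (𝓡 n) p) (φ : ℝ → ℝ → M → M) :
    Prop where
  refl : ∀ s x, φ s s x = x
  comp : ∀ t s r x, φ t s (φ s r x) = φ t r x
  contMDiff : ∀ t s, ContMDiff (𝓡 n) (𝓡 n) 1 (φ t s)
  continuous_tangentMap : ∀ s, Continuous
    (fun q : ℝ × TangentBundle (𝓡 n) M => tangentMap (𝓡 n) (𝓡 n) (φ q.1 s) q.2)
  hasDeriv : ∀ s x, ∀ t ∉ D, HasMFDerivAt 𝓘(ℝ, ℝ) (𝓡 n) (fun t' => φ t' s x) t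
    ((1 : ℝ →L[ℝ] ℝ).smulRight (V t (φ t s x)))

end Dynamics

section Liouville

variable {m : ℕ} {M : Type*} [TopologicalSpace M]
  [ChartedSpace (EuclideanSpace ℝ (Fin (m + 2))) M]

/-- `V` is globally Liouville for the volume form `Ω` with `ι_V Ω = dβ` at all times. -/
def IsGloballyLiouville (Ω : DForm (𝓡 (m + 2)) M (m + 2))
    (V : ℝ → ∀ p : M, TangentSpace (𝓡 (m + 2)) p) (β : ℝ → DForm (𝓡 (m + 2)) M m) : Prop :=
  ∀ t, IsC1 (β t) ∧ contract (V t) Ω = extD (β t)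

/-- The Lagrangian form `ι_V α + β` at time `t`. -/
def lagrangianForm (α : DForm (𝓡 (m + 2)) M (m + 1))
    (V : ℝ → ∀ p : M, TangentSpace (𝓡 (m + 2)) p) (β : ℝ → DForm (𝓡 (m + 2)) M m) (t : ℝ) :
    DForm (𝓡 (m + 2)) M m :=
  contract (V t) α + β t

/-- `∫_{f(Γ)} θ`, with the orientation transported from `Γ` by `f`. -/
def surfaceIntegral (Γ : OrientedSubmanifold (m + 1) (m + 2) M) (f : M → M)
    (θ : DForm (𝓡 (m + 2)) M (m + 1)) : ℝ :=
  formIntegral Γ.orient (pullback (f ∘ Γ.emb) θ)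

/-- The `θ`-surface area `∫_{f(Γ)} |θ|` of `f(Γ)`. -/
def surfaceArea (Γ : OrientedSubmanifold (m + 1) (m + 2) M) (f : M → M)
    (θ : DForm (𝓡 (m + 2)) M (m + 1)) : ℝ :=
  densityIntegral (pullback (J := Corners (m + 1)) (f ∘ Γ.emb) θ)

/-- `∫_{∂f(Γ)} η`, with the orientation induced on the boundary. -/
def edgeIntegral (Γ : OrientedSubmanifold (m + 1) (m + 2) M) (f : M → M)
    (η : DForm (𝓡 (m + 2)) M m) : ℝ :=
  boundaryIntegral Γ.orient (pullback (f ∘ Γ.emb) η)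

/-- The volume `∫_R |Ω|` of a compact region. -/
def regionVolume (Ω : DForm (𝓡 (m + 2)) M (m + 2)) (R : CompactSubmanifold (m + 2) (m + 2) M) : ℝ :=
  densityIntegral (pullback (J := Corners (m + 2)) R.emb Ω)

/-- `∂R = ∑ᵢ Γᵢ` as an equality of oriented `(n-1)`-chains, that is, both sides give the same
integral to every `C¹` form of degree `n-1`. Here `R` is oriented by `Ω` and `∂R` by the outward
normal. -/
def BoundaryEqSum (Ω : DForm (𝓡 (m + 2)) M (m + 2)) (R : CompactSubmanifold (m + 2) (m + 2) M)
    {ι : Type} [Fintype ι] (Γ : ι → OrientedSubmanifold (m + 1) (m + 2) M) : Prop :=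
  ∀ η : DForm (𝓡 (m + 2)) M (m + 1), IsC1 η →
    boundaryIntegral (pullback R.emb Ω) (pullback R.emb η) = ∑ i, surfaceIntegral (Γ i) id η

end Liouville

end ActionFlux

end

/-!
The rate of change of the action `∫_{Γ_t} α` is the flux `∫_{∂Γ_t} λ`, because the Lie derivative
of `α` along `V` is `ι_V dα + d(ι_V α) = d(β + ι_V α) = dλ` by Cartan's formula, and because of
Stokes' theorem. On a bounded time interval this gives
`∫_r^s (∫_{∂Γ_t} λ) dt = ∫_{Γ_s} α - ∫_{Γ_r} α` (`integral_edgeIntegral`). Since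
`|∫_{Γ_t} α|` is at most the `α`-surface area of `Γ_t`, one of the two terms disappears in the limit. The volume of a region is `∫_{∂R} α`, again
by Stokes' theorem, so it is the sum of the actions of the surfaces that make up the boundary.

The regularity is low: the forms, the submanifolds and the flow are only of class `C¹`. In
particular pullbacks of forms are merely continuous and have no exterior derivative in the naive
sense. The proof avoids this by representing a `C¹` form near a compact subset of `M` as the
pullback `e^* Θ` of a `C¹` form `Θ` on a vector space under a smooth map `e`, built from finitely
many charts (`exists_flatPullback_eq`). All forms in sight then are pullbacks `f^* Θ`
(`flatPullback`) under `C¹` maps `f` from a compact manifold with corners to a vector space.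

* Stokes' theorem `∫_N f^* dΘ = ∫_{∂N} f^* Θ` (`formIntegral_flatPullback_extDeriv`) is the
  divergence theorem on a box when `f` is `C²`, follows for `f` of class `C¹` by mollification
  (`boxStokes_of_contDiff_one`), and is globalized by a partition of unity. The members `ρ` of the
  partition are treated as additional components of the map: `ρ f^* Θ = (ρ, f)^* (s Θ)`,
  where `s` is the first coordinate (`scaledForm`).
* If `f` moves with velocity `w`, then `d/dt ∫_N f^* Θ` is the integral of the pullback under
  `(f, w)` of the form `ι_w dΘ + d(ι_w Θ)`, now a form on the space of pairs `(z, w)` (`lieForm`,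
  `hasDerivAt_formIntegral_flatPullback`). The integrand can be differentiated in time although
  `f` is only `C¹` in space, because the velocity is `C¹` in space
  (`hasDerivAt_deriv_of_continuousAt`).
* Pulled back under `(f, w)`, the form `ι_w dΘ` is `ι_V dα = dβ`, which is in turn represented as
  the pullback of an exact form on a vector space, so Stokes' theorem applies to the sum
  (`boundaryIntegral_pullback_lagrangian`).

The jumps of `V` are finitely many times, at which `∫_{Γ_t} α` is still continuous.
-/

noncomputable section
namespace ActionFlux

/-! ### Stokes' theorem on a box for pullbacks under `C¹` maps -/

section Box

variable {F : Type*} [NormedAddCommGroup F] [NormedSpace ℝ F] {k : ℕ}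

/-- Stokes' formula `∫_B f^* dΘ = ∫_{∂B} f^* Θ` on the box `B = [a, b]`, where `f'` plays the role
of the derivative of `f`. -/
def BoxStokes (a b : Fin (k + 1) → ℝ) (Θ : F → F [⋀^Fin k]→L[ℝ] ℝ) (f : (Fin (k + 1) → ℝ) → F)
    (f' : (Fin (k + 1) → ℝ) → (Fin (k + 1) → ℝ) →L[ℝ] F) : Prop :=
  ∫ y in Icc a b, extDeriv Θ (f y) (fun i => f' y (Pi.single i 1)) =
    ∑ i : Fin (k + 1),
      ((∫ z in Icc (a ∘ i.succAbove) (b ∘ i.succAbove), (-1 : ℝ) ^ (i : ℕ) *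
          Θ (f (i.insertNth (b i) z)) (fun j => f' (i.insertNth (b i) z)
            (Pi.single (i.succAbove j) 1))) -
        ∫ z in Icc (a ∘ i.succAbove) (b ∘ i.succAbove), (-1 : ℝ) ^ (i : ℕ) *
          Θ (f (i.insertNth (a i) z)) (fun j => f' (i.insertNth (a i) z)
            (Pi.single (i.succAbove j) 1)))

lemma continuous_alternating_apply {ι : Type*} [Fintype ι] {X : Type*} [TopologicalSpace X]
    {Θ : X → F [⋀^ι]→L[ℝ] ℝ} {v : X → ι → F} (hΘ : Continuous Θ) (hv : Continuous v) :
    Continuous (fun x => Θ x (v x)) := by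
  exact hΘ.eval hv

lemma continuous_extDeriv {Θ : F → F [⋀^Fin k]→L[ℝ] ℝ} (hΘ : ContDiff ℝ 1 Θ) :
    Continuous (extDeriv Θ) :=
  (ContinuousAlternatingMap.alternatizeUncurryFinCLM ℝ F ℝ).continuous.comp
    (hΘ.continuous_fderiv one_ne_zero)

/-- For a twice differentiable map the pullback of the form is differentiable, and the formula is
the divergence theorem for its coefficients. -/
lemma boxStokes_of_contDiff_two {a b : Fin (k + 1) → ℝ} (hab : a ≤ b)
    {Θ : F → F [⋀^Fin k]→L[ℝ] ℝ} (hΘ : ContDiff ℝ 1 Θ) {f : (Fin (k + 1) → ℝ) → F}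
    (hf : ContDiff ℝ 2 f) : BoxStokes a b Θ f (fderiv ℝ f) := by
  set ξ : (Fin (k + 1) → ℝ) → (Fin (k + 1) → ℝ) [⋀^Fin k]→L[ℝ] ℝ :=
    fun y => (Θ (f y)).compContinuousLinearMap (fderiv ℝ f y) with hξ
  have hd : ∀ y, HasFDerivAt ξ (fderiv ℝ ξ y) y := by
    intro y
    have h1 : DifferentiableAt ℝ (fun y => Θ (f y)) y :=
      ((hΘ.differentiable one_ne_zero) _).comp y ((hf.differentiable two_ne_zero) y)
    have h2 : DifferentiableAt ℝ (fderiv ℝ f) y :=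
      ((hf.fderiv_right (m := 1) (by norm_num)).differentiable one_ne_zero) y
    exact (h1.continuousAlternatingMapCompContinuousLinearMap h2).hasFDerivAt
  have hext : ∀ y, extDeriv ξ y = (extDeriv Θ (f y)).compContinuousLinearMap (fderiv ℝ f y) :=
    fun y => extDeriv_pullback ((hΘ.differentiable one_ne_zero) _) hf.contDiffAt (by simp)
  have hcoef : ∀ (i : Fin (k + 1)) y, HasFDerivAt
      (fun y => (-1 : ℝ) ^ (i : ℕ) * ξ y (fun j => Pi.single (i.succAbove j) 1))
      ((-1 : ℝ) ^ (i : ℕ) • (fderiv ℝ ξ y).flipAlternating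
        (fun j => Pi.single (i.succAbove j) 1)) y := by
    intro i y
    have := (hd y).continuousAlternatingMap_apply_const
      (fun j : Fin k => (Pi.single (i.succAbove j) 1 : Fin (k + 1) → ℝ))
    exact this.const_mul _
  have hsum : ∀ y, ∑ i : Fin (k + 1), ((-1 : ℝ) ^ (i : ℕ) • (fderiv ℝ ξ y).flipAlternating
        (fun j => (Pi.single (i.succAbove j) 1 : Fin (k + 1) → ℝ))) (Pi.single i 1)
      = extDeriv Θ (f y) (fun i => fderiv ℝ f y (Pi.single i 1)) := by
    intro y
    have := congrArg (fun A => A (fun i => (Pi.single i 1 : Fin (k + 1) → ℝ))) (hext y)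
    simp only [extDeriv, ContinuousAlternatingMap.alternatizeUncurryFin_apply] at this
    rw [ContinuousAlternatingMap.compContinuousLinearMap_apply] at this
    refine Eq.trans (Finset.sum_congr rfl fun i _ => ?_) this
    simp
    rfl
  have hcont : Continuous (fun y => extDeriv Θ (f y) (fun i => fderiv ℝ f y (Pi.single i 1))) :=
    continuous_alternating_apply ((continuous_extDeriv hΘ).comp hf.continuous)
      (continuous_pi fun i => (hf.continuous_fderiv two_ne_zero).clm_apply continuous_const)
  have := integral_divergence_of_hasFDerivAt_off_countable' a b hab
    (fun i y => (-1 : ℝ) ^ (i : ℕ) * ξ y (fun j => Pi.single (i.succAbove j) 1)) _ ∅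
    countable_empty (fun i y hy => (hcoef i y).continuousAt.continuousWithinAt)
    (fun y _ i => hcoef i y) (by
      simp_rw [hsum]
      exact hcont.continuousOn.integrableOn_compact isCompact_Icc)
  simp_rw [hsum] at this
  exact this

variable [FiniteDimensional ℝ F]

lemma tendsto_setIntegral_of_bounded {X P : Type*} [TopologicalSpace X] [MeasurableSpace X]
    [OpensMeasurableSpace X] [NormedAddCommGroup P] [ProperSpace P]
    [SecondCountableTopology P] {ν : Measure X} [IsFiniteMeasureOnCompacts ν]
    {K : Set X} (hK : IsCompact K) (hKm : MeasurableSet K) {J : P → ℝ} (hJ : Continuous J)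
    {u : ℕ → X → P} {v : X → P} {C : ℝ} (hu : ∀ n, ContinuousOn (u n) K)
    (hC : ∀ n, ∀ y ∈ K, ‖u n y‖ ≤ C) (hlim : ∀ y ∈ K, Tendsto (fun n => u n y) atTop (𝓝 (v y))) :
    Tendsto (fun n => ∫ y in K, J (u n y) ∂ν) atTop (𝓝 (∫ y in K, J (v y) ∂ν)) := by
  obtain ⟨B, hB⟩ := (isCompact_closedBall (0 : P) C).exists_bound_of_continuousOn hJ.continuousOn
  refine tendsto_integral_of_dominated_convergence (fun _ => B) (fun n => ?_) ?_ (fun n => ?_) ?_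
  · exact (hJ.comp_continuousOn (hu n)).aestronglyMeasurable hKm
  · exact integrableOn_const hK.measure_ne_top
  · exact (ae_restrict_mem hKm).mono fun y hy => hB _ (by simpa using hC n y hy)
  · exact (ae_restrict_mem hKm).mono fun y hy => (hJ.tendsto _).comp (hlim y hy)

lemma insertNth_mem_Icc {a b : Fin (k + 1) → ℝ} (i : Fin (k + 1)) {t : ℝ}
    (ht : t ∈ Icc (a i) (b i)) {z : Fin k → ℝ} (hz : z ∈ Icc (a ∘ i.succAbove) (b ∘ i.succAbove)) :
    i.insertNth t z ∈ Icc a b :=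
  (Fin.insertNth_mem_Icc (α := fun _ => ℝ)).2 ⟨ht, hz⟩

lemma continuous_insertNth (i : Fin (k + 1)) (t : ℝ) :
    Continuous (fun z : Fin k → ℝ => (i.insertNth t z : Fin (k + 1) → ℝ)) :=
  Continuous.finInsertNth i continuous_const continuous_id

/-- The formula is stable under bounded pointwise convergence of maps and derivatives. -/
lemma boxStokes_of_tendsto {a b : Fin (k + 1) → ℝ} (hab : a ≤ b)
    {Θ : F → F [⋀^Fin k]→L[ℝ] ℝ} (hΘ : ContDiff ℝ 1 Θ)
    {f : ℕ → (Fin (k + 1) → ℝ) → F} {f' : ℕ → (Fin (k + 1) → ℝ) → (Fin (k + 1) → ℝ) →L[ℝ] F}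
    {g : (Fin (k + 1) → ℝ) → F} {g' : (Fin (k + 1) → ℝ) → (Fin (k + 1) → ℝ) →L[ℝ] F}
    (h : ∀ n, BoxStokes a b Θ (f n) (f' n)) (hc : ∀ n, ContinuousOn (f n) (Icc a b))
    (hc' : ∀ n, ContinuousOn (f' n) (Icc a b)) {C : ℝ}
    (hC : ∀ n, ∀ y ∈ Icc a b, ‖f n y‖ ≤ C) (hC' : ∀ n, ∀ y ∈ Icc a b, ‖f' n y‖ ≤ C)
    (hlim : ∀ y ∈ Icc a b, Tendsto (fun n => f n y) atTop (𝓝 (g y)))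
    (hlim' : ∀ y ∈ Icc a b, Tendsto (fun n => f' n y) atTop (𝓝 (g' y))) :
    BoxStokes a b Θ g g' := by
  have : ProperSpace (F × ((Fin (k + 1) → ℝ) →L[ℝ] F)) := FiniteDimensional.proper ℝ _
  have hJ : ∀ (i : Fin (k + 1)), Continuous (fun p : F × ((Fin (k + 1) → ℝ) →L[ℝ] F) =>
      (-1 : ℝ) ^ (i : ℕ) * Θ p.1 (fun j => p.2 (Pi.single (i.succAbove j) 1))) := fun i =>
    continuous_const.mul (continuous_alternating_apply (hΘ.continuous.comp continuous_fst)
      (continuous_pi fun j => continuous_snd.clm_apply continuous_const))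
  have hJ' : Continuous (fun p : F × ((Fin (k + 1) → ℝ) →L[ℝ] F) =>
      extDeriv Θ p.1 (fun j => p.2 (Pi.single j 1))) :=
    continuous_alternating_apply ((continuous_extDeriv hΘ).comp continuous_fst)
      (continuous_pi fun j => continuous_snd.clm_apply continuous_const)
  have face : ∀ (i : Fin (k + 1)) (t : ℝ), t ∈ Icc (a i) (b i) → Tendsto (fun n =>
      ∫ z in Icc (a ∘ i.succAbove) (b ∘ i.succAbove), (-1 : ℝ) ^ (i : ℕ) *
          Θ (f n (i.insertNth t z)) (fun j => f' n (i.insertNth t z)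
            (Pi.single (i.succAbove j) 1))) atTop
      (𝓝 (∫ z in Icc (a ∘ i.succAbove) (b ∘ i.succAbove), (-1 : ℝ) ^ (i : ℕ) *
          Θ (g (i.insertNth t z)) (fun j => g' (i.insertNth t z)
            (Pi.single (i.succAbove j) 1)))) := by
    intro i t ht
    have hm : ∀ z ∈ Icc (a ∘ i.succAbove) (b ∘ i.succAbove), i.insertNth t z ∈ Icc a b :=
      fun z hz => insertNth_mem_Icc i ht hz
    exact tendsto_setIntegral_of_bounded (C := C)
      (u := fun n z => (f n (i.insertNth t z), f' n (i.insertNth t z)))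
      (v := fun z => (g (i.insertNth t z), g' (i.insertNth t z))) isCompact_Icc measurableSet_Icc
      (hJ i) (fun n => ((hc n).comp (continuous_insertNth i t).continuousOn hm).prodMk
        ((hc' n).comp (continuous_insertNth i t).continuousOn hm))
      (fun n z hz => norm_prod_le_iff.2 ⟨hC n _ (hm z hz), hC' n _ (hm z hz)⟩)
      (fun z hz => (hlim _ (hm z hz)).prodMk_nhds (hlim' _ (hm z hz)))
  have hL := tendsto_setIntegral_of_bounded (ν := volume) (C := C)
      (u := fun n z => (f n z, f' n z))
      (v := fun z => (g z, g' z)) (isCompact_Icc (a := a) (b := b)) measurableSet_Icc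
      hJ' (fun n => (hc n).prodMk (hc' n))
      (fun n z hz => norm_prod_le_iff.2 ⟨hC n _ hz, hC' n _ hz⟩)
      (fun z hz => (hlim _ hz).prodMk_nhds (hlim' _ hz))
  have hR := tendsto_finsetSum Finset.univ (fun i _ =>
    (face i (b i) (right_mem_Icc.2 (hab i))).sub (face i (a i) (left_mem_Icc.2 (hab i))))
  refine tendsto_nhds_unique (hL.congr fun n => h n) hR

/-- Mollification extends the formula to `C¹` maps defined on the whole space. -/
lemma boxStokes_of_contDiff_one {a b : Fin (k + 1) → ℝ} (hab : a ≤ b)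
    {Θ : F → F [⋀^Fin k]→L[ℝ] ℝ} (hΘ : ContDiff ℝ 1 Θ) {f : (Fin (k + 1) → ℝ) → F}
    (hf : ContDiff ℝ 1 f) (hsupp : HasCompactSupport f) : BoxStokes a b Θ f (fderiv ℝ f) := by
  open scoped Convolution in
  set φ : ℕ → ContDiffBump (0 : Fin (k + 1) → ℝ) := fun n =>
    ⟨1 / (2 * (n + 1 : ℝ)), 1 / (n + 1 : ℝ), by positivity, by
      apply one_div_lt_one_div_of_lt <;> linarith [(Nat.cast_nonneg n : (0 : ℝ) ≤ n)]⟩ with hφ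
  have hrout : Tendsto (fun n => (φ n).rOut) atTop (𝓝 0) := tendsto_one_div_add_atTop_nhds_zero_nat
  have hcf' : Continuous (fderiv ℝ f) := hf.continuous_fderiv one_ne_zero
  obtain ⟨C, hC⟩ := hsupp.exists_bound_of_continuous hf.continuous
  obtain ⟨C', hC'⟩ := (hsupp.fderiv ℝ).exists_bound_of_continuous hcf'
  have hbound : ∀ {G : Type _} [NormedAddCommGroup G] [NormedSpace ℝ G] [CompleteSpace G]
      (u : (Fin (k + 1) → ℝ) → G) (c : ℝ), Continuous u → (∀ y, ‖u y‖ ≤ c) → ∀ n y,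
      ‖((φ n).normed volume ⋆[ContinuousLinearMap.lsmul ℝ ℝ, volume] u) y‖ ≤ 3 * c := by
    intro G _ _ _ u c hu hc n y
    have h1 := (φ n).dist_normed_convolution_le (μ := volume) (x₀ := y) (ε := 2 * c)
      hu.aestronglyMeasurable (fun x _ => by
        rw [dist_eq_norm]; linarith [norm_sub_le (u x) (u y), hc x, hc y])
    rw [dist_eq_norm] at h1
    have h2 := norm_le_norm_add_norm_sub (u y)
      (((φ n).normed volume ⋆[ContinuousLinearMap.lsmul ℝ ℝ, volume] u) y)
    rw [norm_sub_rev] at h2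
    linarith [hc y]
  set h : ℕ → (Fin (k + 1) → ℝ) → F := fun n =>
    (φ n).normed volume ⋆[ContinuousLinearMap.lsmul ℝ ℝ, volume] f with hh
  have hsm : ∀ n, ContDiff ℝ 2 (h n) := fun n =>
    HasCompactSupport.contDiff_convolution_left _ (φ n).hasCompactSupport_normed
      (φ n).contDiff_normed (hf.continuous.locallyIntegrable)
  have hder : ∀ n y, fderiv ℝ (h n) y =
      ((φ n).normed volume ⋆[ContinuousLinearMap.lsmul ℝ ℝ, volume] (fderiv ℝ f)) y := by
    intro n y
    have := hsupp.hasFDerivAt_convolution_right (μ := volume) (ContinuousLinearMap.lsmul ℝ ℝ)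
      ((φ n).continuous_normed (μ := volume)).locallyIntegrable hf y
    exact this.fderiv
  refine boxStokes_of_tendsto hab hΘ (f := h) (f' := fun n => fderiv ℝ (h n))
    (C := max (3 * C) (3 * C')) (fun n => boxStokes_of_contDiff_two hab hΘ (hsm n))
    (fun n => (hsm n).continuous.continuousOn)
    (fun n => ((hsm n).continuous_fderiv two_ne_zero).continuousOn)
    (fun n y _ => (hbound f C hf.continuous hC n y).trans (le_max_left _ _))
    (fun n y _ => ?_) (fun y _ => ?_) (fun y _ => ?_)
  · rw [hder]
    exact (hbound _ C' hcf' hC' n y).trans (le_max_right _ _)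
  · exact ContDiffBump.convolution_tendsto_right_of_continuous hrout hf.continuous y
  · simp_rw [hder]
    exact ContDiffBump.convolution_tendsto_right_of_continuous hrout hcf' y

omit [FiniteDimensional ℝ F] in
lemma boxStokes_congr {a b : Fin (k + 1) → ℝ} (hab : a ≤ b) {Θ : F → F [⋀^Fin k]→L[ℝ] ℝ}
    {f g : (Fin (k + 1) → ℝ) → F} {f' g' : (Fin (k + 1) → ℝ) → (Fin (k + 1) → ℝ) →L[ℝ] F}
    (h : ∀ y ∈ Icc a b, f y = g y) (h' : ∀ y ∈ Icc a b, f' y = g' y)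
    (hf : BoxStokes a b Θ f f') : BoxStokes a b Θ g g' := by
  unfold BoxStokes at hf ⊢
  have e1 : ∫ y in Icc a b, extDeriv Θ (g y) (fun i => g' y (Pi.single i 1)) =
      ∫ y in Icc a b, extDeriv Θ (f y) (fun i => f' y (Pi.single i 1)) :=
    setIntegral_congr_fun measurableSet_Icc fun y hy => by simp only [h y hy, h' y hy]
  rw [e1, hf]
  refine Finset.sum_congr rfl fun i _ => congrArg₂ _ ?_ ?_
  · refine setIntegral_congr_fun measurableSet_Icc fun z hz => ?_
    have hm := insertNth_mem_Icc i (right_mem_Icc.2 (hab i)) hz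
    simp only [h _ hm, h' _ hm]
  · refine setIntegral_congr_fun measurableSet_Icc fun z hz => ?_
    have hm := insertNth_mem_Icc i (left_mem_Icc.2 (hab i)) hz
    simp only [h _ hm, h' _ hm]

/-- A smooth cutoff, equal to `1` near a compact set and supported in a given neighbourhood. -/
lemma exists_cutoff {E : Type*} [NormedAddCommGroup E] [NormedSpace ℝ E] [FiniteDimensional ℝ E]
    {K O : Set E} (hK : IsCompact K) (hO : IsOpen O) (hKO : K ⊆ O) :
    ∃ χ : E → ℝ, ContDiff ℝ ∞ χ ∧ (∀ᶠ y in 𝓝ˢ K, χ y = 1) ∧ HasCompactSupport χ ∧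
      tsupport χ ⊆ O := by
  obtain ⟨L, hL, hKL, hLO⟩ := exists_compact_between hK hO hKO
  have : ProperSpace E := FiniteDimensional.proper ℝ E
  obtain ⟨χ, h1, h0, -⟩ := exists_contMDiffMap_one_nhds_of_subset_interior (n := ⊤) 𝓘(ℝ, E)
    hK.isClosed hKL
  have hsub : tsupport χ ⊆ L :=
    closure_minimal (fun y hy => by_contra fun h => hy (h0 y h)) hL.isClosed
  exact ⟨χ, χ.contMDiff.contDiff, h1, hL.of_isClosed_subset (isClosed_tsupport _) hsub,
    hsub.trans hLO⟩

omit [FiniteDimensional ℝ F] in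
lemma contDiffOn_cutoff_smul {E : Type*} [NormedAddCommGroup E] [NormedSpace ℝ E]
    {χ : E → ℝ} (hχ : ContDiff ℝ ∞ χ) {O Q : Set E} (hO : IsOpen O) (hχO : tsupport χ ⊆ O)
    {f : E → F} (hf : ContDiffOn ℝ 1 f (Q ∩ O)) : ContDiffOn ℝ 1 (fun y => χ y • f y) Q := by
  intro y hy
  by_cases h : y ∈ tsupport χ
  · have hyO := hO.mem_nhds (hχO h)
    exact (hχ.of_le (by simp)).contDiffAt.contDiffWithinAt.smul
      ((contDiffWithinAt_inter hyO).1 (hf y ⟨hy, hχO h⟩))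
  · have : (fun y => χ y • f y) =ᶠ[𝓝 y] fun _ => 0 :=
      (notMem_tsupport_iff_eventuallyEq.1 h).mono fun z hz => by simp [hz]
    exact (contDiffAt_const.congr_of_eventuallyEq this).contDiffWithinAt

/-- Stokes' formula for a map that is `C¹` on the closed box. The map is precomposed with a
contraction towards the centre of the box, which makes it `C¹` near the box. -/
theorem boxStokes_of_contDiffOn {a b : Fin (k + 1) → ℝ} (hab : ∀ i, a i < b i)
    {Θ : F → F [⋀^Fin k]→L[ℝ] ℝ} (hΘ : ContDiff ℝ 1 Θ) {f : (Fin (k + 1) → ℝ) → F}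
    (hf : ContDiffOn ℝ 1 f (Icc a b)) :
    BoxStokes a b Θ f (fun y => fderivWithin ℝ f (Icc a b) y) := by
  have hab' : a ≤ b := fun i => (hab i).le
  have hud : UniqueDiffOn ℝ (Icc a b) := by
    rw [← pi_univ_Icc]
    exact UniqueDiffOn.univ_pi fun i => uniqueDiffOn_Icc (hab i)
  set O : Set (Fin (k + 1) → ℝ) := pi univ fun i => Ioo (a i) (b i) with hOdef
  have hO : IsOpen O := isOpen_set_pi finite_univ fun i _ => isOpen_Ioo
  have hOB : O ⊆ Icc a b := fun y hy => ⟨fun i => (hy i trivial).1.le, fun i => (hy i trivial).2.le⟩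
  set c : Fin (k + 1) → ℝ := fun i => (a i + b i) / 2 with hc
  set r : ℕ → ℝ := fun n => 1 - 1 / (n + 1 : ℝ) / 2 with hr
  have hn1 : ∀ n : ℕ, 0 < 1 / (n + 1 : ℝ) ∧ 1 / (n + 1 : ℝ) ≤ 1 := fun n =>
    ⟨by positivity, by rw [div_le_one (by positivity)]; linarith [(Nat.cast_nonneg n : (0 : ℝ) ≤
        n)]⟩
  have hr0 : ∀ n, 0 < r n ∧ r n < 1 := fun n => by
    have := hn1 n
    simp only [hr]
    constructor <;> linarith
  have hrlim : Tendsto r atTop (𝓝 1) := by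
    have := (tendsto_one_div_add_atTop_nhds_zero_nat (𝕜 := ℝ)).div_const 2
    simpa [hr] using this.const_sub 1
  set T : ℕ → (Fin (k + 1) → ℝ) → (Fin (k + 1) → ℝ) := fun n y => c + r n • (y - c) with hT
  have hTd : ∀ n y, HasFDerivAt (T n) (r n • ContinuousLinearMap.id ℝ (Fin (k + 1) → ℝ)) y :=
    fun n y => (((hasFDerivAt_id y).sub_const c).const_smul (r n)).const_add c
  have hTs : ∀ n, ContDiff ℝ 1 (T n) := fun n =>
    contDiff_const.add ((contDiff_id.sub contDiff_const).const_smul (r n))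
  have hTB : ∀ n, ∀ y ∈ Icc a b, T n y ∈ O := by
    intro n y hy i _
    have h0 := hr0 n
    have h1 := hy.1 i
    have h2 := hy.2 i
    have h3 := hab i
    simp only [hT, hc, Pi.add_apply, Pi.smul_apply, Pi.sub_apply, smul_eq_mul, mem_Ioo]
    constructor <;> nlinarith
  have hTlim : ∀ y, Tendsto (fun n => T n y) atTop (𝓝 y) := fun y => by
    have := (hrlim.smul_const (y - c)).const_add c
    simpa [hT] using this
  -- the contracted maps satisfy the formula
  have hstep : ∀ n, BoxStokes a b Θ (fun y => f (T n y))
      (fun y => r n • fderivWithin ℝ f (Icc a b) (T n y)) := by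
    intro n
    have hU : IsOpen (T n ⁻¹' O) := hO.preimage (hTs n).continuous
    obtain ⟨χ, hχ, hχ1, hχc, hχU⟩ := exists_cutoff (isCompact_Icc (a := a) (b := b)) hU (hTB n)
    have hs : ContDiffOn ℝ 1 (fun y => f (T n y)) (univ ∩ T n ⁻¹' O) := by
      rw [univ_inter]
      exact (hf.mono hOB).comp (hTs n).contDiffOn (fun y hy => hy)
    have hg := contDiffOn_univ.1 (contDiffOn_cutoff_smul hχ hU hχU hs)
    have hgc : HasCompactSupport (fun y => χ y • f (T n y)) := hχc.smul_right
    have hloc : ∀ y ∈ Icc a b, (fun y => χ y • f (T n y)) =ᶠ[𝓝 y] fun y => f (T n y) :=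
      fun y hy => (eventually_nhdsSet_iff_forall.1 hχ1 y hy).mono fun z hz => by simp [hz]
    refine boxStokes_congr hab' (fun y hy => (hloc y hy).self_of_nhds) (fun y hy => ?_)
      (boxStokes_of_contDiff_one hab' hΘ hg hgc)
    rw [(hloc y hy).fderiv_eq]
    have h1 : HasFDerivAt f (fderivWithin ℝ f (Icc a b) (T n y)) (T n y) :=
      ((hf.differentiableOn one_ne_zero _ (hOB (hTB n y hy))).hasFDerivWithinAt).hasFDerivAt
        (mem_of_superset (hO.mem_nhds (hTB n y hy)) hOB)
    have h2 := h1.comp y (hTd n y)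
    refine h2.fderiv.trans ?_
    ext v
    simp
  have hcf : ContinuousOn f (Icc a b) := hf.continuousOn
  have hcf' : ContinuousOn (fderivWithin ℝ f (Icc a b)) (Icc a b) :=
    hf.continuousOn_fderivWithin hud le_rfl
  have hTm : ∀ n, MapsTo (T n) (Icc a b) (Icc a b) := fun n y hy => hOB (hTB n y hy)
  obtain ⟨C, hC⟩ := isCompact_Icc.exists_bound_of_continuousOn hcf
  obtain ⟨C', hC'⟩ := isCompact_Icc.exists_bound_of_continuousOn hcf'
  have hTw : ∀ y ∈ Icc a b, Tendsto (fun n => T n y) atTop (𝓝[Icc a b] y) := fun y hy =>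
    tendsto_nhdsWithin_iff.2 ⟨hTlim y, Eventually.of_forall fun n => hTm n hy⟩
  refine boxStokes_of_tendsto hab' hΘ hstep (C := max C C')
    (fun n => hcf.comp (hTs n).continuous.continuousOn (hTm n))
    (fun n => (hcf'.comp (hTs n).continuous.continuousOn (hTm n)).const_smul (r n))
    (fun n y hy => (hC _ (hTm n hy)).trans (le_max_left _ _)) (fun n y hy => ?_)
    (fun y hy => (hcf y hy).tendsto.comp (hTw y hy)) (fun y hy => ?_)
  · rw [norm_smul, Real.norm_of_nonneg (hr0 n).1.le]
    refine le_trans ?_ ((hC' _ (hTm n hy)).trans (le_max_right _ _))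
    exact mul_le_of_le_one_left (norm_nonneg _) (hr0 n).2.le
  · have := hrlim.smul ((hcf' y hy).tendsto.comp (hTw y hy))
    simpa using this

end Box

/-! ### Pullbacks of forms on a vector space -/

section FlatPullback

variable {E : Type*} [NormedAddCommGroup E] [NormedSpace ℝ E]
  {H : Type*} [TopologicalSpace H] {I : ModelWithCorners ℝ E H}
  {M : Type*} [TopologicalSpace M] [ChartedSpace H M]
  {F : Type*} [NormedAddCommGroup F] [NormedSpace ℝ F] {k : ℕ}

/-- The pullback `f^* Θ` of a differential form on a normed space `F` under `f : M → F`. -/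
def flatPullback (I : ModelWithCorners ℝ E H) (f : M → F) (Θ : F → F [⋀^Fin k]→L[ℝ] ℝ) :
    DForm I M k := fun q =>
  (Θ (f q)).compContinuousLinearMap (mfderiv I 𝓘(ℝ, F) f q)

/-- The coordinate expression of a map to a normed space. -/
def coordMap (I : ModelWithCorners ℝ E H) (f : M → F) (x : M) (y : E) : F :=
  f ((extChartAt I x).symm y)

lemma range_inter_preimage_eq_target (x : M) :
    range I ∩ I.symm ⁻¹' (chartAt H x).target = (extChartAt I x).target := by
  rw [extChartAt_target, inter_comm]

lemma uniqueDiffWithinAt_of_mem_target {x : M} {y : E} (hy : y ∈ (extChartAt I x).target) :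
    UniqueDiffWithinAt ℝ (range I) y :=
  I.uniqueDiffOn _ (extChartAt_target_subset_range x hy)

variable [IsManifold I 1 M]

lemma contDiffOn_coordMap {f : M → F} (hf : ContMDiff I 𝓘(ℝ, F) 1 f) (x : M) :
    ContDiffOn ℝ 1 (coordMap I f x) (extChartAt I x).target :=
  contMDiffOn_iff_contDiffOn.1 (hf.comp_contMDiffOn (contMDiffOn_extChartAt_symm x))

lemma contDiffWithinAt_coordMap {f : M → F} (hf : ContMDiff I 𝓘(ℝ, F) 1 f) {x : M} {y : E}
    (hy : y ∈ (extChartAt I x).target) : ContDiffWithinAt ℝ 1 (coordMap I f x) (range I) y :=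
  (contDiffOn_coordMap hf x y hy).mono_of_mem_nhdsWithin
    (extChartAt_target_mem_nhdsWithin_of_mem hy)

lemma differentiableWithinAt_coordMap {f : M → F} (hf : ContMDiff I 𝓘(ℝ, F) 1 f) {x : M} {y : E}
    (hy : y ∈ (extChartAt I x).target) : DifferentiableWithinAt ℝ (coordMap I f x) (range I) y :=
  (contDiffWithinAt_coordMap hf hy).differentiableWithinAt one_ne_zero

omit [IsManifold I 1 M] in
lemma uniqueDiffOn_target (x : M) : UniqueDiffOn ℝ (extChartAt I x).target :=
  uniqueDiffOn_extChartAt_target x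

lemma continuousOn_fderivWithin_coordMap {f : M → F} (hf : ContMDiff I 𝓘(ℝ, F) 1 f) (x : M) :
    ContinuousOn (fderivWithin ℝ (coordMap I f x) (range I)) (extChartAt I x).target := by
  refine ((contDiffOn_coordMap hf x).continuousOn_fderivWithin (uniqueDiffOn_target x)
    le_rfl).congr fun y hy => ?_
  rw [fderivWithin_of_mem_nhdsWithin (mem_of_superset self_mem_nhdsWithin
    (extChartAt_target_subset_range x)) (uniqueDiffOn_target x y hy)
    (differentiableWithinAt_coordMap hf hy)]

lemma fderivWithin_coordMap {f : M → F} {x : M} {y : E} (hy : y ∈ (extChartAt I x).target)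
    (hf : MDifferentiableAt I 𝓘(ℝ, F) f ((extChartAt I x).symm y)) :
    fderivWithin ℝ (coordMap I f x) (range I) y =
      (mfderiv I 𝓘(ℝ, F) f ((extChartAt I x).symm y)).comp
        (mfderivWithin 𝓘(ℝ, E) I (extChartAt I x).symm (range I) y) := by
  rw [← mfderivWithin_eq_fderivWithin]
  exact mfderiv_comp_mfderivWithin y hf (mdifferentiableWithinAt_extChartAt_symm hy)
    (uniqueDiffWithinAt_of_mem_target hy).uniqueMDiffWithinAt

lemma localForm_flatPullback {f : M → F} {x : M} {y : E} (hy : y ∈ (extChartAt I x).target)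
    (hf : MDifferentiableAt I 𝓘(ℝ, F) f ((extChartAt I x).symm y))
    (Θ : F → F [⋀^Fin k]→L[ℝ] ℝ) :
    localForm (flatPullback I f Θ) x y = (Θ (coordMap I f x y)).compContinuousLinearMap
      (fderivWithin ℝ (coordMap I f x) (range I) y) := by
  rw [fderivWithin_coordMap hy hf]
  rfl

lemma continuousOn_localForm_flatPullback {f : M → F} (hf : ContMDiff I 𝓘(ℝ, F) 1 f)
    {Θ : F → F [⋀^Fin k]→L[ℝ] ℝ} (hΘ : Continuous Θ) (x : M) (v : Fin k → E) :
    ContinuousOn (fun y => localForm (flatPullback I f Θ) x y v) (extChartAt I x).target := by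
  have h : ContinuousOn (fun y => Θ (coordMap I f x y)
      (fun i => fderivWithin ℝ (coordMap I f x) (range I) y (v i))) (extChartAt I x).target :=
    (hΘ.comp_continuousOn (contDiffOn_coordMap hf x).continuousOn).eval
      (continuousOn_pi.2 fun i =>
        (continuousOn_fderivWithin_coordMap hf x).clm_apply continuousOn_const)
  refine h.congr fun y hy => ?_
  rw [localForm_flatPullback hy (hf.mdifferentiable one_ne_zero _)]
  rfl

end FlatPullback

/-! ### Top forms in two charts -/

section TopForms

variable {d : ℕ} {N : Type*} [TopologicalSpace N] [ChartedSpace (EuclideanQuadrant d) N]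

lemma coordVec_eq_basis (d : ℕ) :
    (coordVec : Fin d → EuclideanSpace ℝ (Fin d)) = (EuclideanSpace.basisFun (Fin d) ℝ).toBasis :=
        by
  ext i
  simp [coordVec]

lemma map_coordVec_ne_zero {A : EuclideanSpace ℝ (Fin d) [⋀^Fin d]→L[ℝ] ℝ} (hA : A ≠ 0) :
    A coordVec ≠ 0 := by
  intro h
  apply hA
  have : A.toAlternatingMap = 0 := by
    refine (AlternatingMap.map_basis_eq_zero_iff (EuclideanSpace.basisFun (Fin d) ℝ).toBasis _).1 ?_
    rw [← coordVec_eq_basis]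
    exact h
  exact ContinuousAlternatingMap.toAlternatingMap_injective this

lemma comp_coordVec (A : EuclideanSpace ℝ (Fin d) [⋀^Fin d]→L[ℝ] ℝ)
    (L : EuclideanSpace ℝ (Fin d) →L[ℝ] EuclideanSpace ℝ (Fin d)) :
    A.compContinuousLinearMap L coordVec = L.det * A coordVec := by
  set b := (EuclideanSpace.basisFun (Fin d) ℝ).toBasis
  have h := congrArg (fun B => B (L ∘ coordVec)) (A.toAlternatingMap.eq_smul_basis_det b)
  have h2 := b.det_comp (L : EuclideanSpace ℝ (Fin d) →ₗ[ℝ] EuclideanSpace ℝ (Fin d)) b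
  rw [b.det_self, mul_one] at h2
  have h3 : b.det (L ∘ coordVec) = L.det := by rw [coordVec_eq_basis]; exact h2
  simp only [AlternatingMap.smul_apply, h3, smul_eq_mul] at h
  refine Eq.trans h ?_
  rw [mul_comm, coordVec_eq_basis]
  rfl

variable [IsManifold (Corners d) ∞ N]

/-- The transition map from the chart at `x` to the chart at `x'`. -/
def transition (x x' : N) : EuclideanSpace ℝ (Fin d) → EuclideanSpace ℝ (Fin d) :=
  extChartAt (Corners d) x' ∘ (extChartAt (Corners d) x).symm

lemma transition_differentiableWithinAt {x x' : N} {y : EuclideanSpace ℝ (Fin d)}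
    (hy : y ∈ (extChartAt (Corners d) x).target)
    (hy' : (extChartAt (Corners d) x).symm y ∈ (extChartAt (Corners d) x').source) :
    DifferentiableWithinAt ℝ (transition x x') (range (Corners d)) y := by
  refine (contDiffWithinAt_ext_coord_change (I := Corners d) (n := 1) x' x
      ?_).differentiableWithinAt
    one_ne_zero
  rw [PartialEquiv.trans_source, PartialEquiv.symm_source]
  exact ⟨hy, hy'⟩

lemma localForm_transition {k : ℕ} (θ : DForm (Corners d) N k) {x x' : N}
    {y : EuclideanSpace ℝ (Fin d)} (hy : y ∈ (extChartAt (Corners d) x).target)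
    (hy' : (extChartAt (Corners d) x).symm y ∈ (extChartAt (Corners d) x').source) :
    localForm θ x y = (localForm θ x' (transition x x' y)).compContinuousLinearMap
      (fderivWithin ℝ (transition x x') (range (Corners d)) y) := by
  have hT : transition x x' y ∈ (extChartAt (Corners d) x').target :=
    (extChartAt (Corners d) x').map_source hy'
  have hinv : (extChartAt (Corners d) x').symm (transition x x' y) =
      (extChartAt (Corners d) x).symm y := (extChartAt (Corners d) x').left_inv hy'
  have hev : (extChartAt (Corners d) x).symm =ᶠ[𝓝[range (Corners d)] y]
      (extChartAt (Corners d) x').symm ∘ transition x x' := by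
    have h1 : ∀ᶠ z in 𝓝[range (Corners d)] y,
        (extChartAt (Corners d) x).symm z ∈ (extChartAt (Corners d) x').source :=
      ((continuousOn_extChartAt_symm x y hy).mono_of_mem_nhdsWithin
        (extChartAt_target_mem_nhdsWithin_of_mem hy)).eventually_mem
        ((isOpen_extChartAt_source x').mem_nhds hy')
    exact h1.mono fun z hz => ((extChartAt (Corners d) x').left_inv hz).symm
  have hD : @Eq (EuclideanSpace ℝ (Fin d) →L[ℝ] EuclideanSpace ℝ (Fin d))
      (mfderivWithin 𝓘(ℝ, EuclideanSpace ℝ (Fin d)) (Corners d) (extChartAt (Corners d) x).symm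
        (range (Corners d)) y)
      ((mfderivWithin 𝓘(ℝ, EuclideanSpace ℝ (Fin d)) (Corners d) (extChartAt (Corners d) x').symm
        (range (Corners d)) (transition x x' y)).comp
        (mfderivWithin 𝓘(ℝ, EuclideanSpace ℝ (Fin d)) 𝓘(ℝ, EuclideanSpace ℝ (Fin d))
          (transition x x') (range (Corners d)) y)) := by
    refine Eq.trans (hev.mfderivWithin_eq hinv.symm) ?_
    refine mfderivWithin_comp y (mdifferentiableWithinAt_extChartAt_symm hT)
      (transition_differentiableWithinAt hy hy').mdifferentiableWithinAt ?_
      (uniqueDiffWithinAt_of_mem_target hy).uniqueMDiffWithinAt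
    exact fun z _ => mem_range_self _
  rw [mfderivWithin_eq_fderivWithin] at hD
  have hθ : ∀ p q : N, p = q → @Eq (EuclideanSpace ℝ (Fin d) [⋀^Fin k]→L[ℝ] ℝ) (θ p) (θ q) := by
    rintro p q rfl
    rfl
  ext v
  have e1 : localForm θ x y v = (θ ((extChartAt (Corners d) x).symm y) :
      EuclideanSpace ℝ (Fin d) [⋀^Fin k]→L[ℝ] ℝ) (fun i => (mfderivWithin
      𝓘(ℝ, EuclideanSpace ℝ (Fin d)) (Corners d) (extChartAt (Corners d) x).symm
        (range (Corners d)) y : EuclideanSpace ℝ (Fin d) →L[ℝ] EuclideanSpace ℝ (Fin d)) (v i)) :=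
    rfl
  rw [e1, hD, hθ _ _ hinv.symm]
  rfl

/-- The contribution of the chart at `x` to the integral of `θ`, without the partition of unity. -/
def chartIntegral (μ θ : DForm (Corners d) N d) (x : N) : ℝ :=
  ∫ y in (extChartAt (Corners d) x).target, frameSign μ x y * localForm θ x y coordVec

omit [IsManifold (Corners d) ∞ N] in
lemma measurableSet_target (x : N) : MeasurableSet (extChartAt (Corners d) x).target := by
  rw [← range_inter_preimage_eq_target]
  exact (Corners d).isClosed_range.measurableSet.inter
    ((chartAt _ x).open_target.preimage (Corners d).continuous_symm).measurableSet

/-- The contribution of a chart to the integral of a form supported in two charts does not depend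
on the chart. -/
lemma chartIntegral_eq_of_support (μ θ : DForm (Corners d) N d) {x x' : N}
    (h : ∀ p, p ∉ (extChartAt (Corners d) x).source ∩ (extChartAt (Corners d) x').source → θ p = 0)
        :
    chartIntegral μ θ x = chartIntegral μ θ x' := by
  have hzero : ∀ (x : N) (y : EuclideanSpace ℝ (Fin d)), θ ((extChartAt (Corners d) x).symm y) = 0 →
      frameSign μ x y * localForm θ x y coordVec = 0 := by
    intro x y h
    have : localForm θ x y coordVec = 0 := by
      unfold localForm
      rw [h]
      rfl
    rw [this, mul_zero]
  have hS : ∀ x x' : N, (∀ p, p ∉ (extChartAt (Corners d) x).source ∩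
        (extChartAt (Corners d) x').source → θ p = 0) → chartIntegral μ θ x =
      ∫ y in (extChartAt (Corners d) x).target ∩
        (extChartAt (Corners d) x).symm ⁻¹' (extChartAt (Corners d) x').source,
        frameSign μ x y * localForm θ x y coordVec := by
    intro x x' h
    refine setIntegral_eq_of_subset_of_forall_sdiff_eq_zero (measurableSet_target x)
      inter_subset_left fun y hy => hzero x y (h _ fun hc => hy.2 ⟨hy.1, hc.2⟩)
  rw [hS x x' h, hS x' x fun p hp => h p fun hc => hp ⟨hc.2, hc.1⟩]
  set S := (extChartAt (Corners d) x).target ∩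
        (extChartAt (Corners d) x).symm ⁻¹' (extChartAt (Corners d) x').source with hSdef
  have hSm : MeasurableSet S := by
    obtain ⟨u, hu, hu'⟩ := (continuousOn_iff'.1 (continuousOn_extChartAt_symm (I := Corners d) x))
      _ (isOpen_extChartAt_source (I := Corners d) x')
    rw [hSdef, inter_comm, hu']
    exact hu.measurableSet.inter (measurableSet_target x)
  have himg : transition x x' '' S = (extChartAt (Corners d) x').target ∩
        (extChartAt (Corners d) x').symm ⁻¹' (extChartAt (Corners d) x).source := by
    ext z
    constructor
    · rintro ⟨y, ⟨hy, hy'⟩, rfl⟩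
      refine ⟨(extChartAt (Corners d) x').map_source hy', ?_⟩
      rw [mem_preimage, transition, Function.comp, (extChartAt (Corners d) x').left_inv hy']
      exact (extChartAt (Corners d) x).map_target hy
    · rintro ⟨hz, hz'⟩
      refine ⟨transition x' x z, ⟨(extChartAt (Corners d) x).map_source hz', ?_⟩, ?_⟩
      · rw [mem_preimage, transition, Function.comp, (extChartAt (Corners d) x).left_inv hz']
        exact (extChartAt (Corners d) x').map_target hz
      · simp only [transition, Function.comp]
        rw [(extChartAt (Corners d) x).left_inv hz', (extChartAt (Corners d) x').right_inv hz]
  have hinj : InjOn (transition x x') S := by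
    intro y hy z hz hyz
    have := (extChartAt (Corners d) x').injOn hy.2 hz.2 hyz
    exact (extChartAt (Corners d) x).symm.injOn hy.1 hz.1 this
  rw [← himg, integral_image_eq_integral_abs_det_fderiv_smul volume hSm
    (f' := fun y => fderivWithin ℝ (transition x x') (range (Corners d)) y)
    (fun y hy => (transition_differentiableWithinAt hy.1 hy.2).hasFDerivWithinAt.mono
      (inter_subset_left.trans (extChartAt_target_subset_range x))) hinj]
  refine setIntegral_congr_fun hSm fun y hy => ?_
  simp only [frameSign, localForm_transition μ hy.1 hy.2, localForm_transition θ hy.1 hy.2]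
  rw [comp_coordVec, comp_coordVec, sign_mul]
  set D := (fderivWithin ℝ (transition x x') (range (Corners d)) y).det
  rw [← self_mul_sign D, smul_eq_mul, SignType.coe_mul]
  ring

lemma setIntegral_toLp {G : Type*} [NormedAddCommGroup G] [NormedSpace ℝ G]
    (S : Set (EuclideanSpace ℝ (Fin d))) (h : EuclideanSpace ℝ (Fin d) → G) :
    ∫ y in {y : Fin d → ℝ | WithLp.toLp 2 y ∈ S}, h (WithLp.toLp 2 y) = ∫ y in S, h y :=
  (PiLp.volume_preserving_toLp (Fin d)).setIntegral_preimage_emb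
    (MeasurableEquiv.toLp 2 (Fin d → ℝ)).measurableEmbedding h S

end TopForms

/-! ### Stokes' theorem on a compact manifold with corners -/

section ScaledForm

variable {F : Type*} [NormedAddCommGroup F] [NormedSpace ℝ F] {k : ℕ}

/-- The form `s • Θ` on `ℝ × F`, where `s` is the first coordinate. Its pullback under `(ψ, f)` is
`ψ • f^* Θ`, and the pullback of its exterior derivative is `ψ • f^* dΘ + dψ ∧ f^* Θ`. -/
def scaledForm (Θ : F → F [⋀^Fin k]→L[ℝ] ℝ) (p : ℝ × F) : (ℝ × F) [⋀^Fin k]→L[ℝ] ℝ :=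
  p.1 • (Θ p.2).compContinuousLinearMap (ContinuousLinearMap.snd ℝ ℝ F)

lemma contDiff_scaledForm {Θ : F → F [⋀^Fin k]→L[ℝ] ℝ} (hΘ : ContDiff ℝ 1 Θ) :
    ContDiff ℝ 1 (scaledForm Θ) :=
  contDiff_fst.smul
    ((ContinuousAlternatingMap.compContinuousLinearMapCLM (ContinuousLinearMap.snd ℝ ℝ
        F)).contDiff.comp
      (hΘ.comp contDiff_snd))

lemma extDeriv_scaledForm_apply {Θ : F → F [⋀^Fin k]→L[ℝ] ℝ} (hΘ : ContDiff ℝ 1 Θ) (p : ℝ × F)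
    (v : Fin (k + 1) → ℝ × F) :
    extDeriv (scaledForm Θ) p v = p.1 * extDeriv Θ p.2 (fun i => (v i).2) +
      ∑ i : Fin (k + 1), (-1 : ℝ) ^ (i : ℕ) * ((v i).1 * Θ p.2 (fun j => (i.removeNth v j).2)) := by
  have hd : DifferentiableAt ℝ (scaledForm Θ) p :=
    (contDiff_scaledForm hΘ).differentiable one_ne_zero p
  have hΘd : ∀ z, DifferentiableAt ℝ Θ z := hΘ.differentiable one_ne_zero
  rw [extDeriv_apply hd, extDeriv_apply (hΘd _), Finset.mul_sum, ← Finset.sum_add_distrib]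
  refine Finset.sum_congr rfl fun i _ => ?_
  set w : Fin k → F := fun j => (i.removeNth v j).2 with hw
  have h1 : HasFDerivAt (fun z => Θ z w) (fderiv ℝ (fun z => Θ z w) p.2) p.2 :=
    ((hΘd p.2).continuousAlternatingMap_apply (fun i => differentiableAt_const (w i))).hasFDerivAt
  have h2 : HasFDerivAt (fun q : ℝ × F => scaledForm Θ q (i.removeNth v))
      (p.1 • (fderiv ℝ (fun z => Θ z w) p.2).comp (ContinuousLinearMap.snd ℝ ℝ F) +
        Θ p.2 w • ContinuousLinearMap.fst ℝ ℝ F) p :=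
    hasFDerivAt_fst.mul (h1.comp p hasFDerivAt_snd)
  rw [h2.fderiv]
  have h3 : (fun j => (i.removeNth (fun i => (v i).2)) j) = w := rfl
  simp only [add_apply, smul_apply, smul_eq_mul, zsmul_eq_mul,
    Int.cast_pow, Int.cast_neg, Int.cast_one, ContinuousLinearMap.comp_apply,
        ContinuousLinearMap.coe_snd', ContinuousLinearMap.coe_fst']
  change _ = p.1 * ((-1 : ℝ) ^ (i : ℕ) * (fderiv ℝ (fun z => Θ z w) p.2) (v i).2) + _
  ring

end ScaledForm

section Orientation

variable {d : ℕ} {N : Type*} [TopologicalSpace N] [ChartedSpace (EuclideanQuadrant d) N]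
  [IsManifold (Corners d) ∞ N]

lemma localForm_ne_zero {μ : DForm (Corners d) N d} (hμ : ∀ p, μ p ≠ 0) {x : N}
    {y : EuclideanSpace ℝ (Fin d)} (hy : y ∈ (extChartAt (Corners d) x).target) :
    localForm μ x y ≠ 0 := by
  intro h
  apply hμ ((extChartAt (Corners d) x).symm y)
  obtain ⟨e, he⟩ := isInvertible_mfderivWithin_extChartAt_symm (I := Corners d) hy
  ext v
  have h1 := congrArg (fun A => A (fun i => e.symm (v i))) h
  have h2 : localForm μ x y (fun i => e.symm (v i)) =
      μ ((extChartAt (Corners d) x).symm y) (fun i => (mfderivWithin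
        𝓘(ℝ, EuclideanSpace ℝ (Fin d)) (Corners d) (extChartAt (Corners d) x).symm
        (range (Corners d)) y) (e.symm (v i))) := rfl
  rw [← he] at h2
  simp only [ContinuousLinearEquiv.coe_coe, ContinuousLinearEquiv.apply_symm_apply] at h2
  exact h2.symm.trans h1

lemma abs_frameSign {μ : DForm (Corners d) N d} (hμ : ∀ p, μ p ≠ 0) {x : N}
    {y : EuclideanSpace ℝ (Fin d)} (hy : y ∈ (extChartAt (Corners d) x).target) :
    |frameSign μ x y| = 1 := by
  have h := map_coordVec_ne_zero (localForm_ne_zero hμ hy)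
  unfold frameSign
  rcases lt_or_gt_of_ne h with h | h
  · simp [sign_neg h]
  · simp [sign_pos h]

lemma eventually_frameSign_eq {μ : DForm (Corners d) N d} (hμ0 : IsC0 μ) (hμ : ∀ p, μ p ≠ 0)
    {x : N} {y : EuclideanSpace ℝ (Fin d)} (hy : y ∈ (extChartAt (Corners d) x).target) :
    ∀ᶠ z in 𝓝[range (Corners d)] y, frameSign μ x z = frameSign μ x y := by
  have h := map_coordVec_ne_zero (localForm_ne_zero hμ hy)
  have h1 : ContinuousWithinAt (fun z => localForm μ x z coordVec) (range (Corners d)) y :=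
    (((hμ0 x) y hy).eval continuousWithinAt_const).mono_of_mem_nhdsWithin
      (extChartAt_target_mem_nhdsWithin_of_mem hy)
  have h2 : ContinuousWithinAt (fun z => SignType.sign (localForm μ x z coordVec))
      (range (Corners d)) y :=
    (continuousAt_sign_of_ne_zero h).comp_continuousWithinAt
      (f := fun z => localForm μ x z coordVec) h1
  have h3 := h2.eventually_mem (IsOpen.mem_nhds (isOpen_discrete {SignType.sign
    (localForm μ x y coordVec)}) rfl)
  exact h3.mono fun z hz => by
    unfold frameSign
    rw [show SignType.sign (localForm μ x z coordVec) = _ from hz]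

lemma continuousOn_frameSign {μ : DForm (Corners d) N d} (hμ0 : IsC0 μ) (hμ : ∀ p, μ p ≠ 0)
    (x : N) : ContinuousOn (frameSign μ x) (extChartAt (Corners d) x).target := fun _ hy =>
  (continuousWithinAt_const.congr_of_eventuallyEq (eventually_frameSign_eq hμ0 hμ hy) rfl).mono
    (extChartAt_target_subset_range x)

end Orientation

section Partition

variable {d : ℕ} {N : Type*} [TopologicalSpace N] [T2Space N] [CompactSpace N]
  [ChartedSpace (EuclideanQuadrant d) N] [IsManifold (Corners d) ∞ N]

lemma tsupport_chartPartition (x : N) :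
    tsupport (chartPartition d N x) ⊆ (extChartAt (Corners d) x).source := by
  rw [extChartAt_source]
  exact Classical.choose_spec
    (SmoothPartitionOfUnity.exists_isSubordinate_chartAt_source (Corners d) N) x

lemma finite_chartPartition : {x : N | (Function.support (chartPartition d N x)).Nonempty}.Finite :=
  (chartPartition d N).locallyFinite.finite_nonempty_of_compact

variable (d N) in
/-- The finitely many charts that meet the partition of unity. -/
def activeCharts : Finset N := (finite_chartPartition (d := d) (N := N)).toFinset

lemma chartPartition_eq_zero {x : N} (hx : x ∉ activeCharts d N) (p : N) :
    chartPartition d N x p = 0 := by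
  by_contra h
  exact hx ((Finite.mem_toFinset _).2 ⟨p, h⟩)

lemma sum_chartPartition (p : N) : ∑ x ∈ activeCharts d N, chartPartition d N x p = 1 := by
  refine (chartPartition d N).sum_finsupport' p (mem_univ p) fun x hx => ?_
  by_contra h
  exact ((chartPartition d N).mem_finsupport p).1 hx (chartPartition_eq_zero h p)

/-- The coordinate image of the support of the member of the partition of unity at `x`. -/
def partitionImage (x : N) : Set (EuclideanSpace ℝ (Fin d)) :=
  extChartAt (Corners d) x '' tsupport (chartPartition d N x)

lemma isCompact_partitionImage (x : N) : IsCompact (partitionImage (d := d) x) :=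
  (isClosed_tsupport _).isCompact.image_of_continuousOn
    ((continuousOn_extChartAt x).mono (tsupport_chartPartition x))

lemma partitionImage_subset (x : N) :
    partitionImage (d := d) x ⊆ (extChartAt (Corners d) x).target := by
  rintro _ ⟨p, hp, rfl⟩
  exact (extChartAt (Corners d) x).map_source (tsupport_chartPartition x hp)

lemma notMem_tsupport_of_notMem_partitionImage {x : N} {y : EuclideanSpace ℝ (Fin d)}
    (hy : y ∈ (extChartAt (Corners d) x).target) (h : y ∉ partitionImage (d := d) x) :
    (extChartAt (Corners d) x).symm y ∉ tsupport (chartPartition d N x) := fun hp =>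
  h ⟨_, hp, (extChartAt (Corners d) x).right_inv hy⟩

lemma integrableOn_target {x : N} {h : EuclideanSpace ℝ (Fin d) → ℝ}
    (hc : ContinuousOn h (extChartAt (Corners d) x).target)
    (h0 : ∀ y ∈ (extChartAt (Corners d) x).target, y ∉ partitionImage (d := d) x → h y = 0) :
    IntegrableOn h (extChartAt (Corners d) x).target := by
  have hK := (hc.mono (partitionImage_subset x)).integrableOn_compact (μ := volume)
    (isCompact_partitionImage (d := d) x)
  exact hK.of_forall_sdiff_eq_zero (measurableSet_target x) fun y hy => h0 y hy.1 hy.2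

lemma formIntegral_eq_sum (μ θ : DForm (Corners d) N d) :
    formIntegral μ θ = ∑ x ∈ activeCharts d N,
      chartIntegral μ (fun p => chartPartition d N x p • θ p) x := by
  unfold formIntegral
  rw [finsum_eq_sum_of_support_subset (s := activeCharts d N)]
  · refine Finset.sum_congr rfl fun x _ => ?_
    rw [setIntegral_toLp _ (fun y => chartPartition d N x ((extChartAt (Corners d) x).symm y) *
      (frameSign μ x y * localForm θ x y coordVec))]
    refine integral_congr_ae (Eventually.of_forall fun y => ?_)
    have : localForm (fun p => chartPartition d N x p • θ p) x y coordVec =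
      chartPartition d N x ((extChartAt (Corners d) x).symm y) * localForm θ x y coordVec := rfl
    simp only [this]
    ring
  · intro x hx
    by_contra h
    apply hx
    simp only [chartPartition_eq_zero h]
    simp

end Partition

section Leibniz

variable {F : Type*} [NormedAddCommGroup F] [NormedSpace ℝ F] {k : ℕ}
  {E : Type*} [NormedAddCommGroup E] [NormedSpace ℝ E]
  {H : Type*} [TopologicalSpace H] {I : ModelWithCorners ℝ E H}
  {M : Type*} [TopologicalSpace M] [ChartedSpace H M]

/-- The form `d(ψ f^* Θ) = ψ f^* dΘ + dψ ∧ f^* Θ`, written as a pullback so that it makes sense for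
a map `f` that is only of class `C¹`. -/
def dScaledPullback (I : ModelWithCorners ℝ E H) (ψ : M → ℝ) (f : M → F)
    (Θ : F → F [⋀^Fin k]→L[ℝ] ℝ) : DForm I M (k + 1) :=
  flatPullback I (fun p => (ψ p, f p)) (extDeriv (scaledForm Θ))

variable [IsManifold I 1 M]

omit [IsManifold I 1 M] in
lemma contMDiff_pair {ψ : M → ℝ} {f : M → F} (hψ : ContMDiff I 𝓘(ℝ, ℝ) 1 ψ)
    (hf : ContMDiff I 𝓘(ℝ, F) 1 f) : ContMDiff I 𝓘(ℝ, ℝ × F) 1 (fun p => (ψ p, f p)) :=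
  hψ.prodMk_space hf

lemma fderivWithin_coordMap_pair {ψ : M → ℝ} {f : M → F} (hψ : ContMDiff I 𝓘(ℝ, ℝ) 1 ψ)
    (hf : ContMDiff I 𝓘(ℝ, F) 1 f) {x : M} {y : E} (hy : y ∈ (extChartAt I x).target) :
    fderivWithin ℝ (coordMap I (fun p => (ψ p, f p)) x) (range I) y =
      (fderivWithin ℝ (coordMap I ψ x) (range I) y).prod
        (fderivWithin ℝ (coordMap I f x) (range I) y) :=
  (differentiableWithinAt_coordMap hψ hy).fderivWithin_prodMk
    (differentiableWithinAt_coordMap hf hy) (uniqueDiffWithinAt_of_mem_target hy)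

lemma localForm_dScaledPullback {ψ : M → ℝ} {f : M → F} (hψ : ContMDiff I 𝓘(ℝ, ℝ) 1 ψ)
    (hf : ContMDiff I 𝓘(ℝ, F) 1 f) {Θ : F → F [⋀^Fin k]→L[ℝ] ℝ} (hΘ : ContDiff ℝ 1 Θ)
    {x : M} {y : E} (hy : y ∈ (extChartAt I x).target) (v : Fin (k + 1) → E) :
    localForm (dScaledPullback I ψ f Θ) x y v =
      coordMap I ψ x y * localForm (flatPullback I f (extDeriv Θ)) x y v +
        ∑ i : Fin (k + 1), (-1 : ℝ) ^ (i : ℕ) * (fderivWithin ℝ (coordMap I ψ x) (range I) y (v i) *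
          localForm (flatPullback I f Θ) x y (i.removeNth v)) := by
  unfold dScaledPullback
  rw [localForm_flatPullback hy ((contMDiff_pair hψ hf).mdifferentiable one_ne_zero _),
    localForm_flatPullback hy (hf.mdifferentiable one_ne_zero _),
    localForm_flatPullback hy (hf.mdifferentiable one_ne_zero _),
    fderivWithin_coordMap_pair hψ hf hy]
  exact extDeriv_scaledForm_apply hΘ _ _

omit [IsManifold I 1 M] in
lemma dScaledPullback_eq_zero {ψ : M → ℝ} {f : M → F} (hψ : ContMDiff I 𝓘(ℝ, ℝ) 1 ψ)
    (hf : ContMDiff I 𝓘(ℝ, F) 1 f) {Θ : F → F [⋀^Fin k]→L[ℝ] ℝ} (hΘ : ContDiff ℝ 1 Θ)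
    {p : M} (hp : p ∉ tsupport ψ) : dScaledPullback I ψ f Θ p = 0 := by
  have h0 : ψ =ᶠ[𝓝 p] fun _ => (0 : ℝ) := notMem_tsupport_iff_eventuallyEq.1 hp
  have hfst : ∀ v : TangentSpace I p,
      (mfderiv I 𝓘(ℝ, ℝ × F) (fun p => (ψ p, f p)) p v : ℝ × F).1 = 0 := by
    intro v
    have h1 := mfderiv_comp p (I' := 𝓘(ℝ, ℝ × F)) (I'' := 𝓘(ℝ, ℝ))
      (g := ContinuousLinearMap.fst ℝ ℝ F)
      (ContinuousLinearMap.fst ℝ ℝ F).differentiableAt.mdifferentiableAt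
      ((contMDiff_pair hψ hf).mdifferentiable one_ne_zero p)
    rw [ContinuousLinearMap.mfderiv_eq] at h1
    have h2 : mfderiv I 𝓘(ℝ, ℝ) ((ContinuousLinearMap.fst ℝ ℝ F) ∘ fun p => (ψ p, f p)) p = 0 := by
      have : ((ContinuousLinearMap.fst ℝ ℝ F) ∘ fun p => (ψ p, f p)) =ᶠ[𝓝 p] fun _ => (0 : ℝ) := h0
      exact this.mfderiv_eq.trans mfderiv_const
    rw [h2] at h1
    exact (congrArg (fun A => A v) h1).symm
  ext v
  refine (extDeriv_scaledForm_apply hΘ _ _).trans ?_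
  rw [show ((ψ p, f p) : ℝ × F).1 = 0 from h0.self_of_nhds, zero_mul, zero_add]
  exact Finset.sum_eq_zero fun i _ =>
    mul_eq_zero_of_right _ (mul_eq_zero_of_left (hfst _) _)

end Leibniz

section LocalStokes

variable {k : ℕ} {N : Type*} [TopologicalSpace N] [T2Space N] [CompactSpace N]
  [ChartedSpace (EuclideanQuadrant (k + 1)) N] [IsManifold (Corners (k + 1)) ∞ N]
  {F : Type*} [NormedAddCommGroup F] [NormedSpace ℝ F]

lemma mem_range_corners {d : ℕ} {y : EuclideanSpace ℝ (Fin d)} :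
    y ∈ range (Corners d) ↔ ∀ i, 0 ≤ y i := by
  have : range (Corners d) = {y | ∀ i, 0 ≤ y i} := range_euclideanQuadrant d
  rw [this]
  rfl

lemma contMDiff_chartPartition {d : ℕ} {N : Type*} [TopologicalSpace N] [T2Space N] [CompactSpace N]
    [ChartedSpace (EuclideanQuadrant d) N] [IsManifold (Corners d) ∞ N] (x : N) :
    ContMDiff (Corners d) 𝓘(ℝ, ℝ) 1 (chartPartition d N x) :=
  (chartPartition d N x).contMDiff.of_le (by simp)

/-- The contribution of the chart at `x` to the boundary integral. -/
def boundaryTerm (μ : DForm (Corners (k + 1)) N (k + 1)) (η : DForm (Corners (k + 1)) N k)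
    (x : N) : ℝ :=
  ∑ i : Fin (k + 1),
    ∫ z in {z : Fin k → ℝ | facePoint i z ∈ (extChartAt (Corners (k + 1)) x).target},
      chartPartition (k + 1) N x ((extChartAt (Corners (k + 1)) x).symm (facePoint i z)) *
        (-((-1 : ℝ) ^ (i : ℕ)) * frameSign μ x (facePoint i z) *
          localForm η x (facePoint i z) (fun j => coordVec (i.succAbove j)))

lemma boundaryIntegral_eq_sum (μ : DForm (Corners (k + 1)) N (k + 1))
    (η : DForm (Corners (k + 1)) N k) :
    boundaryIntegral μ η = ∑ x ∈ activeCharts (k + 1) N, boundaryTerm μ η x := by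
  refine finsum_eq_sum_of_support_subset _ fun x hx => ?_
  by_contra h
  apply hx
  simp only [chartPartition_eq_zero h]
  simp

lemma continuous_facePoint (i : Fin (k + 1)) : Continuous (facePoint i) :=
  (PiLp.continuous_toLp 2 _).comp (continuous_insertNth i 0)

/-- `toLp` as a continuous linear map. -/
def toLpL (d : ℕ) : (Fin d → ℝ) →L[ℝ] EuclideanSpace ℝ (Fin d) :=
  ((PiLp.continuousLinearEquiv 2 ℝ (fun _ : Fin d => ℝ)).symm :
    (Fin d → ℝ) →L[ℝ] EuclideanSpace ℝ (Fin d))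

/-- Stokes' formula in a corner for a map `h` with values in `ℝ × F`, whose first component is
supported in a compact set `K`. -/
lemma cornerStokes [FiniteDimensional ℝ F] {Θ : F → F [⋀^Fin k]→L[ℝ] ℝ} (hΘ : ContDiff ℝ 1 Θ)
    {h : EuclideanSpace ℝ (Fin (k + 1)) → ℝ × F}
    (hh : ContDiffOn ℝ 1 h (range (Corners (k + 1))))
    {K : Set (EuclideanSpace ℝ (Fin (k + 1)))} (hK : IsCompact K)
    (hKr : K ⊆ range (Corners (k + 1)))
    (h0 : ∀ y ∈ range (Corners (k + 1)), y ∉ K → (h y).1 = 0) :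
    (∫ y in K, extDeriv (scaledForm Θ) (h y)
      (fun i => fderivWithin ℝ h (range (Corners (k + 1))) y (coordVec i))) =
    ∑ i : Fin (k + 1), ∫ z in {z : Fin k → ℝ | facePoint i z ∈ K},
      -((-1 : ℝ) ^ (i : ℕ)) * scaledForm Θ (h (facePoint i z)) (fun j =>
        fderivWithin ℝ h (range (Corners (k + 1))) (facePoint i z) (coordVec (i.succAbove j))) := by
  set Q := range (Corners (k + 1)) with hQ
  have hud : UniqueDiffOn ℝ Q := (Corners (k + 1)).uniqueDiffOn
  obtain ⟨R, hR0, hR⟩ := hK.isBounded.exists_pos_norm_lt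
  -- off `K`, the pulled back forms vanish
  have hoff1 : ∀ y ∈ Q, y ∉ K → ∀ w : Fin k → EuclideanSpace ℝ (Fin (k + 1)),
      scaledForm Θ (h y) (fun j => fderivWithin ℝ h Q y (w j)) = 0 := by
    intro y hy hyK w
    simp [scaledForm, h0 y hy hyK]
  have hoff2 : ∀ y ∈ Q, y ∉ K → ∀ w : Fin (k + 1) → EuclideanSpace ℝ (Fin (k + 1)),
      extDeriv (scaledForm Θ) (h y) (fun j => fderivWithin ℝ h Q y (w j)) = 0 := by
    intro y hy hyK w
    have hz : (fun z => (h z).1) =ᶠ[𝓝[Q] y] fun _ => (0 : ℝ) := by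
      filter_upwards [self_mem_nhdsWithin, mem_nhdsWithin_of_mem_nhds
        (hK.isClosed.isOpen_compl.mem_nhds hyK)] with z hz hz'
      exact h0 z hz hz'
    have hd := (hh.differentiableOn one_ne_zero y hy).hasFDerivWithinAt
    have h1 : fderivWithin ℝ (fun z => (h z).1) Q y = 0 := by
      rw [hz.fderivWithin_eq_of_mem hy]
      simp
    rw [hd.fst.fderivWithin (hud y hy)] at h1
    have h2 : ∀ v, (fderivWithin ℝ h Q y v).1 = 0 := fun v => congrArg (fun A => A v) h1
    rw [extDeriv_scaledForm_apply hΘ, h0 y hy hyK]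
    simp [h2]
  set L := toLpL (k + 1) with hL
  have hLe : ∀ i : Fin (k + 1), L (Pi.single i 1) = coordVec i := fun i => rfl
  have hLf : ∀ y, L y = WithLp.toLp 2 y := fun y => rfl
  have hmaps : MapsTo L (Icc 0 (fun _ => R)) Q := fun y hy =>
    mem_range_corners.2 fun i => hy.1 i
  have hKbox : ∀ y, L y ∈ K → y ∈ Icc (0 : Fin (k + 1) → ℝ) (fun _ => R) := by
    intro y hy
    refine ⟨fun i => mem_range_corners.1 (hKr hy) i, fun i => ?_⟩
    have h1 := (le_abs_self _).trans (PiLp.norm_apply_le (L y) i)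
    exact h1.trans (hR _ hy).le
  have hbox := boxStokes_of_contDiffOn (a := (0 : Fin (k + 1) → ℝ)) (b := fun _ => R)
    (fun i => hR0) (contDiff_scaledForm hΘ) (f := fun y => h (L y))
    (hh.comp L.contDiff.contDiffOn hmaps)
  have hudB : UniqueDiffOn ℝ (Icc (0 : Fin (k + 1) → ℝ) (fun _ => R)) := by
    rw [← pi_univ_Icc]
    exact UniqueDiffOn.univ_pi fun i => uniqueDiffOn_Icc hR0
  have hbox' := boxStokes_congr (a := (0 : Fin (k + 1) → ℝ)) (b := fun _ => R)
    (fun i => hR0.le) (fun y _ => rfl)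
    (g' := fun y => (fderivWithin ℝ h Q (L y)).comp L) (fun y hy => by
      have hd := (hh.differentiableOn one_ne_zero (L y) (hmaps hy)).hasFDerivWithinAt
      exact (hd.comp y L.hasFDerivWithinAt hmaps).fderivWithin (hudB y hy)) hbox
  unfold BoxStokes at hbox'
  simp only [ContinuousLinearMap.comp_apply, hLe, Pi.zero_apply] at hbox'
  have hmeasK : MeasurableSet {y : Fin (k + 1) → ℝ | WithLp.toLp 2 y ∈ K} :=
    hK.isClosed.measurableSet.preimage L.continuous.measurable
  have hleft : (∫ y in K, extDeriv (scaledForm Θ) (h y) (fun i => fderivWithin ℝ h Q y (coordVec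
      i)))
      = ∫ y in Icc (0 : Fin (k + 1) → ℝ) (fun _ => R), extDeriv (scaledForm Θ) (h (L y))
        (fun i => fderivWithin ℝ h Q (L y) (coordVec i)) := by
    rw [← setIntegral_toLp K]
    refine (setIntegral_eq_of_subset_of_forall_sdiff_eq_zero measurableSet_Icc hKbox ?_).symm
    exact fun y hy => hoff2 _ (hmaps hy.1) hy.2 _
  rw [hleft, hbox']
  refine Finset.sum_congr rfl fun i _ => ?_
  have hface : ∀ t ∈ Icc 0 R, ∀ z ∈ Icc ((0 : Fin (k + 1) → ℝ) ∘ i.succAbove)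
      ((fun _ => R) ∘ i.succAbove), L (i.insertNth t z) ∈ Q := fun t ht z hz =>
    hmaps (insertNth_mem_Icc i ht hz)
  have hup : (∫ z in Icc ((0 : Fin (k + 1) → ℝ) ∘ i.succAbove) ((fun _ => R) ∘ i.succAbove),
      (-1 : ℝ) ^ (i : ℕ) * scaledForm Θ (h (L (i.insertNth R z))) (fun j =>
        fderivWithin ℝ h Q (L (i.insertNth R z)) (coordVec (i.succAbove j)))) = 0 := by
    refine setIntegral_eq_zero_of_forall_eq_zero fun z hz => ?_
    have hn : L (i.insertNth R z) ∉ K := by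
      intro hc
      have h1 := (le_abs_self _).trans (PiLp.norm_apply_le (L (i.insertNth R z)) i)
      have h2 : (L (i.insertNth R z)) i = R := by
        rw [hLf]
        simp
      rw [h2] at h1
      exact absurd (hR _ hc) (not_lt.2 h1)
    rw [hoff1 _ (hface R (right_mem_Icc.2 hR0.le) z hz) hn, mul_zero]
  rw [hup, zero_sub, ← integral_neg]
  refine Eq.trans (setIntegral_eq_of_subset_of_forall_sdiff_eq_zero (t := Icc
    ((0 : Fin (k + 1) → ℝ) ∘ i.succAbove) ((fun _ => R) ∘ i.succAbove)) (s := {z : Fin k → ℝ |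
        facePoint i z ∈ K})
    measurableSet_Icc ?_ ?_) ?_
  · intro z hz
    exact ((Fin.insertNth_mem_Icc (α := fun _ => ℝ)).1 (hKbox (i.insertNth 0 z) hz)).2
  · intro z hz
    have := hoff1 _ (hface 0 (left_mem_Icc.2 hR0.le) z hz.1) hz.2 (fun j => coordVec (i.succAbove
        j))
    exact neg_eq_zero.2 (mul_eq_zero_of_right _ this)
  · refine integral_congr_ae (Eventually.of_forall fun z => ?_)
    exact (neg_mul _ _).symm

end LocalStokes

section GlobalStokes

variable {k : ℕ} {N : Type*} [TopologicalSpace N] [T2Space N] [CompactSpace N]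
  [ChartedSpace (EuclideanQuadrant (k + 1)) N] [IsManifold (Corners (k + 1)) ∞ N]
  {F : Type*} [NormedAddCommGroup F] [NormedSpace ℝ F] [FiniteDimensional ℝ F]

/-- Stokes' formula for one chart, for the form `ρ f^* Θ` with `ρ` in the partition of unity. The
sign of the chart is locally constant on the support of `ρ`, so it is absorbed in `ρ`. -/
lemma chartIntegral_dScaledPullback {μ : DForm (Corners (k + 1)) N (k + 1)} (hμ0 : IsC0 μ)
    (hμ : ∀ p, μ p ≠ 0) {f : N → F} (hf : ContMDiff (Corners (k + 1)) 𝓘(ℝ, F) 1 f)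
    {Θ : F → F [⋀^Fin k]→L[ℝ] ℝ} (hΘ : ContDiff ℝ 1 Θ) (x : N) :
    chartIntegral μ (dScaledPullback (Corners (k + 1)) (chartPartition (k + 1) N x) f Θ) x =
      boundaryTerm μ (flatPullback (Corners (k + 1)) f Θ) x := by
  set Q := range (Corners (k + 1)) with hQ
  set T := (extChartAt (Corners (k + 1)) x).target with hT
  set ρ : N → ℝ := ⇑(chartPartition (k + 1) N x) with hρdef
  have hρ : ContMDiff (Corners (k + 1)) 𝓘(ℝ, ℝ) 1 ρ := contMDiff_chartPartition x
  set K := partitionImage (d := k + 1) x with hK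
  have hKc : IsCompact K := isCompact_partitionImage x
  have hKT : K ⊆ T := partitionImage_subset x
  have hTQ : T ⊆ Q := extChartAt_target_subset_range x
  set O := (Corners (k + 1)).symm ⁻¹' (chartAt (EuclideanQuadrant (k + 1)) x).target with hOdef
  have hO : IsOpen O := (chartAt _ x).open_target.preimage (Corners (k + 1)).continuous_symm
  have hQO : Q ∩ O = T := range_inter_preimage_eq_target x
  obtain ⟨χ, hχ, hχ1, -, hχO⟩ := exists_cutoff hKc hO fun y hy => (hQO.symm.subset (hKT hy)).2
  set g : EuclideanSpace ℝ (Fin (k + 1)) → ℝ × F := fun y =>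
    (frameSign μ x y * coordMap (Corners (k + 1)) ρ x y, coordMap (Corners (k + 1)) f x y) with hg
  have hgT : ContDiffOn ℝ 1 g (Q ∩ O) := by
    rw [hQO]
    refine ContDiffOn.prodMk (fun y hy => ?_) (contDiffOn_coordMap hf x)
    have h1 : ContDiffWithinAt ℝ 1 (fun z => frameSign μ x y * coordMap (Corners (k + 1)) ρ x z) T
        y :=
      contDiffWithinAt_const.mul (contDiffOn_coordMap hρ x y hy)
    refine h1.congr_of_eventuallyEq ?_ rfl
    exact ((eventually_frameSign_eq hμ0 hμ hy).filter_mono (nhdsWithin_mono _ hTQ)).mono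
      fun z hz => by simp only [hz]
  set h : EuclideanSpace ℝ (Fin (k + 1)) → ℝ × F := fun y => χ y • g y with hh
  have hhQ : ContDiffOn ℝ 1 h Q := contDiffOn_cutoff_smul hχ hO hχO hgT
  have hρ0 : ∀ y ∈ T, y ∉ K → (extChartAt (Corners (k + 1)) x).symm y ∉ tsupport ρ := fun y hy hyK
      =>
    notMem_tsupport_of_notMem_partitionImage hy hyK
  have h0 : ∀ y ∈ Q, y ∉ K → (h y).1 = 0 := by
    intro y hy hyK
    by_cases hyT : y ∈ T
    · have : coordMap (Corners (k + 1)) ρ x y = 0 :=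
        image_eq_zero_of_notMem_tsupport (f := ρ) (hρ0 y hyT hyK)
      simp [hh, hg, this]
    · have : χ y = 0 := image_eq_zero_of_notMem_tsupport fun hc => hyT (hQO.subset ⟨hy, hχO hc⟩)
      simp [hh, this]
  -- near `K` the cutoff and the sign are constant
  have hnear : ∀ y ∈ K, h =ᶠ[𝓝[Q] y] fun z =>
      (frameSign μ x y * coordMap (Corners (k + 1)) ρ x z, coordMap (Corners (k + 1)) f x z) := by
    intro y hy
    filter_upwards [eventually_frameSign_eq hμ0 hμ (hKT hy), mem_nhdsWithin_of_mem_nhds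
      (eventually_nhdsSet_iff_forall.1 hχ1 y hy)] with z hz hz'
    have hz'' : χ z = 1 := hz'
    simp only [hh, hg, hz, hz'', one_smul]
  have hval : ∀ y ∈ K, h y = (frameSign μ x y * coordMap (Corners (k + 1)) ρ x y, coordMap (Corners
      (k + 1)) f x y) := fun y hy =>
    (hnear y hy).self_of_nhdsWithin (hTQ (hKT hy))
  have hder : ∀ y ∈ K, ∀ v, fderivWithin ℝ h Q y v =
      (frameSign μ x y * fderivWithin ℝ (coordMap (Corners (k + 1)) ρ x) Q y v,
        fderivWithin ℝ (coordMap (Corners (k + 1)) f x) Q y v) := by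
    intro y hy v
    rw [(hnear y hy).fderivWithin_eq_of_mem (hTQ (hKT hy))]
    have h1 := ((differentiableWithinAt_coordMap hρ (hKT hy)).hasFDerivWithinAt.const_mul
      (frameSign μ x y)).prodMk (differentiableWithinAt_coordMap hf (hKT hy)).hasFDerivWithinAt
    rw [h1.fderivWithin (uniqueDiffWithinAt_of_mem_target (hKT hy))]
    rfl
  have hmd : ∀ q, MDifferentiableAt (Corners (k + 1)) 𝓘(ℝ, F) f q := hf.mdifferentiable one_ne_zero
  have hS := cornerStokes hΘ hhQ hKc (hKT.trans hTQ) h0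
  rw [← hQ] at hS
  have hleft : chartIntegral μ (dScaledPullback (Corners (k + 1)) ρ f Θ) x =
      ∫ y in K, extDeriv (scaledForm Θ) (h y) (fun i => fderivWithin ℝ h Q y (coordVec i)) := by
    unfold chartIntegral
    rw [setIntegral_eq_of_subset_of_forall_sdiff_eq_zero (measurableSet_target x) hKT]
    · refine setIntegral_congr_fun hKc.isClosed.measurableSet fun y hy => ?_
      rw [localForm_dScaledPullback hρ hf hΘ (hKT hy), localForm_flatPullback (hKT hy) (hmd _),
        localForm_flatPullback (hKT hy) (hmd _), extDeriv_scaledForm_apply hΘ, hval y hy]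
      simp only [hder y hy]
      rw [mul_add, Finset.mul_sum]
      refine congrArg₂ _ (mul_assoc _ _ _).symm (Finset.sum_congr rfl fun i _ => ?_)
      rw [mul_left_comm, mul_assoc (frameSign μ x y)]
      rfl
    · intro y hy
      have : localForm (dScaledPullback (Corners (k + 1)) ρ f Θ) x y coordVec = 0 := by
        unfold localForm
        rw [dScaledPullback_eq_zero hρ hf hΘ (hρ0 y hy.1 hy.2)]
        rfl
      rw [this, mul_zero]
  rw [hleft, hS]
  refine Finset.sum_congr rfl fun i _ => ?_
  have hTm : MeasurableSet {z : Fin k → ℝ | facePoint i z ∈ T} :=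
    (measurableSet_target x).preimage (continuous_facePoint i).measurable
  have hKm : MeasurableSet {z : Fin k → ℝ | facePoint i z ∈ K} :=
    hKc.isClosed.measurableSet.preimage (continuous_facePoint i).measurable
  refine Eq.symm ((setIntegral_eq_of_subset_of_forall_sdiff_eq_zero hTm
    (s := {z : Fin k → ℝ | facePoint i z ∈ K}) (fun z hz => hKT hz) fun z hz => ?_).trans ?_)
  · have : ρ ((extChartAt (Corners (k + 1)) x).symm (facePoint i z)) = 0 :=
      image_eq_zero_of_notMem_tsupport (hρ0 _ hz.1 hz.2)
    exact mul_eq_zero_of_left this _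
  · refine setIntegral_congr_fun hKm fun z hz' => ?_
    have hz : facePoint i z ∈ K := hz'
    rw [localForm_flatPullback (hKT hz) (hmd _), hval _ hz]
    simp only [hder _ hz]
    set X := Θ (coordMap (Corners (k + 1)) f x (facePoint i z)) (fun j => fderivWithin ℝ
      (coordMap (Corners (k + 1)) f x) Q (facePoint i z) (coordVec (i.succAbove j))) with hX
    change coordMap (Corners (k + 1)) ρ x (facePoint i z) *
      (-(-1 : ℝ) ^ (i : ℕ) * frameSign μ x (facePoint i z) * X) = -(-1 : ℝ) ^ (i : ℕ) *
        ((frameSign μ x (facePoint i z) * coordMap (Corners (k + 1)) ρ x (facePoint i z)) * X)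
    ring

/-- Stokes' theorem for the pullback of a `C¹` form on a vector space under a `C¹` map. It is the
sum of the formulas for the charts: each `d(ρ f^* Θ)` is moved from its own chart to the other
charts, in which the terms `dρ ∧ f^* Θ` cancel because the functions `ρ` add up to `1`. -/
theorem formIntegral_flatPullback_extDeriv {μ : DForm (Corners (k + 1)) N (k + 1)} (hμ0 : IsC0 μ)
    (hμ : ∀ p, μ p ≠ 0) {f : N → F} (hf : ContMDiff (Corners (k + 1)) 𝓘(ℝ, F) 1 f)
    {Θ : F → F [⋀^Fin k]→L[ℝ] ℝ} (hΘ : ContDiff ℝ 1 Θ) :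
    formIntegral μ (flatPullback (Corners (k + 1)) f (extDeriv Θ)) =
      boundaryIntegral μ (flatPullback (Corners (k + 1)) f Θ) := by
  set ρ : N → N → ℝ := fun x => ⇑(chartPartition (k + 1) N x) with hρdef
  have hρ : ∀ x, ContMDiff (Corners (k + 1)) 𝓘(ℝ, ℝ) 1 (ρ x) := fun x => contMDiff_chartPartition x
  set A := activeCharts (k + 1) N with hA
  set η : N → DForm (Corners (k + 1)) N (k + 1) := fun x => dScaledPullback (Corners (k + 1)) (ρ x)
      f Θ with hη
  have hη0 : ∀ x p, p ∉ tsupport (ρ x) → η x p = 0 := fun x p hp =>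
    dScaledPullback_eq_zero (hρ x) hf hΘ hp
  have hηc : ∀ x x', ContinuousOn (fun y => localForm (η x) x' y coordVec)
      (extChartAt (Corners (k + 1)) x').target := fun x x' =>
    continuousOn_localForm_flatPullback (contMDiff_pair (hρ x) hf)
      (continuous_extDeriv (contDiff_scaledForm hΘ)) x' _
  have hmul : ∀ (θ : DForm (Corners (k + 1)) N (k + 1)) (x' x : N) y,
      localForm (fun p => ρ x p • θ p) x' y coordVec =
        coordMap (Corners (k + 1)) (ρ x) x' y * localForm θ x' y coordVec := fun θ x' x y => rfl
  -- integrability of the pieces, in any chart that carries their support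
  have hint : ∀ x x' z, z = x ∨ z = x' → IntegrableOn (fun y => frameSign μ z y *
      localForm (fun p => ρ x' p • η x p) z y coordVec) (extChartAt (Corners (k + 1)) z).target :=
          by
    intro x x' z hz
    refine integrableOn_target ((continuousOn_frameSign hμ0 hμ z).mul ?_) fun y hy hyK => ?_
    · exact ((contDiffOn_coordMap (hρ x') z).continuousOn).mul (hηc x z)
    · rw [hmul]
      have hnot := notMem_tsupport_of_notMem_partitionImage hy hyK
      rcases hz with rfl | rfl
      · have : localForm (η z) z y coordVec = 0 := by
          unfold localForm
          rw [hη0 z _ hnot]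
          rfl
        rw [this]
        simp
      · have : coordMap (Corners (k + 1)) (ρ z) z y = 0 :=
          image_eq_zero_of_notMem_tsupport (f := ρ z) hnot
        rw [this]
        simp
  -- change of chart
  have hchange : ∀ x x', chartIntegral μ (fun p => ρ x' p • η x p) x =
      chartIntegral μ (fun p => ρ x' p • η x p) x' := by
    intro x x'
    refine chartIntegral_eq_of_support μ _ fun p hp => ?_
    by_cases h1 : p ∈ tsupport (ρ x)
    · have h2 : p ∉ tsupport (ρ x') := fun hc =>
        hp ⟨tsupport_chartPartition x h1, tsupport_chartPartition x' hc⟩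
      simp [image_eq_zero_of_notMem_tsupport h2]
    · simp [hη0 x p h1]
  have hsplit : ∀ x, chartIntegral μ (η x) x =
      ∑ x' ∈ A, chartIntegral μ (fun p => ρ x' p • η x p) x := by
    intro x
    unfold chartIntegral
    rw [← integral_finsetSum A fun x' _ => hint x x' x (Or.inl rfl)]
    refine integral_congr_ae (Eventually.of_forall fun y => ?_)
    simp only [hmul]
    rw [← Finset.mul_sum, ← Finset.sum_mul]
    have : ∑ x' ∈ A, coordMap (Corners (k + 1)) (ρ x') x y = 1 := sum_chartPartition _
    rw [this, one_mul]
  have hjoin : ∀ x', ∑ x ∈ A, chartIntegral μ (fun p => ρ x' p • η x p) x' =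
      chartIntegral μ (fun p => ρ x' p • flatPullback (Corners (k + 1)) f (extDeriv Θ) p) x' := by
    intro x'
    unfold chartIntegral
    rw [← integral_finsetSum A fun x _ => hint x x' x' (Or.inr rfl)]
    refine setIntegral_congr_fun (measurableSet_target x') fun y hy => ?_
    simp only [hmul]
    rw [← Finset.mul_sum, ← Finset.mul_sum]
    refine congrArg _ (congrArg _ ?_)
    -- the differentials of the partition of unity add up to zero
    have hsum1 : ∑ x ∈ A, coordMap (Corners (k + 1)) (ρ x) x' y = 1 := sum_chartPartition _
    have hsum0 : ∀ v, ∑ x ∈ A, fderivWithin ℝ (coordMap (Corners (k + 1)) (ρ x) x') (range (Corners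
        (k + 1))) y v = 0 := by
      intro v
      have h1 : HasFDerivWithinAt (fun z => ∑ x ∈ A, coordMap (Corners (k + 1)) (ρ x) x' z)
          (∑ x ∈ A, fderivWithin ℝ (coordMap (Corners (k + 1)) (ρ x) x') (range (Corners (k + 1)))
              y) (range (Corners (k + 1))) y :=
        HasFDerivWithinAt.fun_sum fun x _ =>
          (differentiableWithinAt_coordMap (hρ x) hy).hasFDerivWithinAt
      have h2 : (fun z => ∑ x ∈ A, coordMap (Corners (k + 1)) (ρ x) x' z) = fun _ => (1 : ℝ) :=
        funext fun z => sum_chartPartition _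
      rw [h2] at h1
      have h3 := h1.fderivWithin (uniqueDiffWithinAt_of_mem_target hy)
      rw [fderivWithin_const_apply] at h3
      have h4 := congrArg (fun B => B v) h3
      simp only [sum_apply] at h4
      exact h4.symm
    simp only [hη, localForm_dScaledPullback (hρ _) hf hΘ hy]
    rw [Finset.sum_add_distrib, ← Finset.sum_mul, hsum1, one_mul, Finset.sum_comm]
    rw [Finset.sum_eq_zero, add_zero]
    intro i _
    rw [← Finset.mul_sum, ← Finset.sum_mul, hsum0, zero_mul, mul_zero]
  rw [formIntegral_eq_sum, boundaryIntegral_eq_sum]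
  calc _ = ∑ x' ∈ A, ∑ x ∈ A, chartIntegral μ (fun p => ρ x' p • η x p) x' :=
        Finset.sum_congr rfl fun x' _ => (hjoin x').symm
    _ = ∑ x ∈ A, ∑ x' ∈ A, chartIntegral μ (fun p => ρ x' p • η x p) x := by
        rw [Finset.sum_comm]
        exact Finset.sum_congr rfl fun x _ => Finset.sum_congr rfl fun x' _ => (hchange x x').symm
    _ = ∑ x ∈ A, boundaryTerm μ (flatPullback (Corners (k + 1)) f Θ) x :=
        Finset.sum_congr rfl fun x _ => (hsplit x).symm.trans
          (chartIntegral_dScaledPullback hμ0 hμ hf hΘ x)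

end GlobalStokes

/-! ### Representing forms on a manifold by forms on a vector space -/

section Representation

variable {n k : ℕ} {M : Type*} [TopologicalSpace M]
  [ChartedSpace (EuclideanSpace ℝ (Fin n)) M]

lemma mfderiv_clm_comp {E : Type*} [NormedAddCommGroup E] [NormedSpace ℝ E]
    {H : Type*} [TopologicalSpace H] {I : ModelWithCorners ℝ E H}
    {N : Type*} [TopologicalSpace N] [ChartedSpace H N]
    {F G : Type*} [NormedAddCommGroup F] [NormedSpace ℝ F] [NormedAddCommGroup G]
    [NormedSpace ℝ G] (L : F →L[ℝ] G) {e : N → F} {p : N} (he : MDifferentiableAt I 𝓘(ℝ, F) e p)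
    (v : TangentSpace I p) :
    (mfderiv I 𝓘(ℝ, G) (fun q => L (e q)) p v : G) = L (mfderiv I 𝓘(ℝ, F) e p v : F) := by
  have h1 := mfderiv_comp p (I' := 𝓘(ℝ, F)) (I'' := 𝓘(ℝ, G)) (g := L)
    L.differentiableAt.mdifferentiableAt he
  rw [ContinuousLinearMap.mfderiv_eq] at h1
  exact congrArg (fun A => A v) h1

/-- If a form agrees near `p` with the pullback of a form on a vector space, then so does its
exterior derivative. -/
lemma extD_eq_flatPullback [IsManifold (𝓡 n) ∞ M] {F : Type*} [NormedAddCommGroup F]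
    [NormedSpace ℝ F] {θ : DForm (𝓡 n) M k} {e : M → F} (he : ContMDiff (𝓡 n) 𝓘(ℝ, F) ∞ e)
    {Θ : F → F [⋀^Fin k]→L[ℝ] ℝ} (hΘ : ContDiff ℝ 1 Θ) {p : M}
    (h : ∀ᶠ q in 𝓝 p, θ q = flatPullback (𝓡 n) e Θ q) :
    extD θ p = flatPullback (𝓡 n) e (extDeriv Θ) p := by
  set y₀ := extChartAt (𝓡 n) p p with hy₀
  have hT : (extChartAt (𝓡 n) p).target ∈ 𝓝 y₀ := extChartAt_target_mem_nhds p
  have hmd : ∀ q, MDifferentiableAt (𝓡 n) 𝓘(ℝ, F) e q := he.mdifferentiable (by simp)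
  have hsymm : Tendsto (extChartAt (𝓡 n) p).symm (𝓝 y₀) (𝓝 p) := by
    have := (continuousAt_extChartAt_symm (I := 𝓡 n) p).tendsto
    rwa [extChartAt_to_inv] at this
  have hloc : localForm θ p =ᶠ[𝓝 y₀] fun y => (Θ (coordMap (𝓡 n) e p y)).compContinuousLinearMap
      (fderiv ℝ (coordMap (𝓡 n) e p) y) := by
    filter_upwards [hT, hsymm.eventually h] with y hy hy'
    have h1 : localForm θ p y = localForm (flatPullback (𝓡 n) e Θ) p y := by
      unfold localForm
      rw [hy']
    rw [h1, localForm_flatPullback hy (hmd _)]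
    simp [fderivWithin_univ]
  have hsm : ContDiffAt ℝ ∞ (coordMap (𝓡 n) e p) y₀ :=
    (contMDiffOn_iff_contDiffOn.1 (he.comp_contMDiffOn (contMDiffOn_extChartAt_symm p))).contDiffAt
        hT
  have hext : extDerivWithin (localForm θ p) (range (𝓡 n)) y₀ =
      (extDeriv Θ (coordMap (𝓡 n) e p y₀)).compContinuousLinearMap
        (fderiv ℝ (coordMap (𝓡 n) e p) y₀) := by
    rw [show range (𝓡 n) = univ from ModelWithCorners.Boundaryless.range_eq_univ,
      extDerivWithin_univ, hloc.extDeriv_eq]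
    exact extDeriv_pullback (hΘ.differentiable one_ne_zero _)
      (hsm.of_le (m := 2) (WithTop.coe_le_coe.2 (le_top : (2 : ℕ∞) ≤ ⊤))) (by simp)
  have hcomp : @Eq (EuclideanSpace ℝ (Fin n) →L[ℝ] F) (mfderiv (𝓡 n) 𝓘(ℝ, F) e p)
      ((fderiv ℝ (coordMap (𝓡 n) e p) y₀).comp
        (mfderiv (𝓡 n) 𝓘(ℝ, EuclideanSpace ℝ (Fin n)) (extChartAt (𝓡 n) p) p)) := by
    have hev : e =ᶠ[𝓝 p] coordMap (𝓡 n) e p ∘ extChartAt (𝓡 n) p := by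
      filter_upwards [extChartAt_source_mem_nhds (I := 𝓡 n) p] with q hq
      exact congrArg e ((extChartAt (𝓡 n) p).left_inv hq).symm
    refine hev.mfderiv_eq.trans ?_
    rw [← mfderiv_eq_fderiv]
    exact mfderiv_comp p (hsm.differentiableAt (by simp)).mdifferentiableAt
      (mdifferentiableAt_extChartAt (mem_chart_source _ p))
  have hval : coordMap (𝓡 n) e p y₀ = e p := by
    unfold coordMap
    rw [hy₀, extChartAt_to_inv]
  ext v
  have e1 : flatPullback (𝓡 n) e (extDeriv Θ) p v = extDeriv Θ (e p) (fun i => (mfderiv (𝓡 n)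
      𝓘(ℝ, F) e p : EuclideanSpace ℝ (Fin n) →L[ℝ] F) (v i)) := rfl
  rw [e1, hcomp, ← hval]
  unfold extD
  rw [hext]
  rfl

variable [T2Space M] [SecondCountableTopology M] [IsManifold (𝓡 n) ∞ M]

/-- Near a compact set, every `C¹` form on a manifold is the pullback of a `C¹` form on a
finite-dimensional vector space under a smooth map; by naturality so is its exterior derivative.
A partition of unity reduces this to forms supported in a chart, where the map consists of the
cutoff function and a globalized chart. -/
theorem exists_flatPullback_eq {K : Set M} (hK : IsCompact K) {θ : DForm (𝓡 n) M k}
    (hθ : IsC1 θ) : ∃ (F : Type) (_ : NormedAddCommGroup F) (_ : NormedSpace ℝ F)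
      (_ : FiniteDimensional ℝ F) (e : M → F) (Θ : F → F [⋀^Fin k]→L[ℝ] ℝ),
      ContMDiff (𝓡 n) 𝓘(ℝ, F) ∞ e ∧ ContDiff ℝ 1 Θ ∧
      ∀ p ∈ K, θ p = flatPullback (𝓡 n) e Θ p ∧
        extD θ p = flatPullback (𝓡 n) e (extDeriv Θ) p := by
  have : LocallyCompactSpace M := ChartedSpace.locallyCompactSpace (EuclideanSpace ℝ (Fin n)) M
  obtain ⟨ρ, hρ⟩ := SmoothPartitionOfUnity.exists_isSubordinate_chartAt_source (𝓡 n) M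
  obtain ⟨L, hL, hKL⟩ := exists_compact_superset hK
  have hfin := ρ.locallyFinite.closure.finite_nonempty_inter_compact hK
  set S : Finset M := hfin.toFinset with hS
  have hsum : ∀ p ∈ K, ∀ᶠ q in 𝓝 p, ∑ c ∈ S, ρ c q = 1 := by
    intro p hp
    filter_upwards [ρ.eventually_finsupport_subset p] with q hq
    refine ρ.sum_finsupport' q (mem_univ q) (hq.trans fun c hc => ?_)
    exact hfin.mem_toFinset.2 ⟨p, (ρ.mem_fintsupport_iff p c).1 hc, hp⟩
  have hsource : ∀ c, tsupport (ρ c) ⊆ (extChartAt (𝓡 n) c).source := fun c => by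
    rw [extChartAt_source]
    exact hρ c
  -- a chart, cut off away from the support of `ρ c`
  have hκ : ∀ c : M, ∃ κ : M → ℝ, ContMDiff (𝓡 n) 𝓘(ℝ, ℝ) ∞ κ ∧
      tsupport κ ⊆ (extChartAt (𝓡 n) c).source ∧ ∀ p ∈ tsupport (ρ c), ∀ᶠ q in 𝓝 p, κ q = 1 := by
    intro c
    obtain ⟨κ, h0, h1, -⟩ := exists_contMDiffMap_zero_one_nhds_of_isClosed (n := ⊤) (𝓡 n)
      (isOpen_extChartAt_source (I := 𝓡 n) c).isClosed_compl (isClosed_tsupport (ρ c))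
      (disjoint_compl_left_iff_subset.2 (hsource c))
    refine ⟨κ, κ.contMDiff, fun p hp => ?_, fun p hp => eventually_nhdsSet_iff_forall.1 h1 p hp⟩
    by_contra hc
    exact notMem_tsupport_iff_eventuallyEq.2 (eventually_nhdsSet_iff_forall.1 h0 p hc) hp
  choose κ hκs hκt hκ1 using hκ
  have hχ : ∀ c : M, ∃ χ : EuclideanSpace ℝ (Fin n) → ℝ, ContDiff ℝ ∞ χ ∧
      tsupport χ ⊆ (extChartAt (𝓡 n) c).target ∧
      ∀ p ∈ tsupport (ρ c) ∩ L, χ (extChartAt (𝓡 n) c p) = 1 := by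
    intro c
    have hc : IsCompact (extChartAt (𝓡 n) c '' (tsupport (ρ c) ∩ L)) :=
      (hL.inter_left (isClosed_tsupport _)).image_of_continuousOn
        ((continuousOn_extChartAt c).mono (inter_subset_left.trans (hsource c)))
    obtain ⟨χ, h1, h2, -, h3⟩ := exists_cutoff hc (isOpen_extChartAt_target c) (by
      rintro _ ⟨p, hp, rfl⟩
      exact (extChartAt (𝓡 n) c).map_source (hsource c hp.1))
    exact ⟨χ, h1, h3, fun p hp => (eventually_nhdsSet_iff_forall.1 h2 _ ⟨p, hp, rfl⟩).self_of_nhds⟩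
  choose χ hχs hχt hχ1 using hχ
  set u : M → M → EuclideanSpace ℝ (Fin n) := fun c p => κ c p • extChartAt (𝓡 n) c p with hu
  have hus : ∀ c, ContMDiff (𝓡 n) 𝓘(ℝ, EuclideanSpace ℝ (Fin n)) ∞ (u c) := fun c =>
    contMDiff_of_tsupport fun p hp => (hκs c p).smul (contMDiffAt_extChartAt' (by
      rw [← extChartAt_source (𝓡 n)]
      exact hκt c (tsupport_smul_subset_left _ _ hp)))
  set B : M → EuclideanSpace ℝ (Fin n) → EuclideanSpace ℝ (Fin n) [⋀^Fin k]→L[ℝ] ℝ := fun c y => χ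
      c y • localForm θ c y with hB
  have hBs : ∀ c, ContDiff ℝ 1 (B c) := fun c => contDiffOn_univ.1
    (contDiffOn_cutoff_smul (hχs c) (isOpen_extChartAt_target c) (hχt c) (by
      rw [univ_inter]
      exact hθ c))
  let pr : ∀ c : Fin S.card, (Fin S.card → ℝ × EuclideanSpace ℝ (Fin n)) →L[ℝ] ℝ × EuclideanSpace ℝ
      (Fin n) := fun c =>
    ContinuousLinearMap.proj c
  let ct : Fin S.card → M := fun i => (S.equivFin.symm i : M)
  set e : M → Fin S.card → ℝ × EuclideanSpace ℝ (Fin n) := fun p i => (ρ (ct i) p, u (ct i) p) with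
      he
  set Θ : (Fin S.card → ℝ × EuclideanSpace ℝ (Fin n)) → (Fin S.card → ℝ × EuclideanSpace ℝ (Fin n))
      [⋀^Fin k]→L[ℝ] ℝ := fun z =>
    ∑ i, (scaledForm (B (ct i)) (pr i z)).compContinuousLinearMap (pr i) with hΘ
  have hes : ContMDiff (𝓡 n) 𝓘(ℝ, Fin S.card → ℝ × EuclideanSpace ℝ (Fin n)) ∞ e :=
    contMDiff_pi_space.2 fun i => (ρ (ct i)).contMDiff.prodMk_space (hus (ct i))
  have hpull : ∀ i, ContDiff ℝ 1 (fun A : (ℝ × EuclideanSpace ℝ (Fin n)) [⋀^Fin k]→L[ℝ] ℝ =>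
      A.compContinuousLinearMap (pr i)) := fun i =>
    ContinuousLinearMap.contDiff (ContinuousAlternatingMap.compContinuousLinearMapCLM
      (F := ℝ) (ι := Fin k) (pr i))
  have hΘs : ContDiff ℝ 1 Θ := ContDiff.sum fun i _ =>
    (hpull i).comp ((contDiff_scaledForm (hBs (ct i))).comp (pr i).contDiff)
  have hΘa : ∀ z (w : Fin k → Fin S.card → ℝ × EuclideanSpace ℝ (Fin n)), Θ z w =
      ∑ i, scaledForm (B (ct i)) (pr i z) (fun j => pr i (w j)) := fun z w => by
    simp only [hΘ, ContinuousAlternatingMap.sum_apply]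
    rfl
  have hrep : ∀ p ∈ L, ∑ c ∈ S, ρ c p = 1 → θ p = flatPullback (𝓡 n) e Θ p := by
    intro p hp hsum
    ext v
    have hterm : ∀ i, scaledForm (B (ct i)) (pr i (e p)) (fun j => pr i (mfderiv (𝓡 n)
        𝓘(ℝ, Fin S.card → ℝ × EuclideanSpace ℝ (Fin n)) e p (v j))) = ρ (ct i) p * θ p v := by
      intro i
      set c := ct i
      by_cases h0 : ρ c p = 0
      · have : (pr i (e p)).1 = 0 := h0
        simp [scaledForm, this, h0]
      have hpt : p ∈ tsupport (ρ c) := subset_tsupport _ h0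
      have hps := hsource c hpt
      have hun : u c =ᶠ[𝓝 p] extChartAt (𝓡 n) c := (hκ1 c p hpt).mono fun q hq => by
        simp only [hu, hq, one_smul]
      have hder : ∀ w : TangentSpace (𝓡 n) p, (pr i (mfderiv (𝓡 n)
          𝓘(ℝ, Fin S.card → ℝ × EuclideanSpace ℝ (Fin n)) e p w)).2 = (mfderiv (𝓡 n) 𝓘(ℝ,
              EuclideanSpace ℝ (Fin n))
            (extChartAt (𝓡 n) c) p w : EuclideanSpace ℝ (Fin n)) := by
        intro w
        have h1 := mfderiv_clm_comp ((ContinuousLinearMap.snd ℝ ℝ (EuclideanSpace ℝ (Fin n))).comp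
            (pr i))
          (hes.mdifferentiable (by simp) p) w
        refine h1.symm.trans ?_
        exact congrArg (fun A => A w) (hun.mfderiv_eq (I := 𝓡 n) (I' := 𝓘(ℝ, EuclideanSpace ℝ (Fin
            n))))
      have hBp : B c (u c p) = localForm θ c (extChartAt (𝓡 n) c p) := by
        rw [hun.self_of_nhds]
        simp only [hB, hχ1 c p ⟨hpt, hp⟩, one_smul]
      have hinv : (extChartAt (𝓡 n) c).symm (extChartAt (𝓡 n) c p) = p :=
        (extChartAt (𝓡 n) c).left_inv hps
      have hθ' : ∀ q, q = p → ∀ (w : Fin k → EuclideanSpace ℝ (Fin n)), (θ q : EuclideanSpace ℝ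
          (Fin n) [⋀^Fin k]→L[ℝ] ℝ) w =
          (θ p : EuclideanSpace ℝ (Fin n) [⋀^Fin k]→L[ℝ] ℝ) w := by
        rintro q rfl w
        rfl
      have hid : ∀ w : TangentSpace (𝓡 n) p, (mfderivWithin 𝓘(ℝ, EuclideanSpace ℝ (Fin n)) (𝓡 n)
          (extChartAt (𝓡 n) c).symm (range (𝓡 n)) (extChartAt (𝓡 n) c p) (mfderiv (𝓡 n) 𝓘(ℝ,
              EuclideanSpace ℝ (Fin n))
            (extChartAt (𝓡 n) c) p w) : EuclideanSpace ℝ (Fin n)) = (w : EuclideanSpace ℝ (Fin n))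
                := by
        intro w
        have := mfderivWithin_extChartAt_symm_comp_mfderiv_extChartAt' (I := 𝓡 n) hps
        exact congrArg (fun A => A w) this
      have h2 : scaledForm (B c) (pr i (e p)) (fun j => pr i (mfderiv (𝓡 n)
        𝓘(ℝ, Fin S.card → ℝ × EuclideanSpace ℝ (Fin n)) e p (v j))) = ρ c p * B c (u c p) (fun j =>
          (pr i (mfderiv (𝓡 n) 𝓘(ℝ, Fin S.card → ℝ × EuclideanSpace ℝ (Fin n)) e p (v j))).2) := rfl
      rw [h2, hBp]
      simp only [hder]
      refine congrArg _ ((hθ' _ hinv _).trans ?_)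
      refine congrArg (θ p) (funext fun j => ?_)
      exact hid (v j)
    have h3 : flatPullback (𝓡 n) e Θ p v = ∑ i, scaledForm (B (ct i)) (pr i (e p)) (fun j =>
        pr i (mfderiv (𝓡 n) 𝓘(ℝ, Fin S.card → ℝ × EuclideanSpace ℝ (Fin n)) e p (v j))) :=
      hΘa _ _
    rw [h3]
    simp only [hterm]
    rw [← Finset.sum_mul]
    have h4 : ∑ i, ρ (ct i) p = ∑ c ∈ S, ρ c p := by
      rw [← Finset.sum_coe_sort S]
      exact Equiv.sum_comp S.equivFin.symm (fun c : S => ρ (c : M) p)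
    rw [h4, hsum, one_mul]
  refine ⟨Fin S.card → ℝ × EuclideanSpace ℝ (Fin n), inferInstance, inferInstance, inferInstance,
      e, Θ, hes, hΘs,
    fun p hp => ⟨hrep p (interior_subset (hKL hp)) (hsum p hp).self_of_nhds, ?_⟩⟩
  refine extD_eq_flatPullback hes hΘs ?_
  filter_upwards [hsum p hp, isOpen_interior.mem_nhds (hKL hp)] with q hq hq'
  exact hrep q (interior_subset hq') hq

end Representation

/-! ### The Lie derivative along a moving map -/

section LieForm

variable {F : Type*} [NormedAddCommGroup F] [NormedSpace ℝ F] {k : ℕ}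

/-- The form `ι_w Θ` on the space of pairs `(z, w)`. Its pullback under `(f, w)` is the interior
product of `Θ` along `f` with the velocity field `w`. -/
def contractForm (Θ : F → F [⋀^Fin (k + 1)]→L[ℝ] ℝ) (p : F × F) : (F × F) [⋀^Fin k]→L[ℝ] ℝ :=
  ((Θ p.1).curryLeft p.2).compContinuousLinearMap (ContinuousLinearMap.fst ℝ F F)

/-- The form `ι_w dΘ + d(ι_w Θ)` on the space of pairs `(z, w)`. By Cartan's formula its pullback
under `(f, w)` is the time derivative of `f^* Θ` when `f` moves with velocity `w`. -/
def lieForm (Θ : F → F [⋀^Fin (k + 1)]→L[ℝ] ℝ) (p : F × F) : (F × F) [⋀^Fin (k + 1)]→L[ℝ] ℝ :=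
  contractForm (extDeriv Θ) p + extDeriv (contractForm Θ) p

/-- `contractForm` as a bilinear operation on the coefficients of the form and the vector. -/
def contractL (F : Type*) [NormedAddCommGroup F] [NormedSpace ℝ F] (k : ℕ) :
    (F [⋀^Fin (k + 1)]→L[ℝ] ℝ) →L[ℝ] F →L[ℝ] ((F × F) [⋀^Fin k]→L[ℝ] ℝ) :=
  ((ContinuousAlternatingMap.compContinuousLinearMapCLM
    (ContinuousLinearMap.fst ℝ F F)).postcomp F).comp
      (ContinuousAlternatingMap.curryLeftLI (𝕜 := ℝ) (E := F) (F := ℝ)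
        (n := k)).toContinuousLinearMap

lemma continuous_contractForm {Θ : F → F [⋀^Fin (k + 1)]→L[ℝ] ℝ} (hΘ : Continuous Θ) :
    Continuous (contractForm Θ) :=
  ((contractL F k).continuous.comp (hΘ.comp continuous_fst)).clm_apply continuous_snd

lemma contDiff_contractForm {Θ : F → F [⋀^Fin (k + 1)]→L[ℝ] ℝ} (hΘ : ContDiff ℝ 1 Θ) :
    ContDiff ℝ 1 (contractForm Θ) :=
  ((contractL F k).contDiff.comp (hΘ.comp contDiff_fst)).clm_apply contDiff_snd

lemma continuous_lieForm {Θ : F → F [⋀^Fin (k + 1)]→L[ℝ] ℝ} (hΘ : ContDiff ℝ 1 Θ) :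
    Continuous (lieForm Θ) :=
  (continuous_contractForm (continuous_extDeriv hΘ)).add
    (continuous_extDeriv (contDiff_contractForm hΘ))

lemma fderiv_contractForm_apply {Θ : F → F [⋀^Fin (k + 1)]→L[ℝ] ℝ} (hΘ : ContDiff ℝ 1 Θ)
    (p : F × F) (v : Fin k → F × F) (q : F × F) :
    fderiv ℝ (fun p => contractForm Θ p v) p q =
      fderiv ℝ Θ p.1 q.1 (Matrix.vecCons p.2 (fun j => (v j).1)) +
        Θ p.1 (Matrix.vecCons q.2 (fun j => (v j).1)) := by
  have h1 : HasFDerivAt (fun p : F × F => Θ p.1)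
      ((fderiv ℝ Θ p.1).comp (ContinuousLinearMap.fst ℝ F F)) p :=
    (hΘ.differentiable one_ne_zero p.1).hasFDerivAt.comp p hasFDerivAt_fst
  have h2 := (contractL F k).hasFDerivAt_of_bilinear h1 (hasFDerivAt_snd (𝕜 := ℝ) (p := p))
  have h3 := h2.continuousAlternatingMap_apply_const v
  refine (congrArg (fun A => A q) h3.fderiv).trans ?_
  rw [add_comm]
  rfl

lemma extDeriv_vecCons (Θ : F → F [⋀^Fin (k + 1)]→L[ℝ] ℝ) (z w : F)
    (v : Fin (k + 1) → F) : extDeriv Θ z (Matrix.vecCons w v) = fderiv ℝ Θ z w v -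
      ∑ i : Fin (k + 1), (-1 : ℝ) ^ (i : ℕ) *
        fderiv ℝ Θ z (v i) (Matrix.vecCons w (i.removeNth v)) := by
  rw [extDeriv, ContinuousAlternatingMap.alternatizeUncurryFin_apply, Fin.sum_univ_succ,
    sub_eq_add_neg, ← Finset.sum_neg_distrib]
  refine congrArg₂ _ ?_ (Finset.sum_congr rfl fun i _ => ?_)
  · simp
  · have : (i.succ).removeNth (Matrix.vecCons w v) = Matrix.vecCons w (i.removeNth v) := by
      ext j
      refine Fin.cases ?_ (fun j => ?_) j
      · simp [Fin.removeNth]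
      · simp [Fin.removeNth]
    rw [this]
    simp [pow_succ]

/-- Cartan's formula along a curve. -/
lemma lieForm_apply {Θ : F → F [⋀^Fin (k + 1)]→L[ℝ] ℝ} (hΘ : ContDiff ℝ 1 Θ) (z w : F)
    (a b : Fin (k + 1) → F) : lieForm Θ (z, w) (fun i => (a i, b i)) =
      fderiv ℝ Θ z w a + ∑ i, Θ z (Function.update a i (b i)) := by
  have hd : DifferentiableAt ℝ (contractForm Θ) (z, w) :=
    (contDiff_contractForm hΘ).differentiable one_ne_zero _
  have h1 : contractForm (extDeriv Θ) (z, w) (fun i => (a i, b i)) =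
      extDeriv Θ z (Matrix.vecCons w a) := rfl
  have h2 : extDeriv (contractForm Θ) (z, w) (fun i => (a i, b i)) =
      ∑ i : Fin (k + 1), (-1 : ℝ) ^ (i : ℕ) *
        (fderiv ℝ Θ z (a i) (Matrix.vecCons w (i.removeNth a)) +
          Θ z (Matrix.vecCons (b i) (i.removeNth a))) := by
    rw [extDeriv_apply hd]
    refine Finset.sum_congr rfl fun i _ => ?_
    rw [fderiv_contractForm_apply hΘ]
    simp only [zsmul_eq_mul, Int.cast_pow, Int.cast_neg, Int.cast_one]
    rfl
  have h3 : ∀ i : Fin (k + 1), Θ z (Function.update a i (b i)) =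
      (-1 : ℝ) ^ (i : ℕ) * Θ z (Matrix.vecCons (b i) (i.removeNth a)) := by
    intro i
    have h4 : Function.update a i (b i) = i.insertNth (b i) (i.removeNth a) :=
      (Fin.insertNth_removeNth i (b i) a).symm
    have h5 := (Θ z).toAlternatingMap.map_insertNth i (b i) (i.removeNth a)
    rw [h4]
    refine h5.trans ?_
    simp
  change contractForm (extDeriv Θ) (z, w) (fun i => (a i, b i)) +
    extDeriv (contractForm Θ) (z, w) (fun i => (a i, b i)) = _
  rw [h1, h2, extDeriv_vecCons Θ]
  simp only [h3, mul_add, Finset.sum_add_distrib]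
  ring

lemma hasDerivAt_form_apply {Θ : F → F [⋀^Fin (k + 1)]→L[ℝ] ℝ} (hΘ : ContDiff ℝ 1 Θ)
    {z : ℝ → F} {w : F} {a : Fin (k + 1) → ℝ → F} {b : Fin (k + 1) → F} {t : ℝ}
    (hz : HasDerivAt z w t) (ha : ∀ i, HasDerivAt (a i) (b i) t) :
    HasDerivAt (fun s => Θ (z s) (fun i => a i s)) (lieForm Θ (z t, w) (fun i => (a i t, b i))) t
        := by
  have h1 : HasFDerivAt (fun s => Θ (z s))
      ((fderiv ℝ Θ (z t)).comp (ContinuousLinearMap.toSpanSingleton ℝ w)) t :=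
    (hΘ.differentiable one_ne_zero (z t)).hasFDerivAt.comp t hz.hasFDerivAt
  have h2 := (h1.continuousAlternatingMap_apply fun i => (ha i).hasFDerivAt).hasDerivAt
  refine h2.congr_deriv ?_
  rw [lieForm_apply hΘ (z t) w (fun i => a i t) b]
  simp

lemma extDeriv_fst_add_snd {F' : Type*} [NormedAddCommGroup F'] [NormedSpace ℝ F']
    {A : F → F [⋀^Fin k]→L[ℝ] ℝ} {B : F' → F' [⋀^Fin k]→L[ℝ] ℝ} (hA : ContDiff ℝ 1 A)
    (hB : ContDiff ℝ 1 B) (p : F × F') :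
    extDeriv (fun p : F × F' => (A p.1).compContinuousLinearMap (ContinuousLinearMap.fst ℝ F F') +
      (B p.2).compContinuousLinearMap (ContinuousLinearMap.snd ℝ F F')) p =
    (extDeriv A p.1).compContinuousLinearMap (ContinuousLinearMap.fst ℝ F F') +
      (extDeriv B p.2).compContinuousLinearMap (ContinuousLinearMap.snd ℝ F F') := by
  have hA' : ∀ q, DifferentiableAt ℝ A q := hA.differentiable one_ne_zero
  have hB' : ∀ q, DifferentiableAt ℝ B q := hB.differentiable one_ne_zero
  have h1 := extDeriv_pullback (r := 2) (f := ContinuousLinearMap.fst ℝ F F') (hA' p.1)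
    (ContinuousLinearMap.fst ℝ F F').contDiff.contDiffAt (by simp)
  have h2 := extDeriv_pullback (r := 2) (f := ContinuousLinearMap.snd ℝ F F') (hB' p.2)
    (ContinuousLinearMap.snd ℝ F F').contDiff.contDiffAt (by simp)
  simp only [ContinuousLinearMap.fderiv] at h1 h2
  refine (extDeriv_fun_add ?_ ?_).trans (congrArg₂ _ h1 h2)
  · exact ((ContinuousAlternatingMap.compContinuousLinearMapCLM (F := ℝ) (ι := Fin k)
      (ContinuousLinearMap.fst ℝ F F')).differentiableAt).comp p ((hA' p.1).comp p
          differentiableAt_fst)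
  · exact ((ContinuousAlternatingMap.compContinuousLinearMapCLM (F := ℝ) (ι := Fin k)
      (ContinuousLinearMap.snd ℝ F F')).differentiableAt).comp p ((hB' p.2).comp p
          differentiableAt_snd)

end LieForm

/-- Exchange of derivatives: if `u(t, s)` moves with velocity `v(t, s)`, then `∂ₛ u` moves with
velocity `∂ₛ v`, provided the latter is continuous. -/
lemma hasDerivAt_deriv_of_continuousAt {F : Type*} [NormedAddCommGroup F] [NormedSpace ℝ F]
    {u v u' v' : ℝ → ℝ → F} {t₀ : ℝ}
    (hu : ∀ᶠ q : ℝ × ℝ in 𝓝 (t₀, 0), HasDerivAt (fun t => u t q.2) (v q.1 q.2) q.1)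
    (hu' : ∀ᶠ t in 𝓝 t₀, HasDerivAt (u t) (u' t 0) 0)
    (hv' : ∀ᶠ q : ℝ × ℝ in 𝓝 (t₀, 0), HasDerivAt (v q.1) (v' q.1 q.2) q.2)
    (hc : ContinuousAt (fun q : ℝ × ℝ => v' q.1 q.2) (t₀, 0)) :
    HasDerivAt (fun t => u' t 0) (v' t₀ 0) t₀ := by
  refine hasDerivAt_of_tendstoUniformlyOnFilter (l := 𝓝[≠] (0 : ℝ))
    (f := fun s t => s⁻¹ • (u t s - u t 0)) (f' := fun s t => s⁻¹ • (v t s - v t 0))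
    (g' := fun t => v' t 0) ?_ ?_ ?_
  · rw [Metric.tendstoUniformlyOnFilter_iff]
    intro ε hε
    have h1 : ∀ᶠ q : ℝ × ℝ in 𝓝 (t₀, 0), dist (v' q.1 q.2) (v' t₀ 0) < ε / 3 :=
      Metric.tendsto_nhds.1 hc (ε / 3) (by positivity)
    obtain ⟨r, hr, hr'⟩ := Metric.eventually_nhds_iff_ball.1 (h1.and hv')
    have h2 : ∀ᶠ q : ℝ × ℝ in 𝓝[≠] (0 : ℝ) ×ˢ 𝓝 t₀, q.1 ∈ Metric.ball (0 : ℝ) r ∧ q.1 ≠ 0 ∧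
        q.2 ∈ Metric.ball t₀ r := by
      have h3 : ∀ᶠ s in 𝓝[≠] (0 : ℝ), s ∈ Metric.ball (0 : ℝ) r ∧ s ≠ 0 :=
        (eventually_mem_set.2 (mem_nhdsWithin_of_mem_nhds (Metric.ball_mem_nhds _ hr))).and
          self_mem_nhdsWithin
      filter_upwards [h3.prod_mk (eventually_mem_set.2 (Metric.ball_mem_nhds t₀ hr))] with q hq
      exact ⟨hq.1.1, hq.1.2, hq.2⟩
    filter_upwards [h2] with q hq
    obtain ⟨hs, hs0, ht⟩ := hq
    have hball : ∀ σ ∈ Metric.ball (0 : ℝ) r, (q.2, σ) ∈ Metric.ball (t₀, (0 : ℝ)) r := by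
      intro σ hσ
      rw [← ball_prod_same]
      exact ⟨ht, hσ⟩
    have hz : (0 : ℝ) ∈ Metric.ball (0 : ℝ) r := Metric.mem_ball_self hr
    -- mean value inequality for `v(t, ·) - s v'(t, 0)`
    have hmv := (convex_ball (0 : ℝ) r).norm_image_sub_le_of_norm_hasDerivWithin_le
      (f := fun σ => v q.2 σ - σ • v' q.2 0) (f' := fun σ => v' q.2 σ - v' q.2 0) (C := 2 * (ε / 3))
      (fun σ hσ => by
        have := ((hr' _ (hball σ hσ)).2.fun_sub ((hasDerivAt_id' σ).smul_const (v' q.2 0)))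
        rw [one_smul] at this
        exact this.hasDerivWithinAt)
      (fun σ hσ => by
        have e1 := (hr' _ (hball σ hσ)).1
        have e2 := (hr' _ (hball 0 hz)).1
        have e3 := dist_triangle_right (v' q.2 σ) (v' q.2 0) (v' t₀ 0)
        rw [← dist_eq_norm]
        simp only at e1 e2
        linarith) hz hs
    simp only [zero_smul, sub_zero] at hmv
    rw [dist_comm, dist_eq_norm]
    have e : q.1⁻¹ • (v q.2 q.1 - v q.2 0) - v' q.2 0 =
        q.1⁻¹ • (v q.2 q.1 - q.1 • v' q.2 0 - v q.2 0) := by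
      rw [smul_sub, smul_sub, smul_sub, smul_smul, inv_mul_cancel₀ hs0, one_smul]
      abel
    rw [e, norm_smul, norm_inv]
    have hpos : 0 < ‖q.1‖ := norm_pos_iff.2 hs0
    rw [inv_mul_lt_iff₀ hpos]
    nlinarith
  · have h1 : Tendsto (fun q : ℝ × ℝ => (q.2, q.1)) (𝓝[≠] (0 : ℝ) ×ˢ 𝓝 t₀) (𝓝 (t₀, 0)) :=
      (tendsto_snd.prodMk_nhds (tendsto_fst.mono_right nhdsWithin_le_nhds))
    have h2 : Tendsto (fun q : ℝ × ℝ => (q.2, (0 : ℝ))) (𝓝[≠] (0 : ℝ) ×ˢ 𝓝 t₀) (𝓝 (t₀, 0)) :=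
      tendsto_snd.prodMk_nhds tendsto_const_nhds
    filter_upwards [h1.eventually hu, h2.eventually hu] with q hq hq'
    exact (hq.sub hq').const_smul _
  · filter_upwards [hu'] with t ht
    have := ht.tendsto_slope
    refine this.congr fun s => ?_
    simp [slope, vsub_eq_sub]

/-! ### Integrals over compact sets depending on a parameter -/

section Parametric

variable {X : Type*} [TopologicalSpace X] [T2Space X] [MeasurableSpace X] [OpensMeasurableSpace X]
  {ν : Measure X} [IsFiniteMeasureOnCompacts ν] {K : Set X}

omit [T2Space X] [MeasurableSpace X] [OpensMeasurableSpace X] in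
lemma exists_bound_of_continuousOn (hK : IsCompact K) {u : ℝ → X → ℝ}
    (hu : ContinuousOn (Function.uncurry u) (univ ×ˢ K)) (t₀ : ℝ) :
    ∃ C, ∀ t ∈ Metric.closedBall t₀ 1, ∀ y ∈ K, ‖u t y‖ ≤ C := by
  obtain ⟨C, hC⟩ := ((isCompact_closedBall t₀ 1).prod hK).exists_bound_of_continuousOn
    (hu.mono (prod_mono_left (subset_univ _)))
  exact ⟨C, fun t ht y hy => hC (t, y) ⟨ht, hy⟩⟩

omit [T2Space X] [MeasurableSpace X] [OpensMeasurableSpace X] in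
lemma continuousOn_slice {u : ℝ → X → ℝ} (hu : ContinuousOn (Function.uncurry u) (univ ×ˢ K))
    (t : ℝ) : ContinuousOn (u t) K :=
  hu.comp (f := fun y => (t, y)) (Continuous.prodMk_right t).continuousOn fun _ hy => ⟨mem_univ _,
      hy⟩

lemma continuous_setIntegral_of_continuousOn (hK : IsCompact K) {u : ℝ → X → ℝ}
    (hu : ContinuousOn (Function.uncurry u) (univ ×ˢ K)) :
    Continuous fun t => ∫ y in K, u t y ∂ν := by
  rw [continuous_iff_continuousAt]
  intro t₀
  obtain ⟨C, hC⟩ := exists_bound_of_continuousOn hK hu t₀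
  refine continuousAt_of_dominated (bound := fun _ => C) (Eventually.of_forall fun t =>
    ((continuousOn_slice hu t).integrableOn_compact hK).aestronglyMeasurable) ?_
    (integrableOn_const hK.measure_lt_top.ne) ?_
  · filter_upwards [Metric.closedBall_mem_nhds t₀ one_pos] with t ht
    exact (ae_restrict_iff' hK.measurableSet).2 (Eventually.of_forall fun y hy => hC t ht y hy)
  · refine (ae_restrict_iff' hK.measurableSet).2 (Eventually.of_forall fun y hy => ?_)
    exact (hu.comp_continuous (f := fun t => (t, y)) (by fun_prop)
      fun t => ⟨mem_univ _, hy⟩).continuousAt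

lemma hasDerivAt_setIntegral_of_continuousOn (hK : IsCompact K) {u u' : ℝ → X → ℝ}
    (hu : ContinuousOn (Function.uncurry u) (univ ×ˢ K))
    (hu' : ContinuousOn (Function.uncurry u') (univ ×ˢ K)) {a b : ℝ} {Z : Set X} (hZ : ν Z = 0)
    (hd : ∀ y ∈ K \ Z, ∀ t ∈ Ioo a b, HasDerivAt (fun t => u t y) (u' t y) t) {t₀ : ℝ}
    (ht₀ : t₀ ∈ Ioo a b) :
    HasDerivAt (fun t => ∫ y in K, u t y ∂ν) (∫ y in K, u' t₀ y ∂ν) t₀ := by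
  obtain ⟨C, hC⟩ := exists_bound_of_continuousOn hK hu' t₀
  have hae : ∀ᵐ y ∂ν.restrict K, y ∈ K \ Z := by
    filter_upwards [ae_restrict_mem hK.measurableSet,
      ae_restrict_of_ae (measure_eq_zero_iff_ae_notMem.1 hZ)] with y hy hy'
    exact ⟨hy, hy'⟩
  refine (hasDerivAt_integral_of_dominated_loc_of_deriv_le (F := u) (F' := u') (bound := fun _ => C)
    (s := Metric.closedBall t₀ 1 ∩ Ioo a b)
    (inter_mem (Metric.closedBall_mem_nhds t₀ one_pos) (isOpen_Ioo.mem_nhds ht₀))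
    (Eventually.of_forall fun t =>
      ((continuousOn_slice hu t).integrableOn_compact hK).aestronglyMeasurable)
    ((continuousOn_slice hu t₀).integrableOn_compact hK)
    ((continuousOn_slice hu' t₀).integrableOn_compact hK).aestronglyMeasurable ?_
    (integrableOn_const hK.measure_lt_top.ne) ?_).2
  · exact hae.mono fun y hy t ht => hC t ht.1 y hy.1
  · exact hae.mono fun y hy t ht => hd y hy t ht.2

end Parametric

/-! ### Moving maps -/

section Moving

variable {d : ℕ} {N : Type*} [TopologicalSpace N] [ChartedSpace (EuclideanQuadrant d) N]
  [IsManifold (Corners d) ∞ N]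
  {F : Type*} [NormedAddCommGroup F] [NormedSpace ℝ F]

variable (d) in
/-- A family of `C¹` maps `h t : N → F` such that the maps and their derivatives are jointly
continuous. -/
structure IsC1Family (h : ℝ → N → F) : Prop where
  contMDiff : ∀ t, ContMDiff (Corners d) 𝓘(ℝ, F) 1 (h t)
  continuous : Continuous fun q : ℝ × N => h q.1 q.2
  continuous_mfderiv : Continuous fun q : ℝ × TangentBundle (Corners d) N =>
    (mfderiv (Corners d) 𝓘(ℝ, F) (h q.1) q.2.proj q.2.snd : F)

lemma IsC1Family.prodMk {F' : Type*} [NormedAddCommGroup F'] [NormedSpace ℝ F']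
    {h : ℝ → N → F} {h' : ℝ → N → F'} (hh : IsC1Family d h) (hh' : IsC1Family d h') :
    IsC1Family d (fun t p => (h t p, h' t p)) where
  contMDiff t := (hh.contMDiff t).prodMk_space (hh'.contMDiff t)
  continuous := hh.continuous.prodMk hh'.continuous
  continuous_mfderiv := by
    refine (hh.continuous_mfderiv.prodMk hh'.continuous_mfderiv).congr fun q => ?_
    have hpair := ((hh.contMDiff q.1).prodMk_space (hh'.contMDiff q.1)).mdifferentiable one_ne_zero
      q.2.proj
    refine Prod.ext ?_ ?_
    · exact mfderiv_clm_comp (ContinuousLinearMap.fst ℝ F F') hpair q.2.snd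
    · exact mfderiv_clm_comp (ContinuousLinearMap.snd ℝ F F') hpair q.2.snd

lemma continuousOn_chartVector (x : N) (v : EuclideanSpace ℝ (Fin d)) :
    ContinuousOn (fun y => (⟨(extChartAt (Corners d) x).symm y,
      mfderivWithin 𝓘(ℝ, EuclideanSpace ℝ (Fin d)) (Corners d) (extChartAt (Corners d) x).symm
        (range (Corners d)) y v⟩ : TangentBundle (Corners d) N)) (extChartAt (Corners d) x).target
            := by
  have h1 := (contMDiffOn_extChartAt_symm (I := Corners d) (n := 1)
    x).continuousOn_tangentMapWithin le_rfl (uniqueDiffOn_target x).uniqueMDiffOn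
  have h2 : Continuous (fun y : EuclideanSpace ℝ (Fin d) =>
      (⟨y, v⟩ : TangentBundle 𝓘(ℝ, EuclideanSpace ℝ (Fin d)) (EuclideanSpace ℝ (Fin d)))) :=
    (tangentBundleModelSpaceHomeomorph 𝓘(ℝ, EuclideanSpace ℝ (Fin d))).symm.continuous.comp
      (continuous_id.prodMk continuous_const)
  refine (h1.comp h2.continuousOn fun y hy => hy).congr fun y hy => ?_
  have h3 := (mdifferentiableWithinAt_extChartAt_symm (I := Corners d) hy).mfderivWithin_mono
    ((uniqueDiffOn_target x).uniqueMDiffOn y hy) (extChartAt_target_subset_range x)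
  simp only [Function.comp, tangentMapWithin]
  rw [h3]

lemma IsC1Family.continuousOn_coordMap {h : ℝ → N → F} (hh : IsC1Family d h) (x : N) :
    ContinuousOn (fun q : ℝ × EuclideanSpace ℝ (Fin d) => coordMap (Corners d) (h q.1) x q.2)
      (univ ×ˢ (extChartAt (Corners d) x).target) :=
  hh.continuous.comp_continuousOn (continuousOn_fst.prodMk
    ((continuousOn_extChartAt_symm x).comp continuousOn_snd fun _ hq => hq.2))

lemma IsC1Family.continuousOn_fderivWithin {h : ℝ → N → F} (hh : IsC1Family d h) (x : N)
    (v : EuclideanSpace ℝ (Fin d)) :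
    ContinuousOn (fun q : ℝ × EuclideanSpace ℝ (Fin d) =>
      fderivWithin ℝ (coordMap (Corners d) (h q.1) x) (range (Corners d)) q.2 v)
      (univ ×ˢ (extChartAt (Corners d) x).target) := by
  refine (hh.continuous_mfderiv.comp_continuousOn (continuousOn_fst.prodMk
    ((continuousOn_chartVector x v).comp continuousOn_snd fun q hq => hq.2))).congr fun q hq => ?_
  rw [fderivWithin_coordMap hq.2 ((hh.contMDiff q.1).mdifferentiable one_ne_zero _)]
  rfl

lemma IsC1Family.continuousOn_localForm {k : ℕ} {h : ℝ → N → F} (hh : IsC1Family d h)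
    {Ξ : F → F [⋀^Fin k]→L[ℝ] ℝ} (hΞ : Continuous Ξ) (x : N)
    (v : Fin k → EuclideanSpace ℝ (Fin d)) :
    ContinuousOn (fun q : ℝ × EuclideanSpace ℝ (Fin d) =>
      localForm (flatPullback (Corners d) (h q.1) Ξ) x q.2 v)
      (univ ×ˢ (extChartAt (Corners d) x).target) := by
  have h1 : ContinuousOn (fun q : ℝ × EuclideanSpace ℝ (Fin d) =>
      Ξ (coordMap (Corners d) (h q.1) x q.2) (fun i =>
        fderivWithin ℝ (coordMap (Corners d) (h q.1) x) (range (Corners d)) q.2 (v i)))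
      (univ ×ˢ (extChartAt (Corners d) x).target) :=
    (hΞ.comp_continuousOn (hh.continuousOn_coordMap x)).eval
      (continuousOn_pi.2 fun i => hh.continuousOn_fderivWithin x (v i))
  refine h1.congr fun q hq => ?_
  rw [localForm_flatPullback hq.2 ((hh.contMDiff q.1).mdifferentiable one_ne_zero _)]
  rfl

/-- If `f` moves with velocity `w`, then the coefficients of `f^* Θ` move with velocity
`(f, w)^* (lieForm Θ)`, at interior points. -/
lemma hasDerivAt_localForm_flatPullback {k : ℕ} {f w : ℝ → N → F} (hf : IsC1Family d f)
    (hw : IsC1Family d w) {a b : ℝ} (hfw : ∀ p, ∀ t ∈ Ioo a b, HasDerivAt (fun s => f s p) (w t p)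
        t)
    {Θ : F → F [⋀^Fin (k + 1)]→L[ℝ] ℝ} (hΘ : ContDiff ℝ 1 Θ) {x : N}
    {y : EuclideanSpace ℝ (Fin d)} (hy : y ∈ (extChartAt (Corners d) x).target)
    (hy' : y ∈ interior (range (Corners d))) (v : Fin (k + 1) → EuclideanSpace ℝ (Fin d)) {t : ℝ}
    (ht : t ∈ Ioo a b) :
    HasDerivAt (fun s => localForm (flatPullback (Corners d) (f s) Θ) x y v)
      (localForm (flatPullback (Corners d) (fun p => (f t p, w t p)) (lieForm Θ)) x y v) t := by
  have hfd : ∀ s p, MDifferentiableAt (Corners d) 𝓘(ℝ, F) (f s) p := fun s =>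
    (hf.contMDiff s).mdifferentiable one_ne_zero
  have hwd : ∀ s p, MDifferentiableAt (Corners d) 𝓘(ℝ, F) (w s) p := fun s =>
    (hw.contMDiff s).mdifferentiable one_ne_zero
  have hrange : range (Corners d) ∈ 𝓝 y := mem_interior_iff_mem_nhds.1 hy'
  have htgt : (extChartAt (Corners d) x).target ∈ 𝓝 y := by
    have := extChartAt_target_mem_nhdsWithin_of_mem hy
    rwa [nhdsWithin_eq_nhds.2 hrange] at this
  have key : ∀ e : EuclideanSpace ℝ (Fin d), HasDerivAt
      (fun s => fderivWithin ℝ (coordMap (Corners d) (f s) x) (range (Corners d)) y e)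
      (fderivWithin ℝ (coordMap (Corners d) (w t) x) (range (Corners d)) y e) t := by
    intro e
    have hline : ∀ s : ℝ, HasDerivAt (fun σ : ℝ => y + σ • e) e s := fun s => by
      simpa using ((hasDerivAt_id s).smul_const e).const_add y
    have hT : Tendsto (fun q : ℝ × ℝ => y + q.2 • e) (𝓝 (t, 0)) (𝓝 y) := by
      have : Continuous fun q : ℝ × ℝ => y + q.2 • e := by fun_prop
      simpa using this.tendsto (t, 0)
    have hder : ∀ (h : ℝ → N → F), IsC1Family d h → ∀ q : ℝ × ℝ,
        (extChartAt (Corners d) x).target ∈ 𝓝 (y + q.2 • e) →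
        HasDerivAt (fun σ : ℝ => coordMap (Corners d) (h q.1) x (y + σ • e))
          (fderivWithin ℝ (coordMap (Corners d) (h q.1) x) (range (Corners d)) (y + q.2 • e) e)
          q.2 := by
      intro h hh q hq
      have h1 := (differentiableWithinAt_coordMap (hh.contMDiff q.1)
        (mem_of_mem_nhds hq)).hasFDerivWithinAt.hasFDerivAt
          (mem_of_superset hq (extChartAt_target_subset_range x))
      exact h1.comp_hasDerivAt q.2 (hline q.2)
    have h0 : (extChartAt (Corners d) x).target ∈ 𝓝 (y + (0 : ℝ) • e) := by simpa using htgt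
    have hmain := hasDerivAt_deriv_of_continuousAt (t₀ := t)
      (u := fun s σ => coordMap (Corners d) (f s) x (y + σ • e))
      (v := fun s σ => coordMap (Corners d) (w s) x (y + σ • e))
      (u' := fun s σ =>
        fderivWithin ℝ (coordMap (Corners d) (f s) x) (range (Corners d)) (y + σ • e) e)
      (v' := fun s σ =>
        fderivWithin ℝ (coordMap (Corners d) (w s) x) (range (Corners d)) (y + σ • e) e)
      ?_ ?_ ?_ ?_
    · simpa using hmain
    · have : ∀ᶠ q : ℝ × ℝ in 𝓝 (t, 0), q.1 ∈ Ioo a b :=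
        continuous_fst.continuousAt.eventually_mem (isOpen_Ioo.mem_nhds ht)
      exact this.mono fun q hq => hfw _ _ hq
    · exact Eventually.of_forall fun s => hder f hf (s, 0) h0
    · exact (hT.eventually (eventually_eventually_nhds.2 htgt)).mono fun q hq => hder w hw q hq
    · have h1 : ContinuousAt (fun q : ℝ × EuclideanSpace ℝ (Fin d) =>
          fderivWithin ℝ (coordMap (Corners d) (w q.1) x) (range (Corners d)) q.2 e) (t, y) :=
        (hw.continuousOn_fderivWithin x e).continuousAt (prod_mem_nhds univ_mem htgt)
      have h2 : Continuous fun q : ℝ × ℝ => (q.1, y + q.2 • e) := by fun_prop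
      have h3 : (t, y) = (fun q : ℝ × ℝ => (q.1, y + q.2 • e)) (t, 0) := by simp
      rw [h3] at h1
      exact h1.comp (f := fun q : ℝ × ℝ => (q.1, y + q.2 • e)) h2.continuousAt
  have h1 := hasDerivAt_form_apply hΘ (hfw ((extChartAt (Corners d) x).symm y) t ht)
    (fun i => key (v i))
  refine (h1.congr_of_eventuallyEq (Eventually.of_forall fun s => ?_)).congr_deriv ?_
  · rw [localForm_flatPullback hy (hfd s _)]
    rfl
  · rw [localForm_flatPullback hy ((hfd t _).prodMk_space (hwd t _))]
    have h2 : fderivWithin ℝ (coordMap (Corners d) (fun p => (f t p, w t p)) x)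
        (range (Corners d)) y = (fderivWithin ℝ (coordMap (Corners d) (f t) x)
          (range (Corners d)) y).prod
          (fderivWithin ℝ (coordMap (Corners d) (w t) x) (range (Corners d)) y) :=
      (differentiableWithinAt_coordMap (hf.contMDiff t) hy).fderivWithin_prodMk
        (differentiableWithinAt_coordMap (hw.contMDiff t) hy) (uniqueDiffWithinAt_of_mem_target hy)
    rw [h2]
    rfl

end Moving

/-! ### The integral of a pullback under a moving map -/

section MovingIntegral

variable {d : ℕ} {N : Type*} [TopologicalSpace N] [T2Space N] [CompactSpace N]
  [ChartedSpace (EuclideanQuadrant d) N] [IsManifold (Corners d) ∞ N]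
  {F : Type*} [NormedAddCommGroup F] [NormedSpace ℝ F]

/-- The integrand of `formIntegral` in the chart at `x`. -/
def chartIntegrand (μ θ : DForm (Corners d) N d) (x : N) (y : EuclideanSpace ℝ (Fin d)) : ℝ :=
  frameSign μ x y * (chartPartition d N x ((extChartAt (Corners d) x).symm y) *
    localForm θ x y coordVec)

lemma formIntegral_eq_sum_partitionImage (μ θ : DForm (Corners d) N d) :
    formIntegral μ θ = ∑ x ∈ activeCharts d N, ∫ y in partitionImage (d := d) x, chartIntegrand μ θ
        x y := by
  rw [formIntegral_eq_sum]
  refine Finset.sum_congr rfl fun x _ => ?_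
  refine (setIntegral_eq_of_subset_of_forall_sdiff_eq_zero (f := fun y =>
      frameSign μ x y * localForm (fun p => chartPartition d N x p • θ p) x y coordVec)
    (measurableSet_target x)
    (partitionImage_subset (d := d) x) fun y hy => ?_).trans ?_
  · change frameSign μ x y * (chartPartition d N x ((extChartAt (Corners d) x).symm y) *
      localForm θ x y coordVec) = 0
    rw [image_eq_zero_of_notMem_tsupport
      (notMem_tsupport_of_notMem_partitionImage hy.1 hy.2), zero_mul, mul_zero]
  · rfl

lemma IsC1Family.continuousOn_chartIntegrand {μ : DForm (Corners d) N d} (hμ0 : IsC0 μ)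
    (hμ : ∀ p, μ p ≠ 0) {h : ℝ → N → F} (hh : IsC1Family d h) {Ξ : F → F [⋀^Fin d]→L[ℝ] ℝ}
    (hΞ : Continuous Ξ) (x : N) :
    ContinuousOn (Function.uncurry fun t y =>
      chartIntegrand μ (flatPullback (Corners d) (h t) Ξ) x y) (univ ×ˢ partitionImage (d := d) x)
          := by
  have h1 : MapsTo Prod.snd ((univ : Set ℝ) ×ˢ (extChartAt (Corners d) x).target)
    (extChartAt (Corners d) x).target := fun q hq => hq.2
  have h2 := ((continuousOn_frameSign hμ0 hμ x).comp continuousOn_snd h1).mul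
    (((((contMDiff_chartPartition (d := d) x).continuous).comp_continuousOn
        (continuousOn_extChartAt_symm x)).comp
      continuousOn_snd h1).mul (hh.continuousOn_localForm hΞ x coordVec))
  exact h2.mono (prod_mono_right (partitionImage_subset (d := d) x))

lemma IsC1Family.continuous_formIntegral {μ : DForm (Corners d) N d} (hμ0 : IsC0 μ)
    (hμ : ∀ p, μ p ≠ 0) {h : ℝ → N → F} (hh : IsC1Family d h) {Ξ : F → F [⋀^Fin d]→L[ℝ] ℝ}
    (hΞ : Continuous Ξ) :
    Continuous fun t => formIntegral μ (flatPullback (Corners d) (h t) Ξ) := by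
  simp only [formIntegral_eq_sum_partitionImage]
  exact continuous_finsetSum _ fun x _ => continuous_setIntegral_of_continuousOn
    (isCompact_partitionImage (d := d) x) (hh.continuousOn_chartIntegrand hμ0 hμ hΞ x)

end MovingIntegral

/-- The transport formula `d/dt ∫ f^* Θ = ∫ (f, w)^* (lieForm Θ)`, where `f` moves with
velocity `w`. -/
lemma hasDerivAt_formIntegral_flatPullback {k : ℕ} {N : Type*} [TopologicalSpace N] [T2Space N]
    [CompactSpace N] [ChartedSpace (EuclideanQuadrant (k + 1)) N]
    [IsManifold (Corners (k + 1)) ∞ N] {F : Type*} [NormedAddCommGroup F] [NormedSpace ℝ F]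
    {μ : DForm (Corners (k + 1)) N (k + 1)} (hμ0 : IsC0 μ) (hμ : ∀ p, μ p ≠ 0)
    {f w : ℝ → N → F} (hf : IsC1Family (k + 1) f) (hw : IsC1Family (k + 1) w) {a b : ℝ}
    (hfw : ∀ p, ∀ t ∈ Ioo a b, HasDerivAt (fun s => f s p) (w t p) t)
    {Θ : F → F [⋀^Fin (k + 1)]→L[ℝ] ℝ} (hΘ : ContDiff ℝ 1 Θ) {t : ℝ} (ht : t ∈ Ioo a b) :
    HasDerivAt (fun s => formIntegral μ (flatPullback (Corners (k + 1)) (f s) Θ))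
      (formIntegral μ (flatPullback (Corners (k + 1)) (fun p => (f t p, w t p)) (lieForm Θ))) t :=
          by
  simp only [formIntegral_eq_sum_partitionImage]
  refine HasDerivAt.fun_sum fun x _ => ?_
  refine hasDerivAt_setIntegral_of_continuousOn (isCompact_partitionImage (d := k + 1) x)
    (hf.continuousOn_chartIntegrand hμ0 hμ hΘ.continuous x)
    ((hf.prodMk hw).continuousOn_chartIntegrand hμ0 hμ (continuous_lieForm hΘ) x)
    (Z := frontier (range (Corners (k + 1)))) ((Corners (k + 1)).convex_range.addHaar_frontier _)
    (fun y hy s hs => ?_) ht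
  have hyt := partitionImage_subset x hy.1
  have hy' : y ∈ interior (range (Corners (k + 1))) := by
    by_contra hc
    exact hy.2 ⟨subset_closure (extChartAt_target_subset_range x hyt), hc⟩
  exact ((hasDerivAt_localForm_flatPullback hf hw hfw hΘ hyt hy' coordVec hs).const_mul
      _).const_mul _

/-! ### Families of maps obtained from a flow -/

section Transport

variable {n d : ℕ} {M : Type*} [TopologicalSpace M] [ChartedSpace (EuclideanSpace ℝ (Fin n)) M]
  [IsManifold (𝓡 n) ∞ M]
  {N : Type*} [TopologicalSpace N] [ChartedSpace (EuclideanQuadrant d) N]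
  [IsManifold (Corners d) ∞ N]
  {F : Type*} [NormedAddCommGroup F] [NormedSpace ℝ F]

/-- A function of class `C¹` on `ℝ × M`, evaluated along a family of maps to `M`. -/
lemma isC1Family_comp {ψ : ℝ → N → M} (hψ : ∀ t, ContMDiff (Corners d) (𝓡 n) 1 (ψ t))
    (hψ' : Continuous fun q : ℝ × TangentBundle (Corners d) N =>
      tangentMap (Corners d) (𝓡 n) (ψ q.1) q.2)
    {G : ℝ × M → F} (hG : ContMDiff (𝓘(ℝ, ℝ).prod (𝓡 n)) 𝓘(ℝ, F) 1 G) :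
    IsC1Family d (fun t p => G (t, ψ t p)) where
  contMDiff t := hG.comp (contMDiff_const.prodMk (hψ t))
  continuous := by
    have h1 : Continuous fun q : ℝ × N =>
        (tangentMap (Corners d) (𝓡 n) (ψ q.1) ⟨q.2, 0⟩ : TangentBundle (𝓡 n) M).proj := by
      have h2 : Continuous fun p : N => (⟨p, 0⟩ : TangentBundle (Corners d) N) :=
        (Bundle.contMDiff_zeroSection ℝ (TangentSpace (Corners d) : N → Type _)
          (IB := Corners d) (n := 0)).continuous
      exact (FiberBundle.continuous_proj _ _).comp
        (hψ'.comp (continuous_fst.prodMk (h2.comp continuous_snd)))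
    exact hG.continuous.comp (continuous_fst.prodMk h1)
  continuous_mfderiv := by
    have h1 : Continuous fun q : ℝ × TangentBundle (Corners d) N =>
        (equivTangentBundleProd 𝓘(ℝ, ℝ) ℝ (𝓡 n) M).symm
          (⟨q.1, 0⟩, tangentMap (Corners d) (𝓡 n) (ψ q.1) q.2) := by
      have h2 : Continuous fun t : ℝ => (⟨t, 0⟩ : TangentBundle 𝓘(ℝ, ℝ) ℝ) :=
        (Bundle.contMDiff_zeroSection ℝ (TangentSpace 𝓘(ℝ, ℝ) : ℝ → Type _)
          (IB := 𝓘(ℝ, ℝ)) (n := 0)).continuous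
      exact (contMDiff_equivTangentBundleProd_symm (n := 0)).continuous.comp
        ((h2.comp continuous_fst).prodMk hψ')
    have h3 := ((contMDiff_snd_tangentBundle_modelSpace F 𝓘(ℝ, F) (n := 0)).continuous.comp
      (hG.continuous_tangentMap le_rfl)).comp h1
    refine h3.congr fun q => ?_
    have h4 := mfderiv_comp q.2.proj (hG.mdifferentiable one_ne_zero (q.1, ψ q.1 q.2.proj))
      ((contMDiff_const (c := q.1)).prodMk (hψ q.1) |>.mdifferentiable one_ne_zero q.2.proj)
    have h5 := mfderiv_prodMk (mdifferentiableAt_const (I' := 𝓘(ℝ, ℝ)) (c := q.1))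
      ((hψ q.1).mdifferentiable one_ne_zero q.2.proj)
    rw [h5, mfderiv_const] at h4
    refine Eq.trans ?_ (congrArg (fun A => A q.2.snd) h4).symm
    rfl

omit [IsManifold (𝓡 n) ∞ M] [IsManifold (Corners d) ∞ N] in
lemma pullback_flatPullback {k : ℕ} {e : M → F} (he : ContMDiff (𝓡 n) 𝓘(ℝ, F) ∞ e) {g : N → M}
    (hg : ContMDiff (Corners d) (𝓡 n) 1 g) {Θ : F → F [⋀^Fin k]→L[ℝ] ℝ} {θ : DForm (𝓡 n) M k}
    {q : N} (hθ : θ (g q) = flatPullback (𝓡 n) e Θ (g q)) :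
    pullback (J := Corners d) g θ q = flatPullback (Corners d) (e ∘ g) Θ q := by
  have h1 := mfderiv_comp q (he.mdifferentiable (by simp) (g q)) (hg.mdifferentiable one_ne_zero q)
  unfold pullback flatPullback
  rw [hθ, h1]
  rfl

/-- The velocity `De(V)` of `e ∘ φ`, for a `C¹` field. -/
lemma contMDiff_mfderiv_field {e : M → F} (he : ContMDiff (𝓡 n) 𝓘(ℝ, F) ∞ e)
    {W : ℝ → ∀ p : M, TangentSpace (𝓡 n) p} (hW : IsC1Field W) :
    ContMDiff (𝓘(ℝ, ℝ).prod (𝓡 n)) 𝓘(ℝ, F) 1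
      (fun q : ℝ × M => (mfderiv (𝓡 n) 𝓘(ℝ, F) e q.2 (W q.1 q.2) : F)) := by
  have h1 : ContMDiff (𝓡 n).tangent 𝓘(ℝ, F).tangent 1 (tangentMap (𝓡 n) 𝓘(ℝ, F) e) :=
    (he.of_le (m := 2) (WithTop.coe_le_coe.2 (le_top : (2 : ℕ∞) ≤ ⊤))).contMDiff_tangentMap
      (by norm_num)
  exact (contMDiff_snd_tangentBundle_modelSpace F 𝓘(ℝ, F)).comp (h1.comp hW)

end Transport

/-! ### The rate of change of the surface integral -/

section Flux

variable {m : ℕ} {M : Type*} [TopologicalSpace M]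
  [ChartedSpace (EuclideanSpace ℝ (Fin (m + 2))) M]
  [IsManifold (𝓡 (m + 2)) ∞ M]
  {D : Set ℝ} {V : ℝ → ∀ p : M, TangentSpace (𝓡 (m + 2)) p} {φ : ℝ → ℝ → M → M}

lemma contMDiff_flow_emb (hφ : IsFlow D V φ) {d : ℕ} (Γ : CompactSubmanifold d (m + 2) M)
    (τ t : ℝ) : ContMDiff (Corners d) (𝓡 (m + 2)) 1 (φ t τ ∘ Γ.emb) :=
  (hφ.contMDiff t τ).comp Γ.contMDiff_emb

lemma continuous_tangentMap_flow_emb (hφ : IsFlow D V φ) {d : ℕ}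
    (Γ : CompactSubmanifold d (m + 2) M) (τ : ℝ) :
    Continuous fun q : ℝ × TangentBundle (Corners d) Γ.carrier =>
      tangentMap (Corners d) (𝓡 (m + 2)) (φ q.1 τ ∘ Γ.emb) q.2 := by
  have h1 := Γ.contMDiff_emb.continuous_tangentMap le_rfl
  refine ((hφ.continuous_tangentMap τ).comp
    (continuous_fst.prodMk (h1.comp continuous_snd))).congr fun q => ?_
  exact (tangentMap_comp_at q.2 ((hφ.contMDiff q.1 τ).mdifferentiable one_ne_zero _)
    (Γ.contMDiff_emb.mdifferentiable one_ne_zero _)).symm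

/-- The motion of a submanifold under the flow, in the coordinates given by a map to a vector
space. -/
lemma isC1Family_flow_emb (hφ : IsFlow D V φ) {d : ℕ} (Γ : CompactSubmanifold d (m + 2) M) (τ : ℝ)
    {F : Type*} [NormedAddCommGroup F] [NormedSpace ℝ F] {e : M → F}
    (he : ContMDiff (𝓡 (m + 2)) 𝓘(ℝ, F) ∞ e) :
    IsC1Family d (fun t => e ∘ φ t τ ∘ Γ.emb) :=
  isC1Family_comp (G := fun q => e q.2) (contMDiff_flow_emb hφ Γ τ)
    (continuous_tangentMap_flow_emb hφ Γ τ) ((he.of_le (by simp)).comp contMDiff_snd)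

/-- The part of `M` swept out by a compact submanifold in a compact time interval. -/
lemma isCompact_flow_image (hφ : IsFlow D V φ) {d : ℕ} (Γ : CompactSubmanifold d (m + 2) M)
    (τ a b : ℝ) :
    IsCompact ((fun q : ℝ × Γ.carrier => φ q.1 τ (Γ.emb q.2)) '' (Icc a b ×ˢ univ)) := by
  refine (isCompact_Icc.prod isCompact_univ).image ?_
  have h2 : Continuous fun p : Γ.carrier => (⟨p, 0⟩ : TangentBundle (Corners d) Γ.carrier) :=
    (Bundle.contMDiff_zeroSection ℝ (TangentSpace (Corners d) : Γ.carrier → Type _)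
      (IB := Corners d) (n := 0)).continuous
  exact (FiberBundle.continuous_proj _ _).comp
    ((continuous_tangentMap_flow_emb hφ Γ τ).comp (continuous_fst.prodMk (h2.comp continuous_snd)))

lemma hasDerivAt_flow_emb (hφ : IsFlow D V φ) {F : Type*} [NormedAddCommGroup F] [NormedSpace ℝ F]
    {e : M → F} (he : ContMDiff (𝓡 (m + 2)) 𝓘(ℝ, F) ∞ e) (τ : ℝ) (x : M) {t : ℝ} (ht : t ∉ D) :
    HasDerivAt (fun s => e (φ s τ x))
      (mfderiv (𝓡 (m + 2)) 𝓘(ℝ, F) e (φ t τ x) (V t (φ t τ x)) : F) t := by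
  let L : EuclideanSpace ℝ (Fin (m + 2)) →L[ℝ] F := mfderiv (𝓡 (m + 2)) 𝓘(ℝ, F) e (φ t τ x)
  let v : EuclideanSpace ℝ (Fin (m + 2)) := V t (φ t τ x)
  have h1 : HasFDerivAt (fun s => e (φ s τ x)) (L.comp ((1 : ℝ →L[ℝ] ℝ).smulRight v)) t :=
    ((he.mdifferentiable (by simp) (φ t τ x)).hasMFDerivAt.comp t
      (hφ.hasDeriv τ x t ht)).hasFDerivAt
  refine h1.hasDerivAt.congr_deriv ?_
  change L ((1 : ℝ) • v) = L v
  rw [one_smul]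

lemma surfaceIntegral_eq (hφ : IsFlow D V φ) (Γ : OrientedSubmanifold (m + 1) (m + 2) M) (τ t : ℝ)
    {F : Type*} [NormedAddCommGroup F] [NormedSpace ℝ F] {e : M → F}
    (he : ContMDiff (𝓡 (m + 2)) 𝓘(ℝ, F) ∞ e) {Θ : F → F [⋀^Fin (m + 1)]→L[ℝ] ℝ}
    {θ : DForm (𝓡 (m + 2)) M (m + 1)}
    (hθ : ∀ q, θ (φ t τ (Γ.emb q)) = flatPullback (𝓡 (m + 2)) e Θ (φ t τ (Γ.emb q))) :
    surfaceIntegral Γ (φ t τ) θ =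
      formIntegral Γ.orient (flatPullback (Corners (m + 1)) (e ∘ φ t τ ∘ Γ.emb) Θ) := by
  unfold surfaceIntegral
  congr 1
  funext q
  exact pullback_flatPullback he (contMDiff_flow_emb hφ Γ.toCompactSubmanifold τ t) (hθ q)

variable [T2Space M] [SecondCountableTopology M]

/-- The integral of a `C¹` form over the moving surface is continuous in time. -/
lemma continuous_surfaceIntegral (hφ : IsFlow D V φ) (Γ : OrientedSubmanifold (m + 1) (m + 2) M)
    (τ : ℝ) {θ : DForm (𝓡 (m + 2)) M (m + 1)} (hθ : IsC1 θ) :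
    Continuous fun t => surfaceIntegral Γ (φ t τ) θ := by
  rw [continuous_iff_continuousAt]
  intro t₀
  obtain ⟨F, _, _, _, e, Θ, he, hΘ, heq⟩ := exists_flatPullback_eq
    (isCompact_flow_image hφ Γ.toCompactSubmanifold τ (t₀ - 1) (t₀ + 1)) hθ
  have h1 := (isC1Family_flow_emb hφ Γ.toCompactSubmanifold τ he).continuous_formIntegral
    Γ.continuous_orient Γ.orient_ne_zero hΘ.continuous
  refine h1.continuousAt.congr ?_
  filter_upwards [Icc_mem_nhds (show t₀ - 1 < t₀ by linarith) (show t₀ < t₀ + 1 by linarith)]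
    with t ht
  exact (surfaceIntegral_eq hφ Γ τ t he fun q => (heq _ ⟨(t, q), ⟨ht, mem_univ _⟩, rfl⟩).1).symm

/-- The flux of the Lagrangian form `ι_X α + β` through `∂N`, as an integral over `N`: the
differential of `ι_X α + β` is `d(ι_X α) + ι_X dα`. The form `α` and the velocity `X` along `g` are
given in the coordinates `e`. -/
lemma boundaryIntegral_pullback_lagrangian {N : Type*} [TopologicalSpace N] [T2Space N]
    [CompactSpace N] [ChartedSpace (EuclideanQuadrant (m + 1)) N] [IsManifold (Corners (m + 1)) ∞ N]
    {μ : DForm (Corners (m + 1)) N (m + 1)} (hμ0 : IsC0 μ) (hμ : ∀ p, μ p ≠ 0)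
    {g : N → M} (hg : ContMDiff (Corners (m + 1)) (𝓡 (m + 2)) 1 g)
    {F : Type*} [NormedAddCommGroup F] [NormedSpace ℝ F] [FiniteDimensional ℝ F] {e : M → F}
    (he : ContMDiff (𝓡 (m + 2)) 𝓘(ℝ, F) ∞ e) {Θ : F → F [⋀^Fin (m + 1)]→L[ℝ] ℝ}
    (hΘ : ContDiff ℝ 1 Θ) {α : DForm (𝓡 (m + 2)) M (m + 1)}
    (hα : ∀ q, α (g q) = flatPullback (𝓡 (m + 2)) e Θ (g q) ∧
      extD α (g q) = flatPullback (𝓡 (m + 2)) e (extDeriv Θ) (g q))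
    {X : ∀ p : M, TangentSpace (𝓡 (m + 2)) p} {w : N → F}
    (hw : ContMDiff (Corners (m + 1)) 𝓘(ℝ, F) 1 w)
    (hwX : ∀ q, w q = (mfderiv (𝓡 (m + 2)) 𝓘(ℝ, F) e (g q) (X (g q)) : F))
    {β : DForm (𝓡 (m + 2)) M m} (hβ : IsC1 β) (hXβ : contract X (extD α) = extD β) :
    boundaryIntegral μ (pullback g (contract X α + β)) =
      formIntegral μ (flatPullback (Corners (m + 1)) (fun q => ((e ∘ g) q, w q)) (lieForm Θ)) := by
  obtain ⟨F', _, _, _, e', Θ', he', hΘ', heq'⟩ := exists_flatPullback_eq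
    (isCompact_range hg.continuous) hβ
  have hde : ∀ q, @Eq (EuclideanSpace ℝ (Fin (m + 1)) →L[ℝ] F)
      (mfderiv (Corners (m + 1)) 𝓘(ℝ, F) (e ∘ g) q) ((mfderiv (𝓡 (m + 2)) 𝓘(ℝ, F) e (g q)).comp
        (mfderiv (Corners (m + 1)) (𝓡 (m + 2)) g q)) := fun q =>
    mfderiv_comp q (he.mdifferentiable (by simp) (g q)) (hg.mdifferentiable one_ne_zero q)
  have heg : ContMDiff (Corners (m + 1)) 𝓘(ℝ, F) 1 (e ∘ g) := (he.of_le (by simp)).comp hg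
  have heg' : ContMDiff (Corners (m + 1)) 𝓘(ℝ, F') 1 (e' ∘ g) := (he'.of_le (by simp)).comp hg
  have hfw := heg.prodMk_space hw
  have hh := hfw.prodMk_space heg'
  -- the derivative of `((e ∘ g, w), e' ∘ g)`, componentwise
  have hd1 : ∀ q v, (mfderiv (Corners (m + 1)) 𝓘(ℝ, (F × F) × F')
      (fun q => (((e ∘ g) q, w q), (e' ∘ g) q)) q v : (F × F) × F').1 =
      (mfderiv (Corners (m + 1)) 𝓘(ℝ, F × F) (fun q => ((e ∘ g) q, w q)) q v : F × F) := fun q v =>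
    (mfderiv_clm_comp (ContinuousLinearMap.fst ℝ (F × F) F') (hh.mdifferentiable one_ne_zero q)
      v).symm
  have hd2 : ∀ q v, (mfderiv (Corners (m + 1)) 𝓘(ℝ, (F × F) × F')
      (fun q => (((e ∘ g) q, w q), (e' ∘ g) q)) q v : (F × F) × F').2 =
      (mfderiv (Corners (m + 1)) 𝓘(ℝ, F') (e' ∘ g) q v : F') := fun q v =>
    (mfderiv_clm_comp (ContinuousLinearMap.snd ℝ (F × F) F') (hh.mdifferentiable one_ne_zero q)
      v).symm
  have hd3 : ∀ q v, (mfderiv (Corners (m + 1)) 𝓘(ℝ, F × F) (fun q => ((e ∘ g) q, w q)) q v :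
      F × F).1 = (mfderiv (Corners (m + 1)) 𝓘(ℝ, F) (e ∘ g) q v : F) := fun q v =>
    (mfderiv_clm_comp (ContinuousLinearMap.fst ℝ F F) (hfw.mdifferentiable one_ne_zero q) v).symm
  have hΞ : ContDiff ℝ 1 (fun p : (F × F) × F' =>
      (contractForm Θ p.1).compContinuousLinearMap (ContinuousLinearMap.fst ℝ (F × F) F') +
        (Θ' p.2).compContinuousLinearMap (ContinuousLinearMap.snd ℝ (F × F) F')) :=
    ((ContinuousAlternatingMap.compContinuousLinearMapCLM (F := ℝ) (ι := Fin m)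
      (ContinuousLinearMap.fst ℝ (F × F) F')).contDiff.comp
        ((contDiff_contractForm hΘ).comp contDiff_fst)).add
      ((ContinuousAlternatingMap.compContinuousLinearMapCLM (F := ℝ) (ι := Fin m)
        (ContinuousLinearMap.snd ℝ (F × F) F')).contDiff.comp (hΘ'.comp contDiff_snd))
  have hStokes := formIntegral_flatPullback_extDeriv hμ0 hμ hh hΞ
  -- `ι_X θ` along `g` in the coordinates `e`
  have hcontract : ∀ {j : ℕ} {θ : DForm (𝓡 (m + 2)) M (j + 1)} {T : F → F [⋀^Fin (j + 1)]→L[ℝ] ℝ}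
      (q : N) (v : Fin j → EuclideanSpace ℝ (Fin (m + 1))), θ (g q) = flatPullback (𝓡 (m + 2)) e T
          (g q) →
      pullback (J := Corners (m + 1)) g (contract X θ) q v =
        contractForm T ((e ∘ g) q, w q) (fun j =>
          (mfderiv (Corners (m + 1)) 𝓘(ℝ, F × F) (fun q => ((e ∘ g) q, w q)) q (v j) : F × F)) := by
    intro j θ T q v hθ
    have e1 : pullback (J := Corners (m + 1)) g (contract X θ) q v =
        θ (g q) (Matrix.vecCons (X (g q) : EuclideanSpace ℝ (Fin (m + 2)))
          (fun j => (mfderiv (Corners (m + 1)) (𝓡 (m + 2)) g q (v j) :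
            EuclideanSpace ℝ (Fin (m + 2))))) := rfl
    rw [e1, hθ]
    refine congrArg (T (e (g q))) (funext fun i => ?_)
    refine Fin.cases (hwX q).symm (fun j => ?_) i
    exact ((hd3 q (v j)).trans (congrArg (fun A => A (v j)) (hde q))).symm
  have hpull' : ∀ {j : ℕ} {θ : DForm (𝓡 (m + 2)) M j} {T : F' → F' [⋀^Fin j]→L[ℝ] ℝ} (q : N)
      (v : Fin j → EuclideanSpace ℝ (Fin (m + 1))), θ (g q) = flatPullback (𝓡 (m + 2)) e' T (g q) →
      pullback (J := Corners (m + 1)) g θ q v = T ((e' ∘ g) q) (fun i =>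
        (mfderiv (Corners (m + 1)) 𝓘(ℝ, (F × F) × F')
          (fun q => (((e ∘ g) q, w q), (e' ∘ g) q)) q (v i) : (F × F) × F').2) := by
    intro j θ T q v hθ
    rw [pullback_flatPullback he' hg hθ]
    exact congrArg (T ((e' ∘ g) q)) (funext fun i => (hd2 q (v i)).symm)
  have h1 : pullback (J := Corners (m + 1)) g (contract X α + β) =
      flatPullback (Corners (m + 1)) (fun q => (((e ∘ g) q, w q), (e' ∘ g) q)) (fun p =>
        (contractForm Θ p.1).compContinuousLinearMap (ContinuousLinearMap.fst ℝ (F × F) F') +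
          (Θ' p.2).compContinuousLinearMap (ContinuousLinearMap.snd ℝ (F × F) F')) := by
    funext q
    ext v
    refine congrArg₂ (· + ·) ((hcontract q v (hα q).1).trans ?_)
      (hpull' q v (heq' _ (mem_range_self q)).1)
    exact congrArg (contractForm Θ ((e ∘ g) q, w q)) (funext fun j => (hd1 q (v j)).symm)
  have h2 : flatPullback (Corners (m + 1)) (fun q => ((e ∘ g) q, w q)) (lieForm Θ) =
      flatPullback (Corners (m + 1)) (fun q => (((e ∘ g) q, w q), (e' ∘ g) q)) (extDeriv fun p =>
        (contractForm Θ p.1).compContinuousLinearMap (ContinuousLinearMap.fst ℝ (F × F) F') +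
          (Θ' p.2).compContinuousLinearMap (ContinuousLinearMap.snd ℝ (F × F) F')) := by
    funext q
    ext v
    have e1 : pullback (J := Corners (m + 1)) g (contract X (extD α)) q v =
        pullback (J := Corners (m + 1)) g (extD β) q v := by rw [hXβ]
    rw [hcontract q v (hα q).2, hpull' q v (heq' _ (mem_range_self q)).2] at e1
    have e2 := extDeriv_fst_add_snd (contDiff_contractForm hΘ) hΘ' (((e ∘ g) q, w q), (e' ∘ g) q)
    refine Eq.trans ?_ (congrArg (fun A => A (fun i => (mfderiv (Corners (m + 1))
      𝓘(ℝ, (F × F) × F') (fun q => (((e ∘ g) q, w q), (e' ∘ g) q)) q (v i) : (F × F) × F')))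
      e2).symm
    refine Eq.trans (add_comm _ _) (congrArg₂ (· + ·) ?_ e1)
    exact congrArg (extDeriv (contractForm Θ) ((e ∘ g) q, w q))
      (funext fun j => (hd1 q (v j)).symm)
  rw [h1, h2, hStokes]

/-- Away from the jumps, the rate of change of `∫_{Γ_t} α` is the flux `∫_{∂Γ_t} λ`, and it is
continuous in time. -/
theorem exists_continuous_flux {α : DForm (𝓡 (m + 2)) M (m + 1)} (hα : IsC1 α)
    (hV : IsPiecewiseC1Field D V) {β : ℝ → DForm (𝓡 (m + 2)) M m}
    (hβ : IsGloballyLiouville (extD α) V β) (hφ : IsFlow D V φ) (τ : ℝ)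
    (Γ : OrientedSubmanifold (m + 1) (m + 2) M) {a b : ℝ} (hab : Disjoint (Ioo a b) D) :
    ∃ G : ℝ → ℝ, Continuous G ∧ ∀ t ∈ Ioo a b,
      edgeIntegral Γ (φ t τ) (lagrangianForm α V β t) = G t ∧
        HasDerivAt (fun s => surfaceIntegral Γ (φ s τ) α) (G t) t := by
  obtain ⟨W, hW, hVW⟩ := hV a b hab
  obtain ⟨F, _, _, _, e, Θ, he, hΘ, heq⟩ := exists_flatPullback_eq
    (isCompact_flow_image hφ Γ.toCompactSubmanifold τ a b) hα
  have hf := isC1Family_flow_emb hφ Γ.toCompactSubmanifold τ he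
  have hw := isC1Family_comp (contMDiff_flow_emb hφ Γ.toCompactSubmanifold τ)
    (continuous_tangentMap_flow_emb hφ Γ.toCompactSubmanifold τ) (contMDiff_mfderiv_field he hW)
  set f : ℝ → Γ.carrier → F := fun t => e ∘ φ t τ ∘ Γ.emb with hfdef
  set w : ℝ → Γ.carrier → F := fun t p => (mfderiv (𝓡 (m + 2)) 𝓘(ℝ, F) e ((φ t τ ∘ Γ.emb) p)
    (W t ((φ t τ ∘ Γ.emb) p)) : F) with hwdef
  have hfw : ∀ p, ∀ t ∈ Ioo a b, HasDerivAt (fun s => f s p) (w t p) t := by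
    intro p t ht
    have h1 := hasDerivAt_flow_emb hφ he τ (Γ.emb p) (fun hD => hab.ne_of_mem ht hD rfl)
    rw [hVW t ht] at h1
    exact h1
  refine ⟨fun t => formIntegral Γ.orient
    (flatPullback (Corners (m + 1)) (fun p => (f t p, w t p)) (lieForm Θ)),
    (hf.prodMk hw).continuous_formIntegral Γ.continuous_orient Γ.orient_ne_zero
      (continuous_lieForm hΘ), fun t ht => ⟨?_, ?_⟩⟩
  · have hE := boundaryIntegral_pullback_lagrangian Γ.continuous_orient Γ.orient_ne_zero
      (contMDiff_flow_emb hφ Γ.toCompactSubmanifold τ t) he hΘ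
      (fun q => heq _ ⟨(t, q), ⟨Ioo_subset_Icc_self ht, mem_univ _⟩, rfl⟩) (hw.contMDiff t)
      (X := V t) (fun q => by rw [hVW t ht]) (hβ t).1 (hβ t).2
    exact hE
  · have h1 := hasDerivAt_formIntegral_flatPullback Γ.continuous_orient Γ.orient_ne_zero hf hw hfw
      hΘ ht
    refine h1.congr_of_eventuallyEq ?_
    filter_upwards [isOpen_Ioo.mem_nhds ht] with s hs
    exact surfaceIntegral_eq hφ Γ τ s he fun q =>
      (heq _ ⟨(s, q), ⟨Ioo_subset_Icc_self hs, mem_univ _⟩, rfl⟩).1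

end Flux

/-! ### Surface area and volume -/

section Density

variable {d : ℕ} {N : Type*} [TopologicalSpace N] [T2Space N] [CompactSpace N]
  [ChartedSpace (EuclideanQuadrant d) N] [IsManifold (Corners d) ∞ N]

lemma densityIntegral_eq_formIntegral (θ : DForm (Corners d) N d) :
    densityIntegral θ = formIntegral θ θ := by
  unfold densityIntegral formIntegral frameSign
  simp only [sign_mul_self]

lemma densityIntegral_eq_sum (θ : DForm (Corners d) N d) :
    densityIntegral θ = ∑ x ∈ activeCharts d N, ∫ y in (extChartAt (Corners d) x).target,
      chartPartition d N x ((extChartAt (Corners d) x).symm y) * |localForm θ x y coordVec| := by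
  unfold densityIntegral
  rw [finsum_eq_sum_of_support_subset (s := activeCharts d N)]
  · exact Finset.sum_congr rfl fun x _ => setIntegral_toLp _
      (fun y => chartPartition d N x ((extChartAt (Corners d) x).symm y) *
        |localForm θ x y coordVec|)
  · intro x hx
    by_contra h
    apply hx
    simp only [chartPartition_eq_zero h]
    simp

lemma abs_formIntegral_le {μ : DForm (Corners d) N d} (hμ : ∀ p, μ p ≠ 0)
    (θ : DForm (Corners d) N d) : |formIntegral μ θ| ≤ densityIntegral θ := by
  rw [formIntegral_eq_sum, densityIntegral_eq_sum]
  refine (Finset.abs_sum_le_sum_abs _ _).trans (Finset.sum_le_sum fun x _ => ?_)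
  have hle := norm_integral_le_integral_norm (μ := volume.restrict (extChartAt (Corners d)
      x).target)
    (fun y => frameSign μ x y *
      localForm (fun p : N => chartPartition d N x p • θ p) x y coordVec)
  refine hle.trans_eq (setIntegral_congr_fun (measurableSet_target (d := d) x) fun y hy => ?_)
  have h1 : localForm (fun p : N => chartPartition d N x p • θ p) x y coordVec =
    chartPartition d N x ((extChartAt (Corners d) x).symm y) * localForm θ x y coordVec := rfl
  simp only [h1, Real.norm_eq_abs, abs_mul, abs_frameSign hμ hy, one_mul]
  rw [abs_of_nonneg ((chartPartition d N).nonneg x _)]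

end Density

/-! ### The fundamental theorem of calculus with finitely many exceptional times -/

lemma exists_disjoint_Ioo {D : Set ℝ} (hD : D.Finite) (t : ℝ) :
    ∃ ε > 0, Disjoint (Ioo (t - ε) t) D ∧ Disjoint (Ioo t (t + ε)) D := by
  have h1 : (D \ {t})ᶜ ∈ 𝓝 t :=
    (hD.subset sdiff_subset).isClosed.isOpen_compl.mem_nhds fun h => h.2 rfl
  obtain ⟨ε, hε, h⟩ := Metric.mem_nhds_iff.1 h1
  rw [Real.ball_eq_Ioo] at h
  refine ⟨ε, hε, Set.disjoint_left.2 fun s hs hD => ?_, Set.disjoint_left.2 fun s hs hD => ?_⟩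
  · exact h ⟨hs.1, by linarith [hs.2]⟩ ⟨hD, hs.2.ne⟩
  · exact h ⟨by linarith [hs.1], hs.2⟩ ⟨hD, hs.1.ne'⟩

/-- A function that is the restriction of a continuous function on each interval that avoids a
finite set is integrable on bounded intervals. -/
lemma intervalIntegrable_of_eqOn_continuous {D : Set ℝ} (hD : D.Finite) {E : ℝ → ℝ}
    (hE : ∀ a b, Disjoint (Ioo a b) D → ∃ G : ℝ → ℝ, Continuous G ∧ EqOn E G (Ioo a b)) (r s : ℝ) :
    IntervalIntegrable E volume r s := by
  have hint : ∀ a b, Disjoint (Ioo a b) D → IntegrableOn E (Ioo a b) := by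
    intro a b hab
    obtain ⟨G, hG, hEG⟩ := hE a b hab
    exact ((hG.integrableOn_Icc (a := a) (b := b)).mono_set Ioo_subset_Icc_self).congr_fun
      (fun t ht => (hEG ht).symm) measurableSet_Ioo
  have hloc : LocallyIntegrable E volume := by
    intro t
    obtain ⟨ε, hε, h1, h2⟩ := exists_disjoint_Ioo hD t
    refine ⟨Ioo (t - ε) (t + ε), Ioo_mem_nhds (by linarith) (by linarith), ?_⟩
    have h3 : IntegrableOn E (Ioo (t - ε) t ∪ {t} ∪ Ioo t (t + ε)) :=
      ((hint _ _ h1).union (integrableOn_singleton (hx := by rw [Real.volume_singleton]; exact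
          ENNReal.zero_lt_top))).union (hint _ _ h2)
    refine h3.mono_set fun s hs => ?_
    rcases lt_trichotomy s t with h | h | h
    · exact Or.inl (Or.inl ⟨hs.1, h⟩)
    · exact Or.inl (Or.inr h)
    · exact Or.inr ⟨h, hs.2⟩
  exact (hloc.integrableOn_isCompact isCompact_uIcc).intervalIntegrable

lemma isC0_flatPullback {E : Type*} [NormedAddCommGroup E] [NormedSpace ℝ E] {H : Type*}
    [TopologicalSpace H] {I : ModelWithCorners ℝ E H} {N : Type*} [TopologicalSpace N]
    [ChartedSpace H N] [IsManifold I 1 N] {F : Type*} [NormedAddCommGroup F] [NormedSpace ℝ F]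
    {k : ℕ} {f : N → F} (hf : ContMDiff I 𝓘(ℝ, F) 1 f) {Θ : F → F [⋀^Fin k]→L[ℝ] ℝ}
    (hΘ : Continuous Θ) : IsC0 (flatPullback I f Θ) := fun x => by
  have h1 : ContinuousOn (fun y => ContinuousAlternatingMap.compContinuousLinearMapCLM (F := ℝ)
      (ι := Fin k) (fderivWithin ℝ (coordMap I f x) (range I) y) (Θ (coordMap I f x y)))
      (extChartAt I x).target :=
    (ContinuousAlternatingMap.continuous_compContinuousLinearMapCLM.comp_continuousOn
      (continuousOn_fderivWithin_coordMap hf x)).clm_apply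
        (hΘ.comp_continuousOn (contDiffOn_coordMap hf x).continuousOn)
  exact h1.congr fun y hy => localForm_flatPullback hy (hf.mdifferentiable one_ne_zero _) Θ

section Final

variable {m : ℕ} {M : Type*} [TopologicalSpace M] [T2Space M]
  [SecondCountableTopology M] [ChartedSpace (EuclideanSpace ℝ (Fin (m + 2))) M]
  [IsManifold (𝓡 (m + 2)) ∞ M]

/-- The action-flux formula on a bounded time interval. -/
theorem integral_edgeIntegral {α : DForm (𝓡 (m + 2)) M (m + 1)} (hα : IsC1 α) {D : Set ℝ}
    (hD : D.Finite) {V : ℝ → ∀ p : M, TangentSpace (𝓡 (m + 2)) p} (hV : IsPiecewiseC1Field D V)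
    {β : ℝ → DForm (𝓡 (m + 2)) M m} (hβ : IsGloballyLiouville (extD α) V β) {φ : ℝ → ℝ → M → M}
    (hφ : IsFlow D V φ) (τ : ℝ) (Γ : OrientedSubmanifold (m + 1) (m + 2) M) (r s : ℝ) :
    IntervalIntegrable (fun s => edgeIntegral Γ (φ s τ) (lagrangianForm α V β s)) volume r s ∧
      ∫ t in r..s, edgeIntegral Γ (φ t τ) (lagrangianForm α V β t) =
        surfaceIntegral Γ (φ s τ) α - surfaceIntegral Γ (φ r τ) α := by
  have hG := fun a b (hab : Disjoint (Ioo a b) D) =>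
    exists_continuous_flux hα hV hβ hφ τ Γ hab
  have hi : IntervalIntegrable (fun s => edgeIntegral Γ (φ s τ) (lagrangianForm α V β s))
      volume r s := by
    refine intervalIntegrable_of_eqOn_continuous hD (fun a b hab => ?_) r s
    obtain ⟨G, hG1, hG2⟩ := hG a b hab
    exact ⟨G, hG1, fun t ht => (hG2 t ht).1⟩
  refine ⟨hi, integral_eq_of_hasDerivAt_off_countable (fun t => surfaceIntegral Γ (φ t τ) α) _
    hD.countable (continuous_surfaceIntegral hφ Γ τ hα).continuousOn (fun t ht => ?_) hi⟩
  have hnhds : Dᶜ ∈ 𝓝 t := hD.isClosed.isOpen_compl.mem_nhds ht.2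
  obtain ⟨ε, hε, h⟩ := Metric.mem_nhds_iff.1 hnhds
  rw [Real.ball_eq_Ioo] at h
  obtain ⟨G, hG1, hG2⟩ := hG _ _ (Set.disjoint_left.2 h)
  obtain ⟨h1, h2⟩ := hG2 t ⟨by linarith, by linarith⟩
  rw [h1]
  exact h2

/-- A submanifold of full dimension inherits a volume form. -/
lemma pullback_emb_ne_zero {n : ℕ} {M : Type*} [TopologicalSpace M]
    [ChartedSpace (EuclideanSpace ℝ (Fin n)) M] (R : CompactSubmanifold n n M)
    {Ω : DForm (𝓡 n) M n} (hΩ : ∀ p, Ω p ≠ 0) (p : R.carrier) :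
    pullback (J := Corners n) R.emb Ω p ≠ 0 := by
  intro h
  apply hΩ (R.emb p)
  let L : EuclideanSpace ℝ (Fin n) →L[ℝ] EuclideanSpace ℝ (Fin n) :=
    mfderiv (Corners n) (𝓡 n) R.emb p
  have hL : Function.Surjective L :=
    LinearMap.surjective_of_injective (f := (L : EuclideanSpace ℝ (Fin n) →ₗ[ℝ] _))
      (R.injective_mfderiv_emb p)
  ext v
  choose u hu using fun i => hL (v i)
  have h1 : pullback (J := Corners n) R.emb Ω p u = 0 := by
    rw [h]
    rfl
  have h2 : v = fun i => L (u i) := funext fun i => (hu i).symm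
  rw [h2]
  exact h1

/-- The volume of a region is the flux of `α` through its boundary. -/
lemma regionVolume_eq {α : DForm (𝓡 (m + 2)) M (m + 1)} (hα : IsC1 α)
    (hΩ : ∀ p, extD α p ≠ 0) (R : CompactSubmanifold (m + 2) (m + 2) M) :
    regionVolume (extD α) R = boundaryIntegral (pullback R.emb (extD α)) (pullback R.emb α) := by
  obtain ⟨F, _, _, _, e, Θ, he, hΘ, heq⟩ := exists_flatPullback_eq
    (isCompact_range R.contMDiff_emb.continuous) hα
  have h0 : pullback (J := Corners (m + 2)) R.emb α =
      flatPullback (Corners (m + 2)) (e ∘ R.emb) Θ :=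
    funext fun q => pullback_flatPullback he R.contMDiff_emb (heq _ (mem_range_self q)).1
  have h1 : pullback (J := Corners (m + 2)) R.emb (extD α) =
      flatPullback (Corners (m + 2)) (e ∘ R.emb) (extDeriv Θ) :=
    funext fun q => pullback_flatPullback he R.contMDiff_emb (heq _ (mem_range_self q)).2
  have hf : ContMDiff (Corners (m + 2)) 𝓘(ℝ, F) 1 (e ∘ R.emb) :=
    (he.of_le (by simp)).comp R.contMDiff_emb
  have hc : IsC0 (pullback (J := Corners (m + 2)) R.emb (extD α)) := by
    rw [h1]
    exact isC0_flatPullback hf (continuous_extDeriv hΘ)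
  have hS := formIntegral_flatPullback_extDeriv hc (pullback_emb_ne_zero R hΩ) hf hΘ
  rw [← h0, ← h1] at hS
  rw [← hS, regionVolume, densityIntegral_eq_formIntegral]

end Final

end ActionFlux
end

open ActionFlux in
theorem mainTheorem2 {m : ℕ} {M : Type*} [TopologicalSpace M] [T2Space M]
    [SecondCountableTopology M] [ChartedSpace (EuclideanSpace ℝ (Fin (m + 2))) M]
    [IsManifold (𝓡 (m + 2)) ∞ M]
    -- an exact volume form `Ω = dα`
    (Ω : DForm (𝓡 (m + 2)) M (m + 2)) (hΩ : ∀ p, Ω p ≠ 0)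
    (α : DForm (𝓡 (m + 2)) M (m + 1)) (hα : IsC1 α) (hdα : extD α = Ω)
    -- a globally Liouville vector field with a complete flow
    (D : Set ℝ) (hD : D.Finite)
    (V : ℝ → ∀ p : M, TangentSpace (𝓡 (m + 2)) p) (hV : IsPiecewiseC1Field D V)
    (β : ℝ → DForm (𝓡 (m + 2)) M m) (hβ : IsGloballyLiouville Ω V β)
    (φ : ℝ → ℝ → M → M) (hφ : IsFlow D V φ) (τ : ℝ) :
    -- the action-flux formulas for `Γ_t = φ t τ (Γ_τ)`
    (∀ Γ : OrientedSubmanifold (m + 1) (m + 2) M,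
      (∀ a b : ℝ, IntervalIntegrable
        (fun s => edgeIntegral Γ (φ s τ) (lagrangianForm α V β s)) volume a b) ∧
      (Tendsto (fun t => surfaceArea Γ (φ t τ) α) atBot (𝓝 0) →
        Tendsto (fun r => ∫ s in r..τ, edgeIntegral Γ (φ s τ) (lagrangianForm α V β s)) atBot
          (𝓝 (surfaceIntegral Γ id α))) ∧
      (Tendsto (fun t => surfaceArea Γ (φ t τ) α) atTop (𝓝 0) →
        Tendsto (fun r => -∫ s in τ..r, edgeIntegral Γ (φ s τ) (lagrangianForm α V β s)) atTop
          (𝓝 (surfaceIntegral Γ id α)))) ∧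
    -- the volume of a lobe whose boundary at time `τ` is a sum of collapsing surfaces
    (∀ (R : CompactSubmanifold (m + 2) (m + 2) M) (a b : ℕ)
      (Γp : Fin a → OrientedSubmanifold (m + 1) (m + 2) M)
      (Γf : Fin b → OrientedSubmanifold (m + 1) (m + 2) M),
      BoundaryEqSum Ω R (Sum.elim Γp Γf) →
      (∀ j, Tendsto (fun t => surfaceArea (Γp j) (φ t τ) α) atBot (𝓝 0)) →
      (∀ i, Tendsto (fun t => surfaceArea (Γf i) (φ t τ) α) atTop (𝓝 0)) →
      ∃ (Ap : Fin a → ℝ) (Af : Fin b → ℝ),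
        (∀ j, Tendsto
          (fun r => ∫ s in r..τ, edgeIntegral (Γp j) (φ s τ) (lagrangianForm α V β s)) atBot
          (𝓝 (Ap j))) ∧
        (∀ i, Tendsto
          (fun r => ∫ s in τ..r, edgeIntegral (Γf i) (φ s τ) (lagrangianForm α V β s)) atTop
          (𝓝 (Af i))) ∧
        regionVolume Ω R = (∑ j, Ap j) - (∑ i, Af i)) := by
  subst hdα
  have hFTC := integral_edgeIntegral hα hD hV hβ hφ τ
  have hτ : φ τ τ = id := funext (hφ.refl τ)
  have hzero : ∀ (Γ : OrientedSubmanifold (m + 1) (m + 2) M) (l : Filter ℝ),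
      Tendsto (fun t => surfaceArea Γ (φ t τ) α) l (𝓝 0) →
      Tendsto (fun t => surfaceIntegral Γ (φ t τ) α) l (𝓝 0) := fun Γ l h =>
    squeeze_zero_norm (fun _ => abs_formIntegral_le Γ.orient_ne_zero _) h
  have hbot : ∀ Γ : OrientedSubmanifold (m + 1) (m + 2) M,
      Tendsto (fun t => surfaceArea Γ (φ t τ) α) atBot (𝓝 0) →
      Tendsto (fun r => ∫ s in r..τ, edgeIntegral Γ (φ s τ) (lagrangianForm α V β s)) atBot
        (𝓝 (surfaceIntegral Γ id α)) := by
    intro Γ h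
    simp only [(hFTC Γ _ _).2, hτ]
    simpa using (hzero Γ _ h).const_sub (surfaceIntegral Γ id α)
  have htop : ∀ Γ : OrientedSubmanifold (m + 1) (m + 2) M,
      Tendsto (fun t => surfaceArea Γ (φ t τ) α) atTop (𝓝 0) →
      Tendsto (fun r => ∫ s in τ..r, edgeIntegral Γ (φ s τ) (lagrangianForm α V β s)) atTop
        (𝓝 (-surfaceIntegral Γ id α)) := by
    intro Γ h
    simp only [(hFTC Γ _ _).2, hτ]
    simpa using (hzero Γ _ h).sub_const (surfaceIntegral Γ id α)
  refine ⟨fun Γ => ⟨fun a b => (hFTC Γ a b).1, hbot Γ, fun h => ?_⟩,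
    fun R a b Γp Γf hR hp hf => ⟨fun j => surfaceIntegral (Γp j) id α,
      fun i => -surfaceIntegral (Γf i) id α, fun j => hbot _ (hp j), fun i => htop _ (hf i), ?_⟩⟩
  · simpa using (htop Γ h).neg
  · rw [regionVolume_eq hα hΩ R, hR α hα, Fintype.sum_sum_type]
    simp
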